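/- **Setting.** Let $p>3$ be a prime, let $f(x)=x^4+ax^2+bx+c\in\mathbb Z[x]$ be irreducible, $\theta$ a root of $f$, $K=\mathbb Q(\theta)$ with ring of integers $\mathbb Z_K$, and $\Delta:=v_p(\operatorname{disc}(f))$ (with $v_p(0)=\infty$). For $s\in\mathbb Z$ write $f(x)=\sum_i a_i(x-s)^i$ and $w_i=v_p(a_i)$. The $(x-s)$-Newton polygon of $f$ is the lower convex envelope of the points $(i,w_i)$ with $w_i<\infty$. For $0\le i\le 4$ let $c_i\in\mathbb F_p$ be the class of $a_i/p^{w_i}$ if $(i,w_i)$ lies on the polygon, and $c_i=0$ otherwise. To a side of negative slope $-h/e$ ($h,e$ positive and coprime), from abscissa $i$ to abscissa $i+de$, one attaches the residual polynomial $c_i+c_{i+e}y+\cdots+c_{i+de}y^d\in\mathbb F_p[y]$. The integer $s$ is *regular* if the residual polynomials of all sides of negative slope are separable, and *irregular* otherwise. The *iteration method* replaces an irregular $s$ by $t=s+yp^{\delta}$, where $-\delta\in\mathbb Z$ is the slope of a side of negative slope with inseparable residual polynomial, and $y$ is any integer whose class modulo $p$ is a multiple root of that residual polynomial; it is repeated until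 a regular integer is reached. A family $\alpha_1,\dots,\alpha_4\in\mathbb Z_K$ is a *$p$-integral basis* of $K$ if it is a $\mathbb Z_{(p)}$-basis of $\mathbb Z_K\otimes\mathbb Z_{(p)}$. **Statement.** Let $s_0$ be an integer not divisible by $p$ such that $$a\equiv-6s_0^2,\qquad b\equiv 8s_0^3,\qquad c\equiv-3s_0^4\pmod p$$ (equivalently $f(x)\equiv(x-s_0)^3(x+3s_0)\pmod p$ with $p\nmid s_0$), and such that $v_p(a+6s_0^2)=v_p(f''(s_0)/2)>\Delta/6$. Put $u_0=v_p(f(s_0))$, $u_1=v_p(f'(s_0))\in\mathbb Z\cup\{\infty\}$, $\sigma_0=f(s_0)/p^{u_0}$ and, if $u_1<\infty$, $\sigma_1=f'(s_0)/p^{u_1}$. 1. The integer $s_0$ is irregular if and only if $2u_0=3u_1$ and $p\mid\sigma_1^3+27s_0\sigma_0^2$. 2. If $s_0$ is regular, take $s=s_0$. If $s_0$ is irregular, apply the iteration method to $s_0$: a step is possible from every irregular integer reached, and for every choice of the integers $y$ the method arrives after finitely many steps at a regular integer $s$. In all cases $$1,\quad\theta,\quad\frac{\theta^2+2s\theta+3s^2+a}{p^{\nu_2}},\quad\frac{\theta^3+s\theta^2+(s^2+a)\theta+s^3+as+b}{p^{\nu_1}}$$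 is a $p$-integral basis of $K$, where $\nu_i=\lfloor y_i\rfloor$ and $y_i$ is the ordinate of the point of abscissa $i$ on the $(x-s)$-Newton polygon of $f$ $(i=1,2)$; and these exponents are $$(\nu_1,\nu_2)=\begin{cases}\left(\lfloor 2u_0/3\rfloor,\ \lfloor u_0/3\rfloor\right)&\text{if }2u_0<3u_1,\\[2pt]\left(\lfloor(\Delta-u_1)/2\rfloor,\ \lfloor u_1/2\rfloor\right)&\text{if }2u_0\ge 3u_1.\end{cases}$$ -/

import Mathlib

open Polynomial

noncomputable section

namespace OreQuartic

/-! Newton polygons of `F ∈ ℤ[x]` with respect to the linear polynomial `x - s`.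
The `(x - s)`-adic development of `F` is `F = ∑ aᵢ (x - s) ^ i`, where `aᵢ` is the `i`-th coefficient
of the Taylor expansion of `F` at `s`; here the residue field attached to `x - s` is `ZMod p`. -/

/-- The `i`-th coefficient of the `(x - s)`-adic development of `F`. -/
def devCoeff (F : ℤ[X]) (s : ℤ) (i : ℕ) : ℤ :=
  (taylor s F).coeff i

/-- The `p`-adic value `uᵢ` of the `i`-th coefficient (only used when that coefficient is nonzero). -/
def devVal (p : ℕ) (F : ℤ[X]) (s : ℤ) (i : ℕ) : ℕ :=
  padicValInt p (devCoeff F s i)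

/-- The points `(i, uᵢ)` of the plane with `uᵢ < ∞`. -/
def newtonPoints (p : ℕ) (F : ℤ[X]) (s : ℤ) : Set (ℝ × ℝ) :=
  {P | ∃ i : ℕ, devCoeff F s i ≠ 0 ∧ P = ((i : ℝ), (devVal p F s i : ℝ))}

/-- The `(x - s)`-Newton polygon of `F`, as the function giving the ordinate at each abscissa:
the lower boundary of the convex hull of the points `(i, uᵢ)`. -/
def newtonPolygon (p : ℕ) (F : ℤ[X]) (s : ℤ) (x : ℝ) : ℝ :=
  sInf {y : ℝ | (x, y) ∈ convexHull ℝ (newtonPoints p F s)}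

/-- The segment with end points `(i, uᵢ)` and `(j, uⱼ)`, `i < j`, is a side of the Newton polygon:
all points `(k, uₖ)` lie on or above the line through these two points, and those with abscissa
outside `[i, j]` lie strictly above it. -/
def IsSide (p : ℕ) (F : ℤ[X]) (s : ℤ) (i j : ℕ) : Prop :=
  i < j ∧ devCoeff F s i ≠ 0 ∧ devCoeff F s j ≠ 0 ∧
    ∀ k : ℕ, devCoeff F s k ≠ 0 →
      ((devVal p F s j : ℤ) - devVal p F s i) * ((k : ℤ) - i)
          ≤ ((devVal p F s k : ℤ) - devVal p F s i) * ((j : ℤ) - i) ∧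
      ((k < i ∨ j < k) →
        ((devVal p F s j : ℤ) - devVal p F s i) * ((k : ℤ) - i)
          < ((devVal p F s k : ℤ) - devVal p F s i) * ((j : ℤ) - i))

/-- A side of negative slope, that is, a side of the principal polygon. -/
def IsPrincipalSide (p : ℕ) (F : ℤ[X]) (s : ℤ) (i j : ℕ) : Prop :=
  IsSide p F s i j ∧ devVal p F s j < devVal p F s i

open Classical in
/-- The residual coefficient at the abscissa `k`: the class modulo `p` of `aₖ / p ^ uₖ` if `(k, uₖ)`
lies on the Newton polygon, and zero otherwise. -/
def residualCoeff (p : ℕ) (F : ℤ[X]) (s : ℤ) (k : ℕ) : ZMod p :=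
  if devCoeff F s k ≠ 0 ∧ (devVal p F s k : ℝ) = newtonPolygon p F s k then
    ((devCoeff F s k / (p : ℤ) ^ devVal p F s k : ℤ) : ZMod p)
  else 0

/-- The degree `d` of a principal side from abscissa `i` to abscissa `j`: its length `j - i` divided
by the denominator `e` of its slope in lowest terms. -/
def sideDegree (p : ℕ) (F : ℤ[X]) (s : ℤ) (i j : ℕ) : ℕ :=
  Nat.gcd (j - i) (devVal p F s i - devVal p F s j)

/-- The residual polynomial `∑ c_{i + k e} y ^ k`, `0 ≤ k ≤ d`, of a principal side from abscissa `i`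
to abscissa `j`. -/
def residualPoly (p : ℕ) (F : ℤ[X]) (s : ℤ) (i j : ℕ) : (ZMod p)[X] :=
  ∑ k ∈ Finset.range (sideDegree p F s i j + 1),
    C (residualCoeff p F s (i + k * ((j - i) / sideDegree p F s i j))) * X ^ k

/-- `s` is regular for `F` if the residual polynomial of every side of the principal
`(x - s)`-Newton polygon of `F` is separable; otherwise `s` is irregular. -/
def IsRegular (p : ℕ) (F : ℤ[X]) (s : ℤ) : Prop :=
  ∀ i j : ℕ, IsPrincipalSide p F s i j → (residualPoly p F s i j).Separable

/-- One step `s ↦ t = s + y p ^ δ` of the iteration method: `-δ` is the slope of a principal side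
with inseparable residual polynomial, and `y` is any integer whose class modulo `p` is a multiple
root of that polynomial. In particular there is no step starting at a regular `s`. -/
def IterStep (p : ℕ) (F : ℤ[X]) (s t : ℤ) : Prop :=
  ∃ (i j δ : ℕ) (y : ℤ), IsPrincipalSide p F s i j ∧
    ¬ (residualPoly p F s i j).Separable ∧
    devVal p F s i = devVal p F s j + δ * (j - i) ∧
    (X - C (y : ZMod p)) ^ 2 ∣ residualPoly p F s i j ∧
    t = s + y * (p : ℤ) ^ δ

/-- A finite family of elements of the ring of integers of `K` is a `p`-integral basis if it is a
basis of `ℤ_K ⊗ ℤ_(p)` over `ℤ_(p)`: it is linearly independent, and every algebraic integer of `K`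
becomes an integral combination of the family after multiplication by an integer prime to `p`. -/
def IsPIntegralBasis (p : ℕ) {K : Type*} [Field K] {ι : Type*} (α : ι → K) : Prop :=
  (∀ i, IsIntegral ℤ (α i)) ∧ LinearIndependent ℤ α ∧
    ∀ x : K, IsIntegral ℤ x →
      ∃ m : ℤ, ¬ (p : ℤ) ∣ m ∧ m • x ∈ Submodule.span ℤ (Set.range α)

/-- The quartic polynomial `x⁴ + a x² + b x + c`. -/
def quartic (a b c : ℤ) : ℤ[X] :=
  X ^ 4 + C a * X ^ 2 + C b * X + C c

/-- The family `1, θ, (θ² + 2sθ + 3s² + a) / p ^ ν₂, (θ³ + sθ² + (s² + a)θ + s³ + as + b) / p ^ ν₁`. -/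
def tripleBasis (p : ℕ) {K : Type*} [Field K] (θ : K) (a b s ν₁ ν₂ : ℤ) : Fin 4 → K :=
  ![1, θ,
    (θ ^ 2 + 2 * (s : K) * θ + 3 * (s : K) ^ 2 + (a : K)) / (p : K) ^ ν₂,
    (θ ^ 3 + (s : K) * θ ^ 2 + ((s : K) ^ 2 + (a : K)) * θ
      + (s : K) ^ 3 + (a : K) * (s : K) + (b : K)) / (p : K) ^ ν₁]

end OreQuartic

end

/-! ### Coefficients of the development and the Sylvester determinant -/

namespace OreQuartic

/-! Write A_i for the coefficients of the development at s, w_i for their values, z = θ - s. Modulo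
p the root s is triple: A_3 = 4s is a unit and p divides A_0, A_1, A_2, so the principal polygon
lives on [0, 3]. The discriminant is A_3² times the discriminant of the cubic A_3z³ + A_2z² + A_1z +
A_0, plus terms of higher weight (`discr_quartic_eq_devCoeff`, `pow_dvd_discr_tail`). Comparing its
value with the polygon gives all the exponents.

At s_0, the bound Δ < 6w_2 puts the point of abscissa 2 strictly above the polygon (`TwoAbove`).
Only a side from 0 to 3, with residual polynomial 4sy³ + σ_1y + σ_0, can then be inseparable; its
discriminant is the criterion. A double root y is nonzero, so the shift by yp^δ creates the term
12syp^δ in A_2: afterwards w_2 = δ exactly, and the points of abscissas 0 and 1 have moved up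
(`IsIterate`). From then on (2, δ) is a vertex and only a side from 0 to 2 can be inseparable. Each
further step keeps δ and raises w_0, while the discriminant bounds w_0 at irregular integers, so the
method stops. At a regular iterate the leading part A_3²A_2²(A_1² - 4A_2A_0) does not cancel, whence
Δ = 2δ + 2y_1, with 2δ = u_1.

Ore's theorem is proved through the trace form. At a place above p where z has positive value l, the
terms of minimal value in f(z) = 0 must cancel, so they form a side of slope -l; its residual
polynomial has a simple root there, and the value of zf'(θ) is exactly that minimum
(`exists_map_sum_natCast_mul_eq`). By Euler's formula the coordinates of x along the quotients of f
by z - X are traces of x zⁱ/f'(θ) (`eq_sum_trace`). Multiplied by p^ν, these are p-integral because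
p^(ν+1) zⁱ/f'(θ) is small at every place above p (`exists_dvd_trace`). The divided quotients are
integral because each is, up to sign, either of two complementary parts of the development divided
by a power of z (`map_quotient_le`). -/

theorem quartic_natDegree (a b c : ℤ) : (quartic a b c).natDegree = 4 := by
  unfold quartic
  compute_degree!

theorem quartic_monic (a b c : ℤ) : (quartic a b c).Monic := by
  unfold quartic
  monicity!

theorem quartic_eval (a b c s : ℤ) :
    (quartic a b c).eval s = s ^ 4 + a * s ^ 2 + b * s + c := by
  simp [quartic]

theorem quartic_derivative_eval (a b c s : ℤ) :
    (derivative (quartic a b c)).eval s = 4 * s ^ 3 + 2 * a * s + b := by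
  simp [quartic]
  ring

theorem taylor_quartic (a b c s : ℤ) :
    taylor s (quartic a b c) = X ^ 4 + C (4 * s) * X ^ 3 + C (6 * s ^ 2 + a) * X ^ 2 +
      C (4 * s ^ 3 + 2 * a * s + b) * X + C (s ^ 4 + a * s ^ 2 + b * s + c) := by
  simp only [quartic, map_add, taylor_mul, taylor_C, taylor_X, taylor_pow]
  simp only [map_mul, map_pow, C_ofNat]
  ring

theorem devCoeff_quartic (a b c s : ℤ) :
    devCoeff (quartic a b c) s 0 = s ^ 4 + a * s ^ 2 + b * s + c ∧
    devCoeff (quartic a b c) s 1 = 4 * s ^ 3 + 2 * a * s + b ∧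
    devCoeff (quartic a b c) s 2 = 6 * s ^ 2 + a ∧
    devCoeff (quartic a b c) s 3 = 4 * s ∧
    devCoeff (quartic a b c) s 4 = 1 ∧
    ∀ k, 4 < k → devCoeff (quartic a b c) s k = 0 := by
  unfold devCoeff
  refine ⟨?_, ?_, ?_, ?_, ?_, fun k hk ↦ coeff_eq_zero_of_natDegree_lt ?_⟩
  on_goal 6 => rwa [natDegree_taylor, quartic_natDegree]
  all_goals
    rw [taylor_quartic]
    simp only [coeff_add, coeff_C_mul, coeff_X_pow, coeff_X, coeff_C]
    norm_num

theorem discr_quartic (a b c : ℤ) :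
    (quartic a b c).discr = 16 * a ^ 4 * c - 4 * a ^ 3 * b ^ 2 - 128 * a ^ 2 * c ^ 2
      + 144 * a * b ^ 2 * c - 27 * b ^ 4 + 256 * c ^ 3 := by
  have hf := quartic_natDegree a b c
  have h0 : (quartic a b c).coeff 0 = c := by
    simp only [quartic, coeff_add, coeff_C_mul, coeff_X_pow, coeff_X, coeff_C]; norm_num
  have h1 : (quartic a b c).coeff 1 = b := by
    simp only [quartic, coeff_add, coeff_C_mul, coeff_X_pow, coeff_X, coeff_C]; norm_num
  have h2 : (quartic a b c).coeff 2 = a := by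
    simp only [quartic, coeff_add, coeff_C_mul, coeff_X_pow, coeff_X, coeff_C]; norm_num
  have h3 : (quartic a b c).coeff 3 = 0 := by
    simp only [quartic, coeff_add, coeff_C_mul, coeff_X_pow, coeff_X, coeff_C]; norm_num
  have h4 : (quartic a b c).coeff 4 = 1 := by
    simp only [quartic, coeff_add, coeff_C_mul, coeff_X_pow, coeff_X, coeff_C]; norm_num
  -- Gives the Sylvester matrix the literal size 7, so that it can be written out and expanded.
  let e : Fin ((quartic a b c).natDegree - 1 + (quartic a b c).natDegree) ≃ Fin 7 :=
    finCongr (by rw [hf])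
  have hM : (quartic a b c).sylvesterDeriv.reindex e e =
      !![c, 0, 0, b,     0,     0,     0;
         b, c, 0, 2 * a, b,     0,     0;
         a, b, c, 0,     2 * a, b,     0;
         0, a, b, 4,     0,     2 * a, b;
         1, 0, a, 0,     4,     0,     2 * a;
         0, 1, 0, 0,     0,     4,     0;
         0, 0, 1, 0,     0,     0,     4] := by
    ext ⟨i, hi⟩ ⟨j, hj⟩
    simp only [e, sylvesterDeriv, hf, OfNat.ofNat_ne_zero, ↓reduceDIte, sylvester, Fin.addCases,
      Nat.add_one_sub_one, Fin.val_castLT, Set.mem_Icc, Fin.val_fin_le, Fin.val_subNat,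
      Fin.val_cast, tsub_le_iff_right, coeff_derivative, eq_rec_constant, dite_eq_ite,
      Nat.reduceMul, Nat.reduceSub, Nat.cast_ofNat, Matrix.reindex_apply, finCongr_symm,
      Matrix.submatrix_apply, finCongr_apply, Fin.cast_mk, Matrix.updateRow_apply, Fin.mk.injEq,
      Matrix.of_apply, Fin.mk_le_mk]
    interval_cases i <;> interval_cases j <;> simp [h0, h1, h2, h3, h4, mul_comm]
  rw [discr, ← Matrix.det_reindex_self e, hM, hf]
  simp [Matrix.det_succ_row_zero (n := 6), Matrix.det_succ_row_zero (n := 5),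
    Matrix.det_succ_row_zero (n := 4), Matrix.det_succ_row_zero (n := 3), Fin.succAbove,
    Matrix.det_fin_three, Fin.sum_univ_succ]
  ring

end OreQuartic

/-! ### The discriminant in shifted coefficients -/

namespace OreQuartic

/-- The discriminant is invariant under translation. The terms are grouped so that A₃² times the
discriminant of the cubic part comes first; which of those dominates depends on the shape of the
polygon. -/
theorem discr_quartic_eq_devCoeff (a b c s : ℤ) {A₀ A₁ A₂ A₃ : ℤ}
    (h₀ : devCoeff (quartic a b c) s 0 = A₀) (h₁ : devCoeff (quartic a b c) s 1 = A₁)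
    (h₂ : devCoeff (quartic a b c) s 2 = A₂) (h₃ : devCoeff (quartic a b c) s 3 = A₃) :
    (quartic a b c).discr = A₃ ^ 2 * (A₂ ^ 2 * (A₁ ^ 2 - 4 * A₂ * A₀))
      - A₃ ^ 3 * (27 * A₃ * A₀ ^ 2 + 4 * A₁ ^ 3) + 18 * A₃ ^ 3 * A₂ * A₁ * A₀
      + 256 * A₀ ^ 3 - 192 * A₃ * A₁ * A₀ ^ 2 - 128 * A₂ ^ 2 * A₀ ^ 2 + 144 * A₂ * A₁ ^ 2 * A₀
      - 27 * A₁ ^ 4 + 144 * A₃ ^ 2 * A₂ * A₀ ^ 2 - 6 * A₃ ^ 2 * A₁ ^ 2 * A₀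
      - 80 * A₃ * A₂ ^ 2 * A₁ * A₀ + 18 * A₃ * A₂ * A₁ ^ 3 + 16 * A₂ ^ 4 * A₀
      - 4 * A₂ ^ 3 * A₁ ^ 2 := by
  obtain ⟨e₀, e₁, e₂, e₃, -, -⟩ := devCoeff_quartic a b c s
  rw [discr_quartic, ← h₀, ← h₁, ← h₂, ← h₃, e₀, e₁, e₂, e₃]
  ring

/-- By Gauss's lemma the quartic is irreducible over ℚ, hence coprime to its derivative, so the
resultant cannot vanish. -/
theorem discr_quartic_ne_zero {a b c : ℤ} (h : Irreducible (quartic a b c)) :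
    (quartic a b c).discr ≠ 0 := by
  have hm := quartic_monic a b c
  have hd := quartic_natDegree a b c
  have hq : Irreducible ((quartic a b c).map (algebraMap ℤ ℚ)) :=
    (hm.irreducible_iff_irreducible_map_fraction_map).1 h
  have hsep := hq.separable
  rw [Polynomial.Separable] at hsep
  have hdeg : 0 < (quartic a b c).degree := by
    rw [← natDegree_pos_iff_degree_pos, hd]; norm_num
  have hr := resultant_deriv hdeg
  intro h0
  rw [h0, mul_zero] at hr
  have h1 : resultant ((quartic a b c).map (algebraMap ℤ ℚ))
      (derivative ((quartic a b c).map (algebraMap ℤ ℚ))) = 0 := by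
    have hn : (derivative ((quartic a b c).map (algebraMap ℤ ℚ))).natDegree = 4 - 1 := by
      rw [natDegree_derivative, hm.natDegree_map, hd]
    rw [hn, hm.natDegree_map, hd, derivative_map, resultant_map_map]
    rw [hd] at hr
    rw [hr, map_zero]
  exact (resultant_eq_zero_iff.1 h1).2 hsep

theorem devCoeff_zero_ne_zero {a b c : ℤ} (h : Irreducible (quartic a b c)) (s : ℤ) :
    devCoeff (quartic a b c) s 0 ≠ 0 := by
  intro h0
  have hroot : (quartic a b c).IsRoot s := by
    rw [IsRoot, quartic_eval, ← (devCoeff_quartic a b c s).1, h0]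
  obtain ⟨g, hg⟩ := dvd_iff_isRoot.2 hroot
  have hdeg := quartic_natDegree a b c
  rcases h.isUnit_or_isUnit hg with hu | hu
  · exact not_isUnit_X_sub_C s hu
  · have hg0 : g.natDegree = 0 := natDegree_eq_zero_of_isUnit hu
    have : (quartic a b c).natDegree ≤ 1 := by
      rw [hg]
      refine natDegree_mul_le.trans ?_
      rw [natDegree_X_sub_C, hg0]
    omega

/-! ### Supporting lines and the Newton polygon -/

section polygon

variable {p : ℕ} {F : ℤ[X]} {s : ℤ}

/-- A line lying below all points `(k, uₖ)` lies below their convex hull. -/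
theorem le_of_mem_convexHull_newtonPoints {α β : ℝ}
    (h : ∀ k, devCoeff F s k ≠ 0 → α + β * k ≤ devVal p F s k) {P : ℝ × ℝ}
    (hP : P ∈ convexHull ℝ (newtonPoints p F s)) : α + β * P.1 ≤ P.2 := by
  have hconv : Convex ℝ {P : ℝ × ℝ | α + β * P.1 ≤ P.2} := by
    intro P hP Q hQ u v hu hv huv
    simp only [Set.mem_ofPred_eq, Prod.fst_add, Prod.smul_fst, smul_eq_mul, Prod.snd_add,
      Prod.smul_snd] at *
    have : α = u * α + v * α := by rw [← add_mul, huv, one_mul]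
    nlinarith [mul_le_mul_of_nonneg_left hP hu, mul_le_mul_of_nonneg_left hQ hv]
  refine convexHull_min ?_ hconv hP
  rintro _ ⟨k, hk, rfl⟩
  exact h k hk

theorem mem_convexHull_of_le_of_le {α β x : ℝ} {i j : ℕ}
    (hi : devCoeff F s i ≠ 0) (hj : devCoeff F s j ≠ 0)
    (hwi : (devVal p F s i : ℝ) = α + β * i) (hwj : (devVal p F s j : ℝ) = α + β * j)
    (hix : i ≤ x) (hxj : x ≤ j) : (x, α + β * x) ∈ convexHull ℝ (newtonPoints p F s) := by
  have hPi : ((i : ℝ), (devVal p F s i : ℝ)) ∈ convexHull ℝ (newtonPoints p F s) :=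
    subset_convexHull ℝ _ ⟨i, hi, rfl⟩
  have hPj : ((j : ℝ), (devVal p F s j : ℝ)) ∈ convexHull ℝ (newtonPoints p F s) :=
    subset_convexHull ℝ _ ⟨j, hj, rfl⟩
  rcases eq_or_lt_of_le (hix.trans hxj) with hij | hij
  · have : x = i := by linarith
    rw [this, ← hwi]
    exact hPi
  · have hne : (j : ℝ) - i ≠ 0 := by linarith
    have := (convex_convexHull ℝ (newtonPoints p F s)) hPi hPj
      (a := ((j : ℝ) - x) / (j - i)) (b := (x - i) / (j - i))
      (div_nonneg (by linarith) (by linarith)) (div_nonneg (by linarith) (by linarith))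
      (by field_simp; ring)
    convert this using 1
    ext
    · simp only [Prod.smul_mk, Prod.mk_add_mk, smul_eq_mul]
      field_simp
      ring
    · simp only [Prod.smul_mk, Prod.mk_add_mk, smul_eq_mul, hwi, hwj]
      field_simp
      ring

theorem newtonPolygon_le {x y : ℝ} (h : (x, y) ∈ convexHull ℝ (newtonPoints p F s)) :
    newtonPolygon p F s x ≤ y := by
  refine csInf_le ⟨0, fun z hz ↦ ?_⟩ h
  simpa using le_of_mem_convexHull_newtonPoints (α := 0) (β := 0) (by intros; simp) hz

theorem le_newtonPolygon {x y α β : ℝ} (hy : (x, y) ∈ convexHull ℝ (newtonPoints p F s))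
    (h : ∀ k, devCoeff F s k ≠ 0 → α + β * k ≤ devVal p F s k) :
    α + β * x ≤ newtonPolygon p F s x :=
  le_csInf ⟨y, hy⟩ fun _ hz ↦ le_of_mem_convexHull_newtonPoints h hz

/-- The Newton polygon along a supporting line through two of the points. -/
theorem newtonPolygon_eq {α β x : ℝ} {i j : ℕ}
    (h : ∀ k, devCoeff F s k ≠ 0 → α + β * k ≤ devVal p F s k)
    (hi : devCoeff F s i ≠ 0) (hj : devCoeff F s j ≠ 0)
    (hwi : (devVal p F s i : ℝ) = α + β * i) (hwj : (devVal p F s j : ℝ) = α + β * j)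
    (hix : i ≤ x) (hxj : x ≤ j) : newtonPolygon p F s x = α + β * x :=
  le_antisymm (newtonPolygon_le (mem_convexHull_of_le_of_le hi hj hwi hwj hix hxj))
    (le_newtonPolygon (mem_convexHull_of_le_of_le hi hj hwi hwj hix hxj) h)

theorem IsSide.newtonPolygon_eq {i j : ℕ} (h : IsSide p F s i j) {x : ℝ} (hix : i ≤ x)
    (hxj : x ≤ j) : newtonPolygon p F s x =
      devVal p F s i + ((devVal p F s j : ℝ) - devVal p F s i) / ((j : ℝ) - i) * (x - i) := by
  obtain ⟨hij, hi, hj, hk⟩ := h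
  have hpos : (0 : ℝ) < (j : ℝ) - i := by
    rw [sub_pos]; exact_mod_cast hij
  set β := ((devVal p F s j : ℝ) - devVal p F s i) / ((j : ℝ) - i) with hβ
  have hβ' : β * ((j : ℝ) - i) = (devVal p F s j : ℝ) - devVal p F s i := by
    rw [hβ]; field_simp
  rw [OreQuartic.newtonPolygon_eq (α := devVal p F s i - β * i) (β := β) (i := i) (j := j) ?_ hi hj
    (by ring) (by linarith) hix hxj]
  · ring
  · intro k hk0
    have h1 := (hk k hk0).1
    have h2 : ((devVal p F s j : ℝ) - devVal p F s i) * ((k : ℝ) - i)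
          ≤ ((devVal p F s k : ℝ) - devVal p F s i) * ((j : ℝ) - i) := by exact_mod_cast h1
    rw [← hβ'] at h2
    have h3 : (β * ((k : ℝ) - i)) * ((j : ℝ) - i)
      ≤ ((devVal p F s k : ℝ) - devVal p F s i) * ((j : ℝ) - i) := by linarith
    have := le_of_mul_le_mul_right h3 hpos
    linarith

-- Turns membership in the real convex envelope into an integer collinearity condition, which
-- arithmetic tactics can decide.
open Classical in
theorem IsSide.residualCoeff_eq {i j k : ℕ} (h : IsSide p F s i j) (hik : i ≤ k) (hkj : k ≤ j) :
    residualCoeff p F s k = if devCoeff F s k ≠ 0 ∧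
      ((devVal p F s j : ℤ) - devVal p F s i) * ((k : ℤ) - i)
        = ((devVal p F s k : ℤ) - devVal p F s i) * ((j : ℤ) - i)
      then ((devCoeff F s k / (p : ℤ) ^ devVal p F s k : ℤ) : ZMod p) else 0 := by
  have hpos : (0 : ℝ) < (j : ℝ) - i := by
    rw [sub_pos]; exact_mod_cast h.1
  unfold residualCoeff
  rw [h.newtonPolygon_eq (by exact_mod_cast hik) (by exact_mod_cast hkj)]
  refine if_congr (and_congr_right fun _ ↦ ?_) rfl rfl
  rw [← @Int.cast_inj ℝ]
  push_cast
  constructor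
  · intro h'
    rw [h']
    field_simp
    ring
  · intro h'
    have : ((devVal p F s j : ℝ) - devVal p F s i) / ((j : ℝ) - i) * ((k : ℝ) - i) =
      ((devVal p F s k : ℝ) - devVal p F s i) := by
      rw [div_mul_eq_mul_div, h']
      field_simp
    rw [this]
    ring

end polygon

end OreQuartic

/-! ### Valuations at a triple root modulo p -/

namespace OreQuartic

/-- The standing situation: `f = x⁴ + a x² + b x + c` is irreducible and
`f ≡ (x - s)³ (x + 3 s)` modulo the prime `p > 3`, which does not divide `s`. -/
structure IsTripleRoot (p : ℕ) (a b c s : ℤ) : Prop where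
  prime : p.Prime
  three_lt : 3 < p
  irr : Irreducible (quartic a b c)
  not_dvd : ¬ (p : ℤ) ∣ s
  dvd_zero : (p : ℤ) ∣ devCoeff (quartic a b c) s 0
  dvd_one : (p : ℤ) ∣ devCoeff (quartic a b c) s 1
  dvd_two : (p : ℤ) ∣ devCoeff (quartic a b c) s 2

section valuation

variable {p : ℕ}

theorem intCast_ne_zero_iff {x : ℤ} : (x : ZMod p) ≠ 0 ↔ ¬ (p : ℤ) ∣ x :=
  not_congr (ZMod.intCast_zmod_eq_zero_iff_dvd x p)

theorem pow_dvd_iff_le_padicValInt (hp : p.Prime) {A : ℤ} (hA : A ≠ 0) {n : ℕ} :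
    (p : ℤ) ^ n ∣ A ↔ n ≤ padicValInt p A := by
  have := Fact.mk hp
  rw [padicValInt_dvd_iff]
  simp [hA]

theorem not_dvd_div_pow (hp : p.Prime) {A : ℤ} (hA : A ≠ 0) :
    ¬ (p : ℤ) ∣ A / (p : ℤ) ^ padicValInt p A := by
  have := Fact.mk hp
  intro h
  have h1 : (p : ℤ) ^ padicValInt p A ∣ A := (pow_dvd_iff_le_padicValInt hp hA).2 le_rfl
  obtain ⟨d, hd⟩ := h
  have h2 : (p : ℤ) ^ (padicValInt p A + 1) ∣ A := by
    refine ⟨d, ?_⟩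
    rw [pow_succ, mul_assoc, ← hd, Int.mul_ediv_cancel' h1]
  have := (pow_dvd_iff_le_padicValInt hp hA).1 h2
  omega

theorem pow_mul_div_pow (p : ℕ) (A : ℤ) :
    (p : ℤ) ^ padicValInt p A * (A / (p : ℤ) ^ padicValInt p A) = A := by
  exact Int.mul_ediv_cancel' (padicValInt_dvd A)

/-- Reads a valuation off a leading term; all exact values of A₂ at iterates and of the discriminant
are obtained this way. -/
theorem padicValInt_eq_of_dvd_sub (hp : p.Prime) {D M : ℤ} {n : ℕ} (hM : ¬ (p : ℤ) ∣ M)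
    (h : (p : ℤ) ^ (n + 1) ∣ D - (p : ℤ) ^ n * M) : padicValInt p D = n := by
  have hp0 : (p : ℤ) ≠ 0 := by exact_mod_cast hp.ne_zero
  obtain ⟨N, hN⟩ := h
  have hD : D = (p : ℤ) ^ n * (M + p * N) := by
    rw [pow_succ] at hN
    linarith
  have hnd : ¬ (p : ℤ) ∣ M + p * N := fun h ↦ hM ((Int.dvd_iff_dvd_of_dvd_add h).2 ⟨N, rfl⟩)
  have hD0 : D ≠ 0 := by
    rw [hD]
    refine mul_ne_zero (pow_ne_zero _ hp0) fun h ↦ hnd (by rw [h]; exact dvd_zero _)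
  refine le_antisymm ?_ ((pow_dvd_iff_le_padicValInt hp hD0).1 ⟨_, hD⟩)
  by_contra hlt
  have : (p : ℤ) ^ (n + 1) ∣ D := (pow_dvd_iff_le_padicValInt hp hD0).2 (by omega)
  rw [hD, pow_succ] at this
  exact hnd ((mul_dvd_mul_iff_left (pow_ne_zero n hp0)).1 this)

theorem pow_dvd_mul_pow {q A₀ A₁ A₂ : ℤ} {x₀ x₁ x₂ n : ℕ} (h₀ : q ^ x₀ ∣ A₀) (h₁ : q ^ x₁ ∣ A₁)
    (h₂ : q ^ x₂ ∣ A₂) (i j k : ℕ) (hn : n ≤ k * x₂ + j * x₁ + i * x₀) :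
    q ^ n ∣ A₂ ^ k * A₁ ^ j * A₀ ^ i := by
  refine (pow_dvd_pow q hn).trans ?_
  rw [pow_add, pow_add, mul_comm k, mul_comm j, mul_comm i, pow_mul, pow_mul, pow_mul]
  exact mul_dvd_mul (mul_dvd_mul (pow_dvd_pow_of_dvd h₂ k) (pow_dvd_pow_of_dvd h₁ j))
    (pow_dvd_pow_of_dvd h₀ i)

/-- The terms of the discriminant which involve the leading coefficient. -/
theorem pow_dvd_discr_tail {q A₀ A₁ A₂ : ℤ} (A₃ : ℤ) {x₀ x₁ x₂ n : ℕ} (h₀ : q ^ x₀ ∣ A₀)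
    (h₁ : q ^ x₁ ∣ A₁) (h₂ : q ^ x₂ ∣ A₂) (n₁ : n ≤ 3 * x₀) (n₂ : n ≤ x₁ + 2 * x₀)
    (n₃ : n ≤ x₂ + 2 * x₀) (n₄ : n ≤ 2 * x₁ + x₀) (n₅ : n ≤ 4 * x₁) (n₆ : n ≤ 2 * x₂ + x₁ + x₀)
    (n₇ : n ≤ x₂ + 3 * x₁) (n₈ : n ≤ 4 * x₂ + x₀) (n₉ : n ≤ 3 * x₂ + 2 * x₁) :
    q ^ n ∣ 256 * A₀ ^ 3 - 192 * A₃ * A₁ * A₀ ^ 2 - 128 * A₂ ^ 2 * A₀ ^ 2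
      + 144 * A₂ * A₁ ^ 2 * A₀
      - 27 * A₁ ^ 4 + 144 * A₃ ^ 2 * A₂ * A₀ ^ 2 - 6 * A₃ ^ 2 * A₁ ^ 2 * A₀
      - 80 * A₃ * A₂ ^ 2 * A₁ * A₀ + 18 * A₃ * A₂ * A₁ ^ 3 + 16 * A₂ ^ 4 * A₀
      - 4 * A₂ ^ 3 * A₁ ^ 2 := by
  have t := @pow_dvd_mul_pow q A₀ A₁ A₂ x₀ x₁ x₂ n h₀ h₁ h₂
  have e : 256 * A₀ ^ 3 - 192 * A₃ * A₁ * A₀ ^ 2 - 128 * A₂ ^ 2 * A₀ ^ 2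
      + 144 * A₂ * A₁ ^ 2 * A₀
      - 27 * A₁ ^ 4 + 144 * A₃ ^ 2 * A₂ * A₀ ^ 2 - 6 * A₃ ^ 2 * A₁ ^ 2 * A₀
      - 80 * A₃ * A₂ ^ 2 * A₁ * A₀ + 18 * A₃ * A₂ * A₁ ^ 3 + 16 * A₂ ^ 4 * A₀
      - 4 * A₂ ^ 3 * A₁ ^ 2 = 256 * (A₂ ^ 0 * A₁ ^ 0 * A₀ ^ 3)
      + (-192 * A₃) * (A₂ ^ 0 * A₁ ^ 1 * A₀ ^ 2)
      + (144 * A₃ ^ 2 - 128 * A₂) * (A₂ ^ 1 * A₁ ^ 0 * A₀ ^ 2)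
      + (144 * A₂ - 6 * A₃ ^ 2) * (A₂ ^ 0 * A₁ ^ 2 * A₀ ^ 1)
      + (-27) * (A₂ ^ 0 * A₁ ^ 4 * A₀ ^ 0)
      + (-80 * A₃) * (A₂ ^ 2 * A₁ ^ 1 * A₀ ^ 1) + (18 * A₃) * (A₂ ^ 1 * A₁ ^ 3 * A₀ ^ 0)
      + 16 * (A₂ ^ 4 * A₁ ^ 0 * A₀ ^ 1) + (-4) * (A₂ ^ 3 * A₁ ^ 2 * A₀ ^ 0) := by ring
  rw [e]
  refine dvd_add (dvd_add (dvd_add (dvd_add (dvd_add (dvd_add (dvd_add (dvd_add ?_ ?_) ?_) ?_) ?_)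
    ?_) ?_) ?_) ?_
  all_goals
    refine Dvd.dvd.mul_left (t _ _ _ ?_) _
    omega

end valuation

namespace IsTripleRoot

variable {p : ℕ} {a b c s : ℤ}

theorem not_dvd_ofNat (h : IsTripleRoot p a b c s) {n : ℕ} (hn0 : 0 < n) (hn : n < 4) :
    ¬ (p : ℤ) ∣ (n : ℤ) := by
  intro hd
  have := Nat.le_of_dvd hn0 (Int.natCast_dvd_natCast.1 hd)
  have := h.three_lt
  omega

theorem isPrime (h : IsTripleRoot p a b c s) : Prime (p : ℤ) := Nat.prime_iff_prime_int.1 h.prime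

theorem not_dvd_two (h : IsTripleRoot p a b c s) : ¬ (p : ℤ) ∣ 2 := by
  exact_mod_cast h.not_dvd_ofNat (n := 2) (by simp) (by simp)

theorem not_dvd_three (h : IsTripleRoot p a b c s) : ¬ (p : ℤ) ∣ 3 := by
  exact_mod_cast h.not_dvd_ofNat (n := 3) (by simp) (by simp)

theorem not_dvd_four (h : IsTripleRoot p a b c s) : ¬ (p : ℤ) ∣ 4 := by
  intro hd
  rw [show (4 : ℤ) = 2 ^ 2 by norm_num] at hd
  exact h.not_dvd_two (h.isPrime.dvd_of_dvd_pow hd)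

theorem not_dvd_four_mul (h : IsTripleRoot p a b c s) : ¬ (p : ℤ) ∣ 4 * s := fun hd ↦
  (h.isPrime.dvd_or_dvd hd).elim h.not_dvd_four h.not_dvd

theorem devCoeff_zero_ne (h : IsTripleRoot p a b c s) : devCoeff (quartic a b c) s 0 ≠ 0 :=
  devCoeff_zero_ne_zero h.irr s

theorem devCoeff_three : devCoeff (quartic a b c) s 3 = 4 * s := (devCoeff_quartic a b c s).2.2.2.1

theorem devCoeff_four : devCoeff (quartic a b c) s 4 = 1 := (devCoeff_quartic a b c s).2.2.2.2.1

theorem le_four {k : ℕ} (hk : devCoeff (quartic a b c) s k ≠ 0) : k ≤ 4 := by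
  by_contra hlt
  exact hk ((devCoeff_quartic a b c s).2.2.2.2.2 k (by omega))

theorem devCoeff_three_ne (h : IsTripleRoot p a b c s) : devCoeff (quartic a b c) s 3 ≠ 0 := by
  rw [devCoeff_three]
  intro h0
  exact h.not_dvd_four_mul (by rw [h0]; exact _root_.dvd_zero _)

theorem devVal_three (h : IsTripleRoot p a b c s) : devVal p (quartic a b c) s 3 = 0 := by
  rw [devVal, devCoeff_three]
  exact padicValInt.eq_zero_of_not_dvd h.not_dvd_four_mul

theorem devVal_four : devVal p (quartic a b c) s 4 = 0 := by
  rw [devVal, devCoeff_four]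
  simp

theorem devVal_pos (h : IsTripleRoot p a b c s) {k : ℕ} (hk : k < 3)
    (h0 : devCoeff (quartic a b c) s k ≠ 0) :
    1 ≤ devVal p (quartic a b c) s k := by
  rw [devVal, ← pow_dvd_iff_le_padicValInt h.prime h0, pow_one]
  interval_cases k
  exacts [h.dvd_zero, h.dvd_one, h.dvd_two]

theorem pow_dvd (h : IsTripleRoot p a b c s) {k : ℕ}
    (h0 : devCoeff (quartic a b c) s k ≠ 0) {n : ℕ} :
    (p : ℤ) ^ n ∣ devCoeff (quartic a b c) s k ↔ n ≤ devVal p (quartic a b c) s k :=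
  pow_dvd_iff_le_padicValInt h.prime h0

theorem le_discr (h : IsTripleRoot p a b c s) {n : ℕ} (hn : (p : ℤ) ^ n ∣ (quartic a b c).discr) :
    n ≤ padicValInt p (quartic a b c).discr :=
  (pow_dvd_iff_le_padicValInt h.prime (discr_quartic_ne_zero h.irr)).1 hn

/-- The points of abscissas 3 and 4 both have ordinate 0, so a side reaching 4 would pass above the
former or be horizontal. -/
theorem isPrincipalSide_le (h : IsTripleRoot p a b c s) {i j : ℕ}
    (hs : IsPrincipalSide p (quartic a b c) s i j) : j ≤ 3 := by
  obtain ⟨⟨hij, hi, hj, hk⟩, hlt⟩ := hs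
  have hj4 := le_four hj
  rcases Nat.lt_or_ge j 4 with hj' | hj'
  · omega
  · obtain rfl : j = 4 := by omega
    have h3 := (hk 3 h.devCoeff_three_ne).1
    rw [h.devVal_three] at h3
    rw [devVal_four (p := p) (a := a) (b := b) (c := c) (s := s)] at h3 hlt
    have hi3 : i ≤ 3 := by omega
    interval_cases i
    · push_cast at h3; omega
    · push_cast at h3; omega
    · push_cast at h3; omega
    · rw [h.devVal_three] at hlt; omega

theorem add (h : IsTripleRoot p a b c s) {t y : ℤ} (ht : t = s + y) (hy : (p : ℤ) ∣ y) :
    IsTripleRoot p a b c t where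
  prime := h.prime
  three_lt := h.three_lt
  irr := h.irr
  not_dvd := fun hd ↦ h.not_dvd (by
    have := dvd_sub hd hy
    rwa [ht, add_sub_cancel_right] at this)
  dvd_zero := by
    have h0 := h.dvd_zero
    rw [(devCoeff_quartic a b c _).1] at h0 ⊢
    rw [ht, show (s + y) ^ 4 + a * (s + y) ^ 2 + b * (s + y) + c = (s ^ 4 + a * s ^ 2 + b * s + c)
      + y * (4 * s ^ 3 + 6 * s ^ 2 * y + 4 * s * y ^ 2 + y ^ 3 + a * (2 * s + y) + b) by ring]
    exact dvd_add h0 (hy.mul_right _)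
  dvd_one := by
    have h0 := h.dvd_one
    rw [(devCoeff_quartic a b c _).2.1] at h0 ⊢
    rw [ht, show 4 * (s + y) ^ 3 + 2 * a * (s + y) + b = (4 * s ^ 3 + 2 * a * s + b)
      + y * (4 * (3 * s ^ 2 + 3 * s * y + y ^ 2) + 2 * a) by ring]
    exact dvd_add h0 (hy.mul_right _)
  dvd_two := by
    have h0 := h.dvd_two
    rw [(devCoeff_quartic a b c _).2.2.1] at h0 ⊢
    rw [ht, show 6 * (s + y) ^ 2 + a = (6 * s ^ 2 + a) + y * (6 * (2 * s + y)) by ring]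
    exact dvd_add h0 (hy.mul_right _)

end IsTripleRoot

end OreQuartic

/-! ### Separability in low degree and integral slopes -/

namespace OreQuartic

section separable

variable {k : Type*} [Field k]

theorem separable_of_mul_add_mul_eq_C {A B R : k[X]} {d : k} (hd : d ≠ 0)
    (e : A * R + B * derivative R = C d) : R.Separable := by
  refine ⟨C d⁻¹ * A, C d⁻¹ * B, ?_⟩
  rw [mul_assoc, mul_assoc, ← mul_add, e, ← C_mul, inv_mul_cancel₀ hd, C_1]

theorem separable_C_mul_X_add_C {u v : k} (hv : v ≠ 0) : (C u + C v * X : k[X]).Separable := by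
  refine ⟨0, C v⁻¹, ?_⟩
  simp [← C_mul, hv]

/-- A quadratic polynomial with nonzero discriminant is separable. -/
theorem separable_quadratic {u v w : k} (hd : v ^ 2 - 4 * w * u ≠ 0) :
    (C u + C v * X + C w * X ^ 2 : k[X]).Separable := by
  have e : (C (-4 * w)) * (C u + C v * X + C w * X ^ 2 : k[X]) +
      (C (2 * w) * X + C v) * derivative (C u + C v * X + C w * X ^ 2 : k[X]) =
      C (v ^ 2 - 4 * w * u) := by
    simp only [derivative_add, derivative_C, derivative_C_mul, derivative_X, derivative_X_pow]
    simp only [Nat.cast_ofNat, map_mul, map_sub, map_pow, map_neg, C_ofNat]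
    ring
  exact separable_of_mul_add_mul_eq_C hd e

/-- A cubic polynomial without quadratic term and with nonzero discriminant is separable. -/
theorem separable_depressed_cubic {u v w : k} (hd : 4 * v ^ 3 + 27 * w * u ^ 2 ≠ 0) :
    (C u + C v * X + C w * X ^ 3 : k[X]).Separable := by
  set D := 4 * v ^ 3 + 27 * w * u ^ 2 with hD
  have e : (-(C (3 * w) * (C (2 * v) * X - C (3 * u)) * 3)) *
      (C u + C v * X + C w * X ^ 3 : k[X]) +
      (C (4 * v ^ 2) + C (3 * w) * (C (2 * v) * X - C (3 * u)) * X) *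
        derivative (C u + C v * X + C w * X ^ 3 : k[X]) = C D := by
    simp only [derivative_add, derivative_C, derivative_C_mul, derivative_X, derivative_X_pow, hD]
    simp only [Nat.cast_ofNat, map_mul, map_add, map_pow, C_ofNat]
    ring
  exact separable_of_mul_add_mul_eq_C hd e

theorem not_separable_of_sq_dvd {y : k} {R : k[X]} (h : (X - C y) ^ 2 ∣ R) : ¬ R.Separable := by
  intro hs
  have := hs.squarefree (X - C y) (by rwa [← pow_two])
  exact not_isUnit_X_sub_C y this

theorem eval_of_sq_dvd {y : k} {R : k[X]} (h : (X - C y) ^ 2 ∣ R) :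
    R.eval y = 0 ∧ (derivative R).eval y = 0 := by
  obtain ⟨Q, rfl⟩ := h
  constructor <;> simp [derivative_mul, derivative_pow]

end separable

section side

variable {p : ℕ} {F : ℤ[X]} {s : ℤ} {i j : ℕ}

theorem residualPoly_eq_of_sideDegree_eq_one (h : IsSide p F s i j)
    (hd : sideDegree p F s i j = 1) :
    residualPoly p F s i j = C (residualCoeff p F s i) + C (residualCoeff p F s j) * X := by
  have := h.1
  rw [residualPoly, hd]
  simp only [Finset.sum_range_succ, Finset.sum_range_zero, Nat.div_one]
  rw [show i + 1 * (j - i) = j by omega]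
  simp

/-- An integral slope means e = 1: every abscissa of the side contributes a coefficient. -/
theorem residualPoly_eq_of_slope (hij : i < j) {δ : ℕ}
    (hδ : devVal p F s i = devVal p F s j + δ * (j - i)) :
    residualPoly p F s i j =
      ∑ k ∈ Finset.range (j - i + 1), C (residualCoeff p F s (i + k)) * X ^ k := by
  have hd : sideDegree p F s i j = j - i := by
    rw [sideDegree, hδ, Nat.add_sub_cancel_left, Nat.gcd_eq_left (Dvd.intro_left _ rfl)]
  rw [residualPoly, hd, Nat.div_self (by omega)]
  simp

open Classical in
theorem residualCoeff_eq_of_slope (h : IsSide p F s i j) {δ : ℕ}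
    (hδ : devVal p F s i = devVal p F s j + δ * (j - i)) {k : ℕ} (hik : i ≤ k) (hkj : k ≤ j) :
    residualCoeff p F s k = if devCoeff F s k ≠ 0 ∧
      devVal p F s k + δ * (k - i) = devVal p F s i
      then ((devCoeff F s k / (p : ℤ) ^ devVal p F s k : ℤ) : ZMod p) else 0 := by
  rw [h.residualCoeff_eq hik hkj]
  refine if_congr (and_congr_right fun _ ↦ ?_) rfl rfl
  have hij := h.1
  have hpos : (j : ℤ) - i ≠ 0 := by omega
  have e1 : (devVal p F s i : ℤ) = devVal p F s j + δ * (j - i) := by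
    have := congrArg (Nat.cast (R := ℤ)) hδ
    push_cast [Nat.cast_sub hij.le] at this
    exact this
  rw [← @Nat.cast_inj ℤ]
  push_cast [Nat.cast_sub hik]
  constructor
  · intro h'
    have : ((δ : ℤ) * (k - i) + (devVal p F s k - devVal p F s i)) * ((j : ℤ) - i) = 0 := by
      rw [e1] at h' ⊢
      linear_combination (-1 : ℤ) * h'
    rcases mul_eq_zero.1 this with h0 | h0
    · linarith
    · exact absurd h0 hpos
  · intro h'
    have e2 : (devVal p F s k : ℤ) - devVal p F s i = - δ * (k - i) := by linarith
    rw [e2, e1]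
    ring

theorem residualCoeff_right_ne_zero (hp : p.Prime) (h : IsSide p F s i j) :
    residualCoeff p F s j ≠ 0 := by
  classical
  rw [h.residualCoeff_eq h.1.le le_rfl, if_pos ⟨h.2.2.1, rfl⟩]
  intro h0
  rw [ZMod.intCast_zmod_eq_zero_iff_dvd] at h0
  exact not_dvd_div_pow hp h.2.2.1 h0

theorem residualCoeff_left_ne_zero (hp : p.Prime) (h : IsSide p F s i j) :
    residualCoeff p F s i ≠ 0 := by
  classical
  rw [h.residualCoeff_eq le_rfl h.1.le, if_pos ⟨h.2.1, by ring⟩]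
  intro h0
  rw [ZMod.intCast_zmod_eq_zero_iff_dvd] at h0
  exact not_dvd_div_pow hp h.2.1 h0

/-- A side of length at most three with inseparable residual polynomial has integral slope. -/
theorem exists_slope_of_not_separable (hp : p.Prime) (hs : IsPrincipalSide p F s i j)
    (hj : j ≤ 3) (hns : ¬ (residualPoly p F s i j).Separable) :
    2 ≤ j - i ∧ ∃ δ, 1 ≤ δ ∧ devVal p F s i = devVal p F s j + δ * (j - i) := by
  have := Fact.mk hp
  obtain ⟨hs, hlt⟩ := hs
  have hij := hs.1
  -- Degree one gives a linear residual polynomial. The length is at most 3, hence 1 or a prime, so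
  -- the degree must be the whole length.
  have hd1 : sideDegree p F s i j ≠ 1 := fun hd ↦ hns (by
    rw [residualPoly_eq_of_sideDegree_eq_one hs hd]
    exact separable_C_mul_X_add_C (residualCoeff_right_ne_zero hp hs))
  have hdvd : sideDegree p F s i j ∣ j - i := Nat.gcd_dvd_left _ _
  have hdvd' : sideDegree p F s i j ∣ devVal p F s i - devVal p F s j := Nat.gcd_dvd_right _ _
  have hji : sideDegree p F s i j = j - i := by
    have hle := Nat.le_of_dvd (by omega) hdvd
    have hn : j - i ≤ 3 := by omega
    have hn0 : 0 < j - i := by omega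
    clear hdvd'
    generalize sideDegree p F s i j = d at *
    generalize j - i = n at *
    have hd3 : d ≤ 3 := by omega
    interval_cases n <;> interval_cases d <;> simp_all
  rw [hji] at hdvd' hd1
  obtain ⟨δ, hδ⟩ := hdvd'
  refine ⟨by omega, δ, ?_, ?_⟩
  · rcases Nat.eq_zero_or_pos δ with rfl | h
    · omega
    · exact h
  · rw [mul_comm, ← hδ]
    omega

end side

end OreQuartic

/-! ### The initial integer and the first step -/

namespace OreQuartic

/-- The class modulo `p` of the unit part of the `k`-th coefficient of the development at `s`. -/
noncomputable def unitPart (p : ℕ) (F : ℤ[X]) (s : ℤ) (k : ℕ) : ℤ :=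
  devCoeff F s k / (p : ℤ) ^ devVal p F s k

theorem pow_mul_unitPart (p : ℕ) (F : ℤ[X]) (s : ℤ) (k : ℕ) :
    (p : ℤ) ^ devVal p F s k * unitPart p F s k = devCoeff F s k :=
  pow_mul_div_pow p _

theorem not_dvd_unitPart {p : ℕ} (hp : p.Prime) {F : ℤ[X]} {s : ℤ} {k : ℕ}
    (hk : devCoeff F s k ≠ 0) : ¬ (p : ℤ) ∣ unitPart p F s k :=
  not_dvd_div_pow hp hk

theorem devCoeff_add (a b c s y : ℤ) :
    devCoeff (quartic a b c) (s + y) 0 = devCoeff (quartic a b c) s 0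
      + devCoeff (quartic a b c) s 1 * y + devCoeff (quartic a b c) s 2 * y ^ 2
      + 4 * s * y ^ 3 + y ^ 4 ∧
    devCoeff (quartic a b c) (s + y) 1 = devCoeff (quartic a b c) s 1
      + 2 * devCoeff (quartic a b c) s 2 * y + 12 * s * y ^ 2 + 4 * y ^ 3 ∧
    devCoeff (quartic a b c) (s + y) 2 = devCoeff (quartic a b c) s 2
      + 12 * s * y + 6 * y ^ 2 := by
  obtain ⟨e₀, e₁, e₂, -⟩ := devCoeff_quartic a b c s
  obtain ⟨e₀', e₁', e₂', -⟩ := devCoeff_quartic a b c (s + y)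
  rw [e₀, e₁, e₂, e₀', e₁', e₂']
  refine ⟨by ring, by ring, by ring⟩

variable {p : ℕ} {a b c s : ℤ}

namespace IsTripleRoot

theorem unitPart_three (h : IsTripleRoot p a b c s) : unitPart p (quartic a b c) s 3 = 4 * s := by
  have := pow_mul_unitPart p (quartic a b c) s 3
  rwa [h.devVal_three, pow_zero, one_mul, devCoeff_three] at this

theorem isPrincipalSide_zero_three (h : IsTripleRoot p a b c s)
    (h₁ : devCoeff (quartic a b c) s 1 ≠ 0 →
      2 * devVal p (quartic a b c) s 0 ≤ 3 * devVal p (quartic a b c) s 1)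
    (h₂ : devCoeff (quartic a b c) s 2 ≠ 0 →
      devVal p (quartic a b c) s 0 ≤ 3 * devVal p (quartic a b c) s 2) :
    IsPrincipalSide p (quartic a b c) s 0 3 := by
  have hw3 := h.devVal_three
  have hw0 := h.devVal_pos (k := 0) (by norm_num) h.devCoeff_zero_ne
  refine ⟨⟨by norm_num, h.devCoeff_zero_ne, h.devCoeff_three_ne, fun k hk ↦ ?_⟩, by omega⟩
  have hk4 := le_four hk
  have hw4 := devVal_four (p := p) (a := a) (b := b) (c := c) (s := s)
  interval_cases k
  · refine ⟨by simp, by omega⟩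
  · have := h₁ hk
    refine ⟨by push_cast; omega, by omega⟩
  · have := h₂ hk
    refine ⟨by push_cast; omega, by omega⟩
  · refine ⟨by push_cast; omega, by omega⟩
  · refine ⟨by push_cast; omega, fun _ ↦ by push_cast; omega⟩

theorem isPrincipalSide_zero_two (h : IsTripleRoot p a b c s)
    (h₂ : devCoeff (quartic a b c) s 2 ≠ 0)
    (h₂' : 3 * devVal p (quartic a b c) s 2 < devVal p (quartic a b c) s 0)
    (h₁ : devCoeff (quartic a b c) s 1 ≠ 0 →
      devVal p (quartic a b c) s 0 + devVal p (quartic a b c) s 2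
        ≤ 2 * devVal p (quartic a b c) s 1) :
    IsPrincipalSide p (quartic a b c) s 0 2 := by
  have hw3 := h.devVal_three
  have hw0 := h.devVal_pos (k := 0) (by norm_num) h.devCoeff_zero_ne
  refine ⟨⟨by norm_num, h.devCoeff_zero_ne, h₂, fun k hk ↦ ?_⟩, by omega⟩
  have hk4 := le_four hk
  have hw4 := devVal_four (p := p) (a := a) (b := b) (c := c) (s := s)
  interval_cases k
  · refine ⟨by simp, by omega⟩
  · have := h₁ hk
    refine ⟨by push_cast; omega, by omega⟩
  · refine ⟨by push_cast; omega, by omega⟩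
  · refine ⟨by push_cast; omega, fun _ ↦ by push_cast; omega⟩
  · refine ⟨by push_cast; omega, fun _ ↦ by push_cast; omega⟩

end IsTripleRoot

/-- The hypothesis on the second derivative at the initial integer, in terms of the points of the
Newton polygon: the point of abscissa `2` lies strictly above the polygon. -/
noncomputable def TwoAbove (p : ℕ) (a b c s : ℤ) : Prop :=
  devCoeff (quartic a b c) s 2 ≠ 0 →
    devVal p (quartic a b c) s 0 < 3 * devVal p (quartic a b c) s 2 ∨
    (devCoeff (quartic a b c) s 1 ≠ 0 ∧
      devVal p (quartic a b c) s 1 < 2 * devVal p (quartic a b c) s 2)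

namespace IsTripleRoot

/-- Give A₀, A₁, A₂ the weights 3, 2, 1. Every monomial of the discriminant then has weight at least
6, so a point of abscissa 2 that is not strictly above would force p^(6w₂) into the discriminant. -/
theorem twoAbove_of_discr_lt (h : IsTripleRoot p a b c s)
    (hu : devCoeff (quartic a b c) s 2 ≠ 0 →
      padicValInt p (quartic a b c).discr < 6 * devVal p (quartic a b c) s 2) :
    TwoAbove p a b c s := by
  intro h₂
  have hu := hu h₂
  by_contra! hcon
  obtain ⟨hc₀, hc₁⟩ := hcon
  set m := devVal p (quartic a b c) s 2 with hm
  have d₀ : (p : ℤ) ^ (3 * m) ∣ devCoeff (quartic a b c) s 0 := (h.pow_dvd h.devCoeff_zero_ne).2 hc₀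
  have d₁ : (p : ℤ) ^ (2 * m) ∣ devCoeff (quartic a b c) s 1 := by
    by_cases h₁ : devCoeff (quartic a b c) s 1 = 0
    · rw [h₁]; exact _root_.dvd_zero _
    · exact (h.pow_dvd h₁).2 (hc₁ h₁)
  have d₂ : (p : ℤ) ^ m ∣ devCoeff (quartic a b c) s 2 := (h.pow_dvd h₂).2 le_rfl
  refine absurd (h.le_discr (n := 6 * m) ?_) (by omega)
  have t := fun i j k ↦ pow_dvd_mul_pow (n := 6 * m) d₀ d₁ d₂ i j k
  have tail := pow_dvd_discr_tail (n := 6 * m) (devCoeff (quartic a b c) s 3) d₀ d₁ d₂ (by omega)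
    (by omega) (by omega) (by omega) (by omega) (by omega) (by omega) (by omega) (by omega)
  rw [discr_quartic_eq_devCoeff a b c s rfl rfl rfl rfl]
  generalize devCoeff (quartic a b c) s 0 = A₀ at *
  generalize devCoeff (quartic a b c) s 1 = A₁ at *
  generalize devCoeff (quartic a b c) s 2 = A₂ at *
  generalize devCoeff (quartic a b c) s 3 = A₃ at *
  have head : (p : ℤ) ^ (6 * m) ∣ A₃ ^ 2 * (A₂ ^ 2 * A₁ ^ 2 * A₀ ^ 0)
      + (-4 * A₃ ^ 2) * (A₂ ^ 3 * A₁ ^ 0 * A₀ ^ 1) + (-27 * A₃ ^ 4) * (A₂ ^ 0 * A₁ ^ 0 * A₀ ^ 2)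
      + (-4 * A₃ ^ 3) * (A₂ ^ 0 * A₁ ^ 3 * A₀ ^ 0)
      + (18 * A₃ ^ 3) * (A₂ ^ 1 * A₁ ^ 1 * A₀ ^ 1) := by
    refine dvd_add (dvd_add (dvd_add (dvd_add ?_ ?_) ?_) ?_) ?_ <;>
    · refine Dvd.dvd.mul_left (t _ _ _ ?_) _
      omega
  convert! dvd_add head tail using 1
  ring

/-- The quadratic coefficient is absent since the point of abscissa 2 is off the side: the cubic is
depressed, which keeps its discriminant short. -/
theorem residualPoly_zero_three (h : IsTripleRoot p a b c s) (hA : TwoAbove p a b c s) {δ : ℕ}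
    (hs : IsPrincipalSide p (quartic a b c) s 0 3)
    (h₀ : devVal p (quartic a b c) s 0 = 3 * δ) :
    residualPoly p (quartic a b c) s 0 3 = C (unitPart p (quartic a b c) s 0 : ZMod p)
      + C (residualCoeff p (quartic a b c) s 1) * X + C ((4 * s : ℤ) : ZMod p) * X ^ 3 := by
  classical
  have hw3 := h.devVal_three
  have hδ : devVal p (quartic a b c) s 0 = devVal p (quartic a b c) s 3 + δ * (3 - 0) := by omega
  have hc := fun k ↦ residualCoeff_eq_of_slope hs.1 hδ (k := k) (Nat.zero_le k)
  have hk := hs.1.2.2.2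
  rw [residualPoly_eq_of_slope (by norm_num) hδ]
  simp only [Finset.sum_range_succ, Finset.sum_range_zero, zero_add, Nat.sub_zero]
  rw [hc 0 (by norm_num), hc 2 (by norm_num), hc 3 (by norm_num),
    if_pos ⟨h.devCoeff_zero_ne, by omega⟩,
    if_neg (fun h₂ ↦ by
      rcases hA h₂.1 with h' | ⟨h', h''⟩
      · omega
      · have := (hk 1 h').1
        push_cast at this
        omega),
    if_pos ⟨h.devCoeff_three_ne, by omega⟩, ← h.unitPart_three]
  simp [unitPart]

theorem residualCoeff_one (h : IsTripleRoot p a b c s) {δ : ℕ}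
    (hs : IsPrincipalSide p (quartic a b c) s 0 3)
    (h₀ : devVal p (quartic a b c) s 0 = 3 * δ) (h₁ : devCoeff (quartic a b c) s 1 ≠ 0)
    (h₁' : devVal p (quartic a b c) s 1 = 2 * δ) :
    residualCoeff p (quartic a b c) s 1 = (unitPart p (quartic a b c) s 1 : ZMod p) := by
  classical
  have hw3 := h.devVal_three
  have hδ : devVal p (quartic a b c) s 0 = devVal p (quartic a b c) s 3 + δ * (3 - 0) := by omega
  rw [residualCoeff_eq_of_slope hs.1 hδ (by norm_num) (by norm_num), if_pos ⟨h₁, by omega⟩]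
  rfl

/-- Again the middle coefficient is absent, and c₁ + c₃y² has discriminant -4c₁c₃, a unit. -/
theorem separable_one_three (h : IsTripleRoot p a b c s) (hA : TwoAbove p a b c s) {δ : ℕ}
    (hs : IsPrincipalSide p (quartic a b c) s 1 3)
    (h₁ : devVal p (quartic a b c) s 1 = 2 * δ) :
    (residualPoly p (quartic a b c) s 1 3).Separable := by
  classical
  have := Fact.mk h.prime
  have hw3 := h.devVal_three
  have hδ : devVal p (quartic a b c) s 1 = devVal p (quartic a b c) s 3 + δ * (3 - 1) := by omega
  have hc := fun k hk ↦ residualCoeff_eq_of_slope hs.1 hδ (k := k) hk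
  have hk := ((hs.1.2.2.2 0 h.devCoeff_zero_ne).2 (Or.inl (by norm_num)))
  rw [residualPoly_eq_of_slope (by norm_num) hδ]
  simp only [Finset.sum_range_succ, Finset.sum_range_zero, zero_add, pow_zero,
    mul_one, pow_one, Nat.reduceAdd, Nat.reduceSub, add_zero]
  refine separable_quadratic ?_
  push_cast at hk
  rw [hc 2 (by norm_num) (by norm_num),
    if_neg (fun h₂ ↦ by rcases hA h₂.1 with h' | ⟨h', h''⟩ <;> omega)]
  have h1 := residualCoeff_left_ne_zero h.prime hs.1
  have h3 := residualCoeff_right_ne_zero h.prime hs.1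
  have h4 : (4 : ZMod p) ≠ 0 := fun h0 ↦ h.not_dvd_four (by
    rw [← ZMod.intCast_zmod_eq_zero_iff_dvd]; exact_mod_cast h0)
  intro h0
  have : 4 * residualCoeff p (quartic a b c) s 3 * residualCoeff p (quartic a b c) s 1 = 0 := by
    linear_combination -h0
  simp_all

/-- The only side which can have an inseparable residual polynomial at the initial integer. -/
theorem eq_of_not_separable (h : IsTripleRoot p a b c s) (hA : TwoAbove p a b c s) {i j : ℕ}
    (hs : IsPrincipalSide p (quartic a b c) s i j)
    (hns : ¬ (residualPoly p (quartic a b c) s i j).Separable) :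
    i = 0 ∧ j = 3 ∧ ∃ δ, 1 ≤ δ ∧ devVal p (quartic a b c) s 0 = 3 * δ ∧
      devCoeff (quartic a b c) s 1 ≠ 0 ∧ devVal p (quartic a b c) s 1 = 2 * δ ∧
      (p : ℤ) ∣ unitPart p (quartic a b c) s 1 ^ 3 +
        27 * s * unitPart p (quartic a b c) s 0 ^ 2 := by
  classical
  have := Fact.mk h.prime
  have hj := h.isPrincipalSide_le hs
  obtain ⟨hij, δ, hδ1, hδ⟩ := exists_slope_of_not_separable h.prime hs hj hns
  have hw3 := h.devVal_three
  have hk := hs.1.2.2.2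
  have hcases : (i = 0 ∧ j = 3) ∨ (i = 1 ∧ j = 3) ∨ (i = 0 ∧ j = 2) := by omega
  rcases hcases with ⟨rfl, rfl⟩ | ⟨rfl, rfl⟩ | ⟨rfl, rfl⟩
  · have h₀ : devVal p (quartic a b c) s 0 = 3 * δ := by omega
    have h₄ := h.not_dvd_four
    have h₄s := h.not_dvd_four_mul
    have h₃ := h.not_dvd_three
    rw [← intCast_ne_zero_iff] at h₄ h₄s h₃
    have hσ := not_dvd_unitPart h.prime h.devCoeff_zero_ne
    rw [← intCast_ne_zero_iff] at hσ
    refine ⟨rfl, rfl, δ, hδ1, h₀, ?_⟩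
    rw [h.residualPoly_zero_three hA hs h₀] at hns
    have hd : 4 * residualCoeff p (quartic a b c) s 1 ^ 3 + 27 * ((4 * s : ℤ) : ZMod p) *
        (unitPart p (quartic a b c) s 0 : ZMod p) ^ 2 = 0 := by
      by_contra hd
      exact hns (separable_depressed_cubic hd)
    -- If the point of abscissa 1 were off the side, the discriminant would reduce to 3³ · 4s · σ₀²,
    -- which is nonzero because p > 3.
    have hc₁ : devCoeff (quartic a b c) s 1 ≠ 0 ∧
        devVal p (quartic a b c) s 1 + δ * (1 - 0) = devVal p (quartic a b c) s 0 := by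
      by_contra hc
      rw [residualCoeff_eq_of_slope hs.1 hδ (by norm_num) (by norm_num), if_neg hc] at hd
      have : ((3 : ℤ) : ZMod p) ^ 3 * ((4 * s : ℤ) : ZMod p) *
        (unitPart p (quartic a b c) s 0 : ZMod p) ^ 2 = 0 := by
        push_cast at hd ⊢
        linear_combination hd
      simp_all
    have h₁ : devVal p (quartic a b c) s 1 = 2 * δ := by omega
    refine ⟨hc₁.1, h₁, ?_⟩
    rw [h.residualCoeff_one hs h₀ hc₁.1 h₁] at hd
    rw [← ZMod.intCast_zmod_eq_zero_iff_dvd]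
    refine (mul_eq_zero.1 (?_ : ((4 : ℤ) : ZMod p) * _ = 0)).resolve_left h₄
    push_cast at hd ⊢
    linear_combination hd
  · exact absurd (h.separable_one_three hA hs (δ := δ) (by omega)) hns
  -- A side ending at 2 would make this point a vertex, against `TwoAbove`.
  · exfalso
    have h3 := (hk 3 h.devCoeff_three_ne).2 (Or.inr (by norm_num))
    push_cast at h3
    rcases hA hs.1.2.2.1 with h' | ⟨h', h''⟩
    · omega
    · have h1 := (hk 1 h').1
      push_cast at h1
      omega

theorem principalSide_of_val (h : IsTripleRoot p a b c s) (hA : TwoAbove p a b c s) {δ : ℕ}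
    (h₀ : devVal p (quartic a b c) s 0 = 3 * δ)
    (h₁' : devVal p (quartic a b c) s 1 = 2 * δ) :
    IsPrincipalSide p (quartic a b c) s 0 3 :=
  h.isPrincipalSide_zero_three (fun _ ↦ by omega) (fun h₂ ↦ by have := hA h₂; omega)

/-- The double root of the residual polynomial of the side from `0` to `3`. -/
theorem exists_sq_dvd_zero_three (h : IsTripleRoot p a b c s) (hA : TwoAbove p a b c s) {δ : ℕ}
    (h₀ : devVal p (quartic a b c) s 0 = 3 * δ) (h₁ : devCoeff (quartic a b c) s 1 ≠ 0)
    (h₁' : devVal p (quartic a b c) s 1 = 2 * δ)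
    (hd : (p : ℤ) ∣ unitPart p (quartic a b c) s 1 ^ 3 +
      27 * s * unitPart p (quartic a b c) s 0 ^ 2) :
    ∃ y : ℤ, (X - C (y : ZMod p)) ^ 2 ∣ residualPoly p (quartic a b c) s 0 3 := by
  have := Fact.mk h.prime
  have hs := h.principalSide_of_val hA h₀ h₁'
  rw [h.residualPoly_zero_three hA hs h₀, h.residualCoeff_one hs h₀ h₁ h₁']
  have hσ₁ := not_dvd_unitPart h.prime h₁
  have h₂ := h.not_dvd_two
  rw [← intCast_ne_zero_iff] at hσ₁ h₂
  rw [← ZMod.intCast_zmod_eq_zero_iff_dvd] at hd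
  generalize unitPart p (quartic a b c) s 1 = σ₁ at *
  generalize unitPart p (quartic a b c) s 0 = σ₀ at *
  -- A common root of R and R' is a root of 3R - yR' = 3σ₀ + 2σ₁y, which determines it.
  obtain ⟨y, hy⟩ := ZMod.intCast_surjective (-3 * (σ₀ : ZMod p) / (2 * (σ₁ : ZMod p)))
  push_cast at hd h₂
  have hy2 : 2 * (σ₁ : ZMod p) * y = -3 * σ₀ := by
    rw [hy]; field_simp
  have e₁ : (σ₁ : ZMod p) = -12 * s * y ^ 2 := by
    have : (2 * (σ₁ : ZMod p)) ^ 2 * σ₁ = (2 * (σ₁ : ZMod p)) ^ 2 * (-12 * s * y ^ 2) := by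
      linear_combination 4 * hd + 12 * (s : ZMod p) * (2 * σ₁ * y - 3 * σ₀) * hy2
    exact mul_left_cancel₀ (by simp [hσ₁, h₂]) this
  have e₀ : (σ₀ : ZMod p) = 8 * s * y ^ 3 := by
    have h₃ := h.not_dvd_three
    rw [← intCast_ne_zero_iff] at h₃
    push_cast at h₃
    refine mul_left_cancel₀ h₃ ?_
    linear_combination hy2 - 2 * (y : ZMod p) * e₁
  -- The roots of a depressed cubic sum to zero, so the third root is -2y.
  refine ⟨y, C ((4 * s : ℤ) : ZMod p) * (X + 2 * C (y : ZMod p)), ?_⟩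
  rw [e₀, e₁]
  push_cast
  simp only [map_mul, map_pow, map_neg, C_ofNat]
  ring

end IsTripleRoot

/-- The shape of the Newton polygon after the first step of the iteration. -/
structure IsIterate (p : ℕ) (a b c s : ℤ) (δ : ℕ) : Prop where
  tripleRoot : IsTripleRoot p a b c s
  pos : 1 ≤ δ
  two_ne : devCoeff (quartic a b c) s 2 ≠ 0
  val_two : devVal p (quartic a b c) s 2 = δ
  val_zero : 3 * δ + 1 ≤ devVal p (quartic a b c) s 0
  val_one : devCoeff (quartic a b c) s 1 ≠ 0 → 2 * δ + 1 ≤ devVal p (quartic a b c) s 1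

theorem dvd_of_sq_dvd_cubic {y u v w : ℤ}
    (h : (X - C (y : ZMod p)) ^ 2 ∣ C (u : ZMod p) + C (v : ZMod p) * X + C (w : ZMod p) * X ^ 3)
    (hp : p.Prime) : (p : ℤ) ∣ u + v * y + w * y ^ 3 ∧ (p : ℤ) ∣ v + 3 * w * y ^ 2 := by
  have := Fact.mk hp
  obtain ⟨h0, h1⟩ := eval_of_sq_dvd h
  simp only [derivative_add, derivative_C, derivative_C_mul, derivative_X, derivative_X_pow,
    eval_add, eval_mul, eval_C, eval_X, eval_pow, eval_one, eval_zero] at h0 h1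
  rw [← ZMod.intCast_zmod_eq_zero_iff_dvd, ← ZMod.intCast_zmod_eq_zero_iff_dvd]
  push_cast at h1 ⊢
  refine ⟨h0, ?_⟩
  linear_combination h1

theorem dvd_of_sq_dvd_quadratic {y u v w : ℤ}
    (h : (X - C (y : ZMod p)) ^ 2 ∣ C (u : ZMod p) + C (v : ZMod p) * X + C (w : ZMod p) * X ^ 2)
    (hp : p.Prime) : (p : ℤ) ∣ u + v * y + w * y ^ 2 ∧ (p : ℤ) ∣ v + 2 * w * y := by
  have := Fact.mk hp
  obtain ⟨h0, h1⟩ := eval_of_sq_dvd h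
  simp only [derivative_add, derivative_C, derivative_C_mul, derivative_X, derivative_X_pow,
    eval_add, eval_mul, eval_C, eval_X, eval_pow, eval_one, eval_zero] at h0 h1
  rw [← ZMod.intCast_zmod_eq_zero_iff_dvd, ← ZMod.intCast_zmod_eq_zero_iff_dvd]
  push_cast at h1 ⊢
  refine ⟨h0, ?_⟩
  linear_combination h1

/-- The first step of the iteration. -/
theorem IsTripleRoot.isIterate_of_iterStep (h : IsTripleRoot p a b c s)
    (hA : TwoAbove p a b c s) {t : ℤ} (hst : IterStep p (quartic a b c) s t) :
    ∃ δ, devVal p (quartic a b c) s 0 = 3 * δ ∧ devCoeff (quartic a b c) s 1 ≠ 0 ∧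
      devVal p (quartic a b c) s 1 = 2 * δ ∧ IsIterate p a b c t δ := by
  obtain ⟨i, j, δ', y, hs, hns, hδ', hy, rfl⟩ := hst
  obtain ⟨rfl, rfl, δ, hδ, h₀, h₁, h₁', -⟩ := h.eq_of_not_separable hA hs hns
  have hw3 := h.devVal_three
  obtain rfl : δ' = δ := by omega
  refine ⟨δ', h₀, h₁, h₁', ?_⟩
  rw [h.residualPoly_zero_three hA hs h₀, h.residualCoeff_one hs h₀ h₁ h₁'] at hy
  obtain ⟨r₀, r₁⟩ := dvd_of_sq_dvd_cubic hy h.prime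
  have hσ₁ := not_dvd_unitPart h.prime h₁
  -- The vanishing derivative reads σ₁ ≡ -12sy², and σ₁ is a unit.
  have hyp : ¬ (p : ℤ) ∣ y := fun hd ↦ hσ₁ (by
    have := dvd_sub r₁ (Dvd.dvd.mul_left (dvd_pow hd two_ne_zero) (3 * (4 * s)))
    rwa [add_sub_cancel_right] at this)
  have hδp : (p : ℤ) ∣ y * (p : ℤ) ^ δ' := (dvd_pow_self _ (by omega)).mul_left _
  have ht := h.add rfl hδp
  obtain ⟨e₀, e₁, e₂⟩ := devCoeff_add a b c s (y * (p : ℤ) ^ δ')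
  have f₀ := pow_mul_unitPart p (quartic a b c) s 0
  have f₁ := pow_mul_unitPart p (quartic a b c) s 1
  have d₂ : (p : ℤ) ^ (δ' + 1) ∣ devCoeff (quartic a b c) s 2 := by
    by_cases h₂ : devCoeff (quartic a b c) s 2 = 0
    · rw [h₂]; exact _root_.dvd_zero _
    · rw [h.pow_dvd h₂]
      have := hA h₂
      omega
  obtain ⟨q₂, hq₂⟩ := d₂
  obtain ⟨q₀, hq₀⟩ := r₀
  obtain ⟨q₁, hq₁⟩ := r₁
  -- Makes p^(δ-1) available as a cofactor: the quartic term in the shift has value at least 4δ = 3δ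
  -- + 1 + ε.
  obtain ⟨ε, rfl⟩ : ∃ ε, δ' = ε + 1 := ⟨δ' - 1, by omega⟩
  rw [h₀] at f₀
  rw [h₁'] at f₁
  -- The term 12syp^δ dominates: the old coefficient is divisible by p^(δ+1) and the square of the
  -- shift by p^(2δ).
  have v₂ : padicValInt p (devCoeff (quartic a b c) (s + y * (p : ℤ) ^ (ε + 1)) 2) = ε + 1 := by
    refine padicValInt_eq_of_dvd_sub h.prime (M := 4 * 3 * s * y) ?_ ?_
    · intro hd
      have hP := h.isPrime
      rcases hP.dvd_or_dvd hd with hd | hd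
      · rcases hP.dvd_or_dvd hd with hd | hd
        · exact (hP.dvd_or_dvd hd).elim h.not_dvd_four h.not_dvd_three
        · exact h.not_dvd hd
      · exact hyp hd
    · rw [e₂, hq₂]
      refine ⟨q₂ + 6 * y ^ 2 * (p : ℤ) ^ ε, ?_⟩
      ring
  refine ⟨ht, hδ, ?_, v₂, ?_, fun hne ↦ ?_⟩
  · intro h0
    rw [h0] at v₂
    simp at v₂
  · rw [← ht.pow_dvd ht.devCoeff_zero_ne, e₀, ← f₀, ← f₁, hq₂]
    refine ⟨q₀ + q₂ * y ^ 2 + y ^ 4 * (p : ℤ) ^ ε, ?_⟩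
    linear_combination (p : ℤ) ^ (3 * (ε + 1)) * hq₀
  · rw [← ht.pow_dvd hne, e₁, ← f₁, hq₂]
    refine ⟨q₁ + 2 * q₂ * y + 4 * y ^ 3 * (p : ℤ) ^ ε, ?_⟩
    linear_combination (p : ℤ) ^ (2 * (ε + 1)) * hq₁

end OreQuartic

/-! ### Later iterates: persistence of the vertex at 2 -/

namespace OreQuartic

variable {p : ℕ} {a b c s : ℤ}

namespace IsIterate

variable {δ : ℕ}

theorem residualPoly_zero_two (h : IsIterate p a b c s δ) {ε : ℕ}
    (hs : IsPrincipalSide p (quartic a b c) s 0 2)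
    (h₀ : devVal p (quartic a b c) s 0 = δ + 2 * ε) :
    residualPoly p (quartic a b c) s 0 2 = C (unitPart p (quartic a b c) s 0 : ZMod p)
      + C (residualCoeff p (quartic a b c) s 1) * X
      + C (unitPart p (quartic a b c) s 2 : ZMod p) * X ^ 2 := by
  classical
  have hw2 := h.val_two
  have hδ : devVal p (quartic a b c) s 0 = devVal p (quartic a b c) s 2 + ε * (2 - 0) := by omega
  have hc := fun k ↦ residualCoeff_eq_of_slope hs.1 hδ (k := k) (Nat.zero_le k)
  rw [residualPoly_eq_of_slope (by norm_num) hδ]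
  simp only [Finset.sum_range_succ, Finset.sum_range_zero, zero_add, Nat.sub_zero]
  rw [hc 0 (by norm_num), hc 2 (by norm_num),
    if_pos ⟨h.tripleRoot.devCoeff_zero_ne, by omega⟩, if_pos ⟨h.two_ne, by omega⟩]
  simp [unitPart]

theorem residualCoeff_one (h : IsIterate p a b c s δ) {ε : ℕ}
    (hs : IsPrincipalSide p (quartic a b c) s 0 2)
    (h₀ : devVal p (quartic a b c) s 0 = δ + 2 * ε) (h₁ : devCoeff (quartic a b c) s 1 ≠ 0)
    (h₁' : devVal p (quartic a b c) s 1 = δ + ε) :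
    residualCoeff p (quartic a b c) s 1 = (unitPart p (quartic a b c) s 1 : ZMod p) := by
  classical
  have hw2 := h.val_two
  have hδ : devVal p (quartic a b c) s 0 = devVal p (quartic a b c) s 2 + ε * (2 - 0) := by omega
  rw [residualCoeff_eq_of_slope hs.1 hδ (by norm_num) (by norm_num), if_pos ⟨h₁, by omega⟩]
  rfl

/-- The only side which can have an inseparable residual polynomial at a later iterate. -/
theorem eq_of_not_separable (h : IsIterate p a b c s δ) {i j : ℕ}
    (hs : IsPrincipalSide p (quartic a b c) s i j)
    (hns : ¬ (residualPoly p (quartic a b c) s i j).Separable) :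
    i = 0 ∧ j = 2 ∧ ∃ ε, δ < ε ∧ devVal p (quartic a b c) s 0 = δ + 2 * ε ∧
      devCoeff (quartic a b c) s 1 ≠ 0 ∧ devVal p (quartic a b c) s 1 = δ + ε ∧
      (p : ℤ) ∣ unitPart p (quartic a b c) s 1 ^ 2 -
        4 * unitPart p (quartic a b c) s 2 * unitPart p (quartic a b c) s 0 := by
  classical
  have h' := h.tripleRoot
  have := Fact.mk h'.prime
  have hj := h'.isPrincipalSide_le hs
  obtain ⟨hij, ε, hε1, hε⟩ := exists_slope_of_not_separable h'.prime hs hj hns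
  have hw2 := h.val_two
  have hw3 := h'.devVal_three
  have hv0 := h.val_zero
  have hk := hs.1.2.2.2
  have hcases : (i = 0 ∧ j = 2) ∨ (i = 1 ∧ j = 3) ∨ (i = 0 ∧ j = 3) := by omega
  rcases hcases with ⟨rfl, rfl⟩ | ⟨rfl, rfl⟩ | ⟨rfl, rfl⟩
  · have h₀ : devVal p (quartic a b c) s 0 = δ + 2 * ε := by omega
    have h₄ := h'.not_dvd_four
    have hσ := not_dvd_unitPart h'.prime h'.devCoeff_zero_ne
    have hσ₂ := not_dvd_unitPart h'.prime h.two_ne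
    rw [← intCast_ne_zero_iff] at hσ hσ₂ h₄
    refine ⟨rfl, rfl, ε, by omega, h₀, ?_⟩
    rw [h.residualPoly_zero_two hs h₀] at hns
    have hd : residualCoeff p (quartic a b c) s 1 ^ 2 - 4 *
        (unitPart p (quartic a b c) s 2 : ZMod p) * (unitPart p (quartic a b c) s 0 : ZMod p)
          = 0 := by
      by_contra hd
      exact hns (separable_quadratic hd)
    have hc₁ : devCoeff (quartic a b c) s 1 ≠ 0 ∧
        devVal p (quartic a b c) s 1 + ε * (1 - 0) = devVal p (quartic a b c) s 0 := by
      by_contra hc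
      rw [residualCoeff_eq_of_slope hs.1 hε (by norm_num) (by norm_num), if_neg hc] at hd
      have : ((4 : ℤ) : ZMod p) * (unitPart p (quartic a b c) s 2 : ZMod p) *
        (unitPart p (quartic a b c) s 0 : ZMod p) = 0 := by
        push_cast at hd ⊢
        linear_combination -hd
      simp_all
    have h₁ : devVal p (quartic a b c) s 1 = δ + ε := by omega
    refine ⟨hc₁.1, h₁, ?_⟩
    rw [h.residualCoeff_one hs h₀ hc₁.1 h₁] at hd
    rw [← ZMod.intCast_zmod_eq_zero_iff_dvd]
    push_cast
    exact hd
  -- A side from 1 or from 0 to 3 would pass strictly above the point (2, δ).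
  · exfalso
    have h1 := h.val_one hs.1.2.1
    have h2 := (hk 2 h.two_ne).1
    push_cast at h2
    omega
  · exfalso
    have h2 := (hk 2 h.two_ne).1
    push_cast at h2
    omega

theorem exists_sq_dvd (h : IsIterate p a b c s δ) {ε : ℕ}
    (hs : IsPrincipalSide p (quartic a b c) s 0 2)
    (h₀ : devVal p (quartic a b c) s 0 = δ + 2 * ε) (h₁ : devCoeff (quartic a b c) s 1 ≠ 0)
    (h₁' : devVal p (quartic a b c) s 1 = δ + ε)
    (hd : (p : ℤ) ∣ unitPart p (quartic a b c) s 1 ^ 2 -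
      4 * unitPart p (quartic a b c) s 2 * unitPart p (quartic a b c) s 0) :
    ∃ y : ℤ, (X - C (y : ZMod p)) ^ 2 ∣ residualPoly p (quartic a b c) s 0 2 := by
  have h' := h.tripleRoot
  have := Fact.mk h'.prime
  rw [h.residualPoly_zero_two hs h₀, h.residualCoeff_one hs h₀ h₁ h₁']
  have hσ₂ := not_dvd_unitPart h'.prime h.two_ne
  have h₂ := h'.not_dvd_two
  rw [← intCast_ne_zero_iff] at hσ₂ h₂
  rw [← ZMod.intCast_zmod_eq_zero_iff_dvd] at hd
  generalize unitPart p (quartic a b c) s 1 = σ₁ at *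
  generalize unitPart p (quartic a b c) s 0 = σ₀ at *
  generalize unitPart p (quartic a b c) s 2 = σ₂ at *
  -- The double root of a quadratic is the root of its derivative.
  obtain ⟨y, hy⟩ := ZMod.intCast_surjective (-(σ₁ : ZMod p) / (2 * (σ₂ : ZMod p)))
  push_cast at hd h₂
  have e₁ : (σ₁ : ZMod p) = -2 * σ₂ * y := by
    rw [hy]; field_simp
  have e₀ : (σ₀ : ZMod p) = σ₂ * y ^ 2 := by
    have : (2 ^ 2 * (σ₂ : ZMod p)) * σ₀ = (2 ^ 2 * (σ₂ : ZMod p)) * (σ₂ * y ^ 2) := by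
      linear_combination -hd + ((σ₁ : ZMod p) - 2 * σ₂ * y) * e₁
    exact mul_left_cancel₀ (mul_ne_zero (pow_ne_zero _ h₂) hσ₂) this
  refine ⟨y, C (σ₂ : ZMod p), ?_⟩
  rw [e₀, e₁]
  simp only [map_mul, map_pow, map_neg, C_ofNat]
  ring

/-- A later step of the iteration keeps the shape of the polygon and makes progress. -/
theorem of_iterStep (h : IsIterate p a b c s δ) {t : ℤ} (hst : IterStep p (quartic a b c) s t) :
    IsIterate p a b c t δ ∧ ∃ ε, devVal p (quartic a b c) s 0 = δ + 2 * ε ∧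
      devVal p (quartic a b c) s 1 = δ + ε ∧
      δ + 2 * ε < devVal p (quartic a b c) t 0 := by
  obtain ⟨i, j, ε', y, hs, hns, hε', hy, rfl⟩ := hst
  have h' := h.tripleRoot
  obtain ⟨rfl, rfl, ε, hε, h₀, h₁, h₁', -⟩ := h.eq_of_not_separable hs hns
  have hw2 := h.val_two
  obtain rfl : ε' = ε := by omega
  have hδ := h.pos
  rw [h.residualPoly_zero_two hs h₀, h.residualCoeff_one hs h₀ h₁ h₁'] at hy
  obtain ⟨r₀, r₁⟩ := dvd_of_sq_dvd_quadratic hy h'.prime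
  have ht := h'.add rfl ((dvd_pow_self (p : ℤ) (by omega : ε' ≠ 0)).mul_left y)
  obtain ⟨e₀, e₁, e₂⟩ := devCoeff_add a b c s (y * (p : ℤ) ^ ε')
  have f₀ := pow_mul_unitPart p (quartic a b c) s 0
  have f₁ := pow_mul_unitPart p (quartic a b c) s 1
  have f₂ := pow_mul_unitPart p (quartic a b c) s 2
  have hσ₂ := not_dvd_unitPart h'.prime h.two_ne
  obtain ⟨q₀, hq₀⟩ := r₀
  obtain ⟨q₁, hq₁⟩ := r₁
  -- The strict inequality ε > δ makes the cubic term 4sy³p^(3ε) negligible: 3ε = δ + 2ε + 1 + ζ. It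
  -- also keeps A₂ unchanged modulo p^(δ+1).
  obtain ⟨ζ, rfl⟩ : ∃ ζ, ε' = δ + 1 + ζ := ⟨ε' - (δ + 1), by omega⟩
  rw [h₀] at f₀
  rw [h₁'] at f₁
  rw [hw2] at f₂
  have v₂ : padicValInt p (devCoeff (quartic a b c) (s + y * (p : ℤ) ^ (δ + 1 + ζ)) 2) = δ := by
    refine padicValInt_eq_of_dvd_sub h'.prime hσ₂ ?_
    rw [e₂, f₂]
    refine ⟨(p : ℤ) ^ ζ * (12 * s * y + 6 * y ^ 2 * (p : ℤ) ^ (δ + 1 + ζ)), ?_⟩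
    ring
  have v₀ : δ + 2 * (δ + 1 + ζ) + 1 ≤
      devVal p (quartic a b c) (s + y * (p : ℤ) ^ (δ + 1 + ζ)) 0 := by
    rw [← ht.pow_dvd ht.devCoeff_zero_ne, e₀, ← f₀, ← f₁, ← f₂]
    refine ⟨q₀ + (p : ℤ) ^ ζ * (4 * s * y ^ 3 + y ^ 4 * (p : ℤ) ^ (δ + 1 + ζ)), ?_⟩
    linear_combination (p : ℤ) ^ (δ + 2 * (δ + 1 + ζ)) * hq₀
  refine ⟨⟨ht, hδ, ?_, v₂, ?_, fun hne ↦ ?_⟩, _, h₀, h₁', v₀⟩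
  · intro h0
    rw [h0] at v₂
    simp at v₂
    omega
  · omega
  · have : δ + (δ + 1 + ζ) + 1 ≤ devVal p (quartic a b c) (s + y * (p : ℤ) ^ (δ + 1 + ζ)) 1 := by
      rw [← ht.pow_dvd hne, e₁, ← f₁, ← f₂]
      refine ⟨q₁ + (p : ℤ) ^ ζ * (12 * s * y ^ 2 + 4 * y ^ 3 * (p : ℤ) ^ (δ + 1 + ζ)), ?_⟩
      linear_combination (p : ℤ) ^ (δ + (δ + 1 + ζ)) * hq₁
    omega

/-- The leading part of the discriminant at a later iterate. -/
theorem pow_dvd_discr_sub (h : IsIterate p a b c s δ) {m : ℕ} (hm : 4 * δ + 1 ≤ m)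
    (h₀ : m ≤ devVal p (quartic a b c) s 0 + δ)
    (h₁ : devCoeff (quartic a b c) s 1 ≠ 0 → m ≤ 2 * devVal p (quartic a b c) s 1) :
    (p : ℤ) ^ (2 * δ + m + 1) ∣ (quartic a b c).discr - devCoeff (quartic a b c) s 3 ^ 2 *
      (devCoeff (quartic a b c) s 2 ^ 2 * (devCoeff (quartic a b c) s 1 ^ 2
        - 4 * devCoeff (quartic a b c) s 2 * devCoeff (quartic a b c) s 0)) := by
  have h' := h.tripleRoot
  have hδ := h.pos
  have hw2 := h.val_two
  -- x is m/2 rounded up, the value of A₁ that is guaranteed by m ≤ 2w₁.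
  obtain ⟨x, hx, hx'⟩ : ∃ x, m ≤ 2 * x ∧ 2 * x ≤ m + 1 := ⟨(m + 1) / 2, by omega, by omega⟩
  have d₀ : (p : ℤ) ^ (m - δ) ∣ devCoeff (quartic a b c) s 0 :=
    (h'.pow_dvd h'.devCoeff_zero_ne).2 (by omega)
  have d₁ : (p : ℤ) ^ x ∣ devCoeff (quartic a b c) s 1 := by
    by_cases h₁0 : devCoeff (quartic a b c) s 1 = 0
    · rw [h₁0]; exact dvd_zero _
    · exact (h'.pow_dvd h₁0).2 (by have := h₁ h₁0; omega)
  have d₂ : (p : ℤ) ^ δ ∣ devCoeff (quartic a b c) s 2 := (h'.pow_dvd h.two_ne).2 hw2.ge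
  have t := fun i j k ↦ pow_dvd_mul_pow (n := 2 * δ + m + 1) d₀ d₁ d₂ i j k
  have tail := pow_dvd_discr_tail (n := 2 * δ + m + 1) (devCoeff (quartic a b c) s 3) d₀ d₁ d₂
    (by omega) (by omega) (by omega) (by omega) (by omega) (by omega) (by omega) (by omega)
    (by omega)
  rw [discr_quartic_eq_devCoeff a b c s rfl rfl rfl rfl]
  generalize devCoeff (quartic a b c) s 0 = A₀ at *
  generalize devCoeff (quartic a b c) s 1 = A₁ at *
  generalize devCoeff (quartic a b c) s 2 = A₂ at *
  generalize devCoeff (quartic a b c) s 3 = A₃ at *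
  have head : (p : ℤ) ^ (2 * δ + m + 1) ∣ (-27 * A₃ ^ 4) * (A₂ ^ 0 * A₁ ^ 0 * A₀ ^ 2)
      + (-4 * A₃ ^ 3) * (A₂ ^ 0 * A₁ ^ 3 * A₀ ^ 0)
      + (18 * A₃ ^ 3) * (A₂ ^ 1 * A₁ ^ 1 * A₀ ^ 1) := by
    refine dvd_add (dvd_add ?_ ?_) ?_ <;>
    · refine Dvd.dvd.mul_left (t _ _ _ ?_) _
      omega
  convert! dvd_add head tail using 1
  ring

/-- The leading part has value at least 2δ + m and the remainder more. This is what bounds w₀ along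
the iteration. -/
theorem le_discr (h : IsIterate p a b c s δ) {m : ℕ} (hm : 4 * δ + 1 ≤ m)
    (h₀ : m ≤ devVal p (quartic a b c) s 0 + δ)
    (h₁ : devCoeff (quartic a b c) s 1 ≠ 0 → m ≤ 2 * devVal p (quartic a b c) s 1) :
    2 * δ + m ≤ padicValInt p (quartic a b c).discr := by
  have h' := h.tripleRoot
  have hd := h.pow_dvd_discr_sub hm h₀ h₁
  have hδ := h.pos
  have hw2 := h.val_two
  refine h'.le_discr ((dvd_sub_left ?_).1 ((pow_dvd_pow _ (Nat.le_succ _)).trans hd))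
  have d₀ : (p : ℤ) ^ (m - δ) ∣ devCoeff (quartic a b c) s 0 :=
    (h'.pow_dvd h'.devCoeff_zero_ne).2 (by omega)
  have d₁ : (p : ℤ) ^ ((m + 1) / 2) ∣ devCoeff (quartic a b c) s 1 := by
    by_cases h₁0 : devCoeff (quartic a b c) s 1 = 0
    · rw [h₁0]; exact dvd_zero _
    · exact (h'.pow_dvd h₁0).2 (by have := h₁ h₁0; omega)
  have d₂ : (p : ℤ) ^ δ ∣ devCoeff (quartic a b c) s 2 := (h'.pow_dvd h.two_ne).2 hw2.ge
  have t := fun i j k ↦ pow_dvd_mul_pow (n := 2 * δ + m) d₀ d₁ d₂ i j k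
  generalize devCoeff (quartic a b c) s 0 = A₀ at *
  generalize devCoeff (quartic a b c) s 1 = A₁ at *
  generalize devCoeff (quartic a b c) s 2 = A₂ at *
  generalize devCoeff (quartic a b c) s 3 = A₃ at *
  have head : (p : ℤ) ^ (2 * δ + m) ∣ A₃ ^ 2 * (A₂ ^ 2 * A₁ ^ 2 * A₀ ^ 0)
      + (-4 * A₃ ^ 2) * (A₂ ^ 3 * A₁ ^ 0 * A₀ ^ 1) := by
    refine dvd_add ?_ ?_ <;>
    · refine Dvd.dvd.mul_left (t _ _ _ ?_) _
      omega
  convert! head using 1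
  ring

/-- M records the class of (A₁² - 4A₂A₀)/p^m; equality holds when that class does not vanish. -/
theorem discr_eq (h : IsIterate p a b c s δ) {m : ℕ} {M : ℤ} (hm : 4 * δ + 1 ≤ m)
    (h₀ : m ≤ devVal p (quartic a b c) s 0 + δ)
    (h₁ : devCoeff (quartic a b c) s 1 ≠ 0 → m ≤ 2 * devVal p (quartic a b c) s 1)
    (hM : ¬ (p : ℤ) ∣ M)
    (hd : (p : ℤ) ^ (m + 1) ∣ devCoeff (quartic a b c) s 1 ^ 2
        - 4 * devCoeff (quartic a b c) s 2 * devCoeff (quartic a b c) s 0 - (p : ℤ) ^ m * M) :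
    padicValInt p (quartic a b c).discr = 2 * δ + m := by
  have h' := h.tripleRoot
  have hw2 := h.val_two
  have hdvd := h.pow_dvd_discr_sub hm h₀ h₁
  refine padicValInt_eq_of_dvd_sub h'.prime
    (M := (4 * s) ^ 2 * (unitPart p (quartic a b c) s 2 ^ 2 * M)) ?_ ?_
  · have hP := h'.isPrime
    intro hd
    rcases hP.dvd_or_dvd hd with hd | hd
    · exact h'.not_dvd_four_mul (hP.dvd_of_dvd_pow hd)
    · rcases hP.dvd_or_dvd hd with hd | hd
      · exact not_dvd_unitPart h'.prime h.two_ne (hP.dvd_of_dvd_pow hd)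
      · exact hM hd
  · have f₂ := pow_mul_unitPart p (quartic a b c) s 2
    rw [hw2] at f₂
    obtain ⟨u, hu⟩ := hdvd
    obtain ⟨v, hv⟩ := hd
    rw [IsTripleRoot.devCoeff_three] at hu
    refine ⟨u + (4 * s) ^ 2 * unitPart p (quartic a b c) s 2 ^ 2 * v, ?_⟩
    rw [sub_eq_iff_eq_add] at hv hu
    rw [hu, hv, ← f₂]
    ring

/-- The Newton polygon of a regular iterate on the abscissas `1` and `2`. -/
theorem exists_line_of_isRegular (h : IsIterate p a b c s δ)
    (hreg : IsRegular p (quartic a b c) s) :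
    ∃ α β : ℝ, (∀ k, devCoeff (quartic a b c) s k ≠ 0 →
        α + β * k ≤ devVal p (quartic a b c) s k) ∧
      newtonPolygon p (quartic a b c) s 1 = α + β * 1 ∧
      newtonPolygon p (quartic a b c) s 2 = α + β * 2 ∧
      α + β * 2 = δ ∧ 2 * (α + β) = (padicValInt p (quartic a b c).discr : ℝ) - 2 * δ := by
  have h' := h.tripleRoot
  have hw2 := h.val_two
  have hw3 := h'.devVal_three
  have hw4 := IsTripleRoot.devVal_four (p := p) (a := a) (b := b) (c := c) (s := s)
  have hv₀ := h.val_zero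
  have f₀ := pow_mul_unitPart p (quartic a b c) s 0
  have f₁ := pow_mul_unitPart p (quartic a b c) s 1
  have f₂ := pow_mul_unitPart p (quartic a b c) s 2
  have hv₀' : 3 * (δ : ℝ) + 1 ≤ devVal p (quartic a b c) s 0 := by exact_mod_cast hv₀
  have hw2' : (devVal p (quartic a b c) s 2 : ℝ) = δ := by exact_mod_cast hw2
  have hw3' : (devVal p (quartic a b c) s 3 : ℝ) = 0 := by exact_mod_cast hw3
  have hw4' : (devVal p (quartic a b c) s 4 : ℝ) = 0 := by exact_mod_cast hw4
  -- Here abscissa 1 is a vertex: A₁² alone leads the discriminant, and the line goes through the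
  -- points of abscissas 1 and 2.
  by_cases hcase : devCoeff (quartic a b c) s 1 ≠ 0 ∧
    2 * devVal p (quartic a b c) s 1 < devVal p (quartic a b c) s 0 + δ
  · obtain ⟨h₁, hlt⟩ := hcase
    have hv₁ := h.val_one h₁
    have hdisc : padicValInt p (quartic a b c).discr =
        2 * δ + 2 * devVal p (quartic a b c) s 1 := by
      refine h.discr_eq (M := unitPart p (quartic a b c) s 1 ^ 2) (by omega) (by omega)
        (fun _ ↦ le_rfl) (fun hd ↦
          not_dvd_unitPart h'.prime h₁ (h'.isPrime.dvd_of_dvd_pow hd)) ?_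
      obtain ⟨r, hr⟩ : ∃ r, devVal p (quartic a b c) s 0 + δ =
        2 * devVal p (quartic a b c) s 1 + 1 + r := Nat.exists_eq_add_of_lt hlt |>.imp
          fun r hr ↦ by omega
      refine ⟨- 4 * unitPart p (quartic a b c) s 2 * unitPart p (quartic a b c) s 0 *
        (p : ℤ) ^ r, ?_⟩
      have hpow : (p : ℤ) ^ δ * (p : ℤ) ^ devVal p (quartic a b c) s 0 =
          (p : ℤ) ^ (2 * devVal p (quartic a b c) s 1 + 1) * (p : ℤ) ^ r := by
        rw [← pow_add, ← pow_add, ← hr, add_comm]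
      rw [hw2] at f₂
      rw [← f₂, ← f₁, ← f₀, mul_comm 2 (devVal _ _ _ _), pow_mul]
      rw [mul_comm 2 (devVal _ _ _ _), ] at hpow
      linear_combination (-4 * unitPart p (quartic a b c) s 2 * unitPart p (quartic a b c) s 0) *
        hpow
    have hlt' : 2 * (devVal p (quartic a b c) s 1 : ℝ) < devVal p (quartic a b c) s 0 + δ := by
      exact_mod_cast hlt
    have hv₁' : 2 * (δ : ℝ) + 1 ≤ devVal p (quartic a b c) s 1 := by exact_mod_cast hv₁
    have hline : ∀ k, devCoeff (quartic a b c) s k ≠ 0 →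
        (2 * (devVal p (quartic a b c) s 1 : ℝ) - δ) +
          (δ - (devVal p (quartic a b c) s 1 : ℝ)) * k ≤ devVal p (quartic a b c) s k := by
      intro k hk
      have hk4 := IsTripleRoot.le_four hk
      interval_cases k <;> push_cast <;> linarith
    refine ⟨_, _, hline, newtonPolygon_eq hline h₁ h.two_ne (by push_cast; ring)
      (by push_cast; linarith) (by norm_num) (by norm_num), newtonPolygon_eq hline h₁ h.two_ne
      (by push_cast; ring) (by push_cast; linarith) (by norm_num) (by norm_num), by ring, ?_⟩
    rw [hdisc]
    push_cast
    ring
  -- Now a single side joins 0 to 2, and its ordinate at 1 is (w₀ + δ)/2.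
  · have hle : devCoeff (quartic a b c) s 1 ≠ 0 → devVal p (quartic a b c) s 0 + δ ≤
        2 * devVal p (quartic a b c) s 1 := fun h₁ ↦ by
      by_contra hlt
      exact hcase ⟨h₁, by omega⟩
    have hdisc : padicValInt p (quartic a b c).discr =
        2 * δ + (devVal p (quartic a b c) s 0 + δ) := by
      have hσ := not_dvd_unitPart h'.prime h'.devCoeff_zero_ne
      have hσ₂ := not_dvd_unitPart h'.prime h.two_ne
      rw [hw2] at f₂
      -- If abscissa 1 contributes to the side, M is the discriminant of the residual quadratic, and
      -- regularity is what keeps it a unit. Otherwise -4A₂A₀ leads alone.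
      by_cases heq : devCoeff (quartic a b c) s 1 ≠ 0 ∧
        2 * devVal p (quartic a b c) s 1 = devVal p (quartic a b c) s 0 + δ
      · obtain ⟨h₁, heq⟩ := heq
        obtain ⟨ε, hε⟩ : ∃ ε, devVal p (quartic a b c) s 1 = δ + ε :=
          ⟨devVal p (quartic a b c) s 1 - δ, by omega⟩
        have hs : IsPrincipalSide p (quartic a b c) s 0 2 :=
          h'.isPrincipalSide_zero_two h.two_ne (by omega) (fun _ ↦ by omega)
        refine h.discr_eq (by omega) le_rfl hle (M := unitPart p (quartic a b c) s 1 ^ 2 -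
          4 * unitPart p (quartic a b c) s 2 * unitPart p (quartic a b c) s 0) (fun hd ↦ ?_) ?_
        · obtain ⟨y, hy⟩ := h.exists_sq_dvd hs (ε := ε) (by omega) h₁ hε hd
          have := Fact.mk h'.prime
          exact not_separable_of_sq_dvd hy (hreg 0 2 hs)
        · refine ⟨0, ?_⟩
          rw [← f₂, ← f₁, ← f₀, ← heq, mul_comm 2 (devVal _ _ _ _), pow_mul]
          have hpow : (p : ℤ) ^ δ * (p : ℤ) ^ devVal p (quartic a b c) s 0 =
              ((p : ℤ) ^ devVal p (quartic a b c) s 1) ^ 2 := by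
            rw [← pow_add, ← pow_mul, add_comm, ← heq, mul_comm]
          linear_combination (-4 * unitPart p (quartic a b c) s 2 *
            unitPart p (quartic a b c) s 0) * hpow
      · refine h.discr_eq (by omega) le_rfl hle (M := - 4 * unitPart p (quartic a b c) s 2 *
          unitPart p (quartic a b c) s 0) (fun hd ↦ ?_) ?_
        · have hP := h'.isPrime
          rcases hP.dvd_or_dvd hd with hd | hd
          · rcases hP.dvd_or_dvd hd with hd | hd
            · exact h'.not_dvd_four ((dvd_neg).1 hd)
            · exact hσ₂ hd
          · exact hσ hd
        · have d₁ : (p : ℤ) ^ (devVal p (quartic a b c) s 0 + δ + 1) ∣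
              devCoeff (quartic a b c) s 1 ^ 2 := by
            by_cases h₁ : devCoeff (quartic a b c) s 1 = 0
            · rw [h₁]; exact dvd_zero _
            · have := hle h₁
              have hne : 2 * devVal p (quartic a b c) s 1 ≠ devVal p (quartic a b c) s 0 + δ :=
                fun h0 ↦ heq ⟨h₁, h0⟩
              have hdv := pow_dvd_pow_of_dvd ((h'.pow_dvd h₁).2 le_rfl) 2
              rw [← pow_mul] at hdv
              exact (pow_dvd_pow _ (by omega)).trans hdv
          obtain ⟨r, hr⟩ := d₁
          refine ⟨r, ?_⟩
          rw [hr, ← f₂, ← f₀, pow_add _ (devVal _ _ _ _) δ]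
          ring
    have hline : ∀ k, devCoeff (quartic a b c) s k ≠ 0 →
        (devVal p (quartic a b c) s 0 : ℝ) +
          ((δ - (devVal p (quartic a b c) s 0 : ℝ)) / 2) * k ≤ devVal p (quartic a b c) s k := by
      intro k hk
      have hk4 := IsTripleRoot.le_four hk
      interval_cases k
      · simp
      · have : (devVal p (quartic a b c) s 0 : ℝ) + δ ≤ 2 * devVal p (quartic a b c) s 1 := by
          exact_mod_cast hle hk
        push_cast; linarith
      all_goals push_cast; linarith
    refine ⟨_, _, hline, newtonPolygon_eq hline h'.devCoeff_zero_ne h.two_ne (by push_cast; ring)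
      (by push_cast; linarith) (by norm_num) (by norm_num),
      newtonPolygon_eq hline h'.devCoeff_zero_ne h.two_ne
      (by push_cast; ring) (by push_cast; linarith) (by norm_num) (by norm_num), by ring, ?_⟩
    rw [hdisc]
    push_cast
    ring

end IsIterate

end OreQuartic

/-! ### Irregularity criterion, regular starting integer, termination -/

namespace OreQuartic

variable {p : ℕ} {a b c s : ℤ}

namespace IsTripleRoot

theorem not_isRegular_iff (h : IsTripleRoot p a b c s) (hA : TwoAbove p a b c s) :
    ¬ IsRegular p (quartic a b c) s ↔ devCoeff (quartic a b c) s 1 ≠ 0 ∧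
      2 * devVal p (quartic a b c) s 0 = 3 * devVal p (quartic a b c) s 1 ∧
      (p : ℤ) ∣ unitPart p (quartic a b c) s 1 ^ 3 +
        27 * s * unitPart p (quartic a b c) s 0 ^ 2 := by
  constructor
  · intro hreg
    unfold IsRegular at hreg
    push Not at hreg
    obtain ⟨i, j, hs, hns⟩ := hreg
    obtain ⟨-, -, δ, -, h₀, h₁, h₁', hd⟩ := h.eq_of_not_separable hA hs hns
    exact ⟨h₁, by omega, hd⟩
  · rintro ⟨h₁, heq, hd⟩ hreg
    have := Fact.mk h.prime
    obtain ⟨δ, h₀⟩ : ∃ δ, devVal p (quartic a b c) s 0 = 3 * δ :=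
      ⟨devVal p (quartic a b c) s 0 / 3, by omega⟩
    obtain ⟨y, hy⟩ := h.exists_sq_dvd_zero_three hA h₀ h₁ (by omega) hd
    exact not_separable_of_sq_dvd hy (hreg 0 3 (h.principalSide_of_val hA h₀ (by omega)))

theorem exists_iterStep (h : IsTripleRoot p a b c s) (hA : TwoAbove p a b c s)
    (hreg : ¬ IsRegular p (quartic a b c) s) : ∃ t, IterStep p (quartic a b c) s t := by
  unfold IsRegular at hreg
  push Not at hreg
  obtain ⟨i, j, hs, hns⟩ := hreg
  obtain ⟨rfl, rfl, δ, -, h₀, h₁, h₁', hd⟩ := h.eq_of_not_separable hA hs hns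
  obtain ⟨y, hy⟩ := h.exists_sq_dvd_zero_three hA h₀ h₁ h₁' hd
  have hw3 := h.devVal_three
  exact ⟨_, 0, 3, δ, y, hs, hns, by omega, hy, rfl⟩

/-- The discriminant is led by -4A₃³(A₁³ + 27sA₀²). Cancellation is possible only if 2w₀ = 3w₁, and
there it is exactly the irregularity condition. -/
theorem discr_eq (h : IsTripleRoot p a b c s) (hA : TwoAbove p a b c s)
    (hreg : IsRegular p (quartic a b c) s) (h₁ : devCoeff (quartic a b c) s 1 ≠ 0)
    (hle : 3 * devVal p (quartic a b c) s 1 ≤ 2 * devVal p (quartic a b c) s 0) :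
    padicValInt p (quartic a b c).discr = 3 * devVal p (quartic a b c) s 1 := by
  have hP := h.isPrime
  have hw₁ := h.devVal_pos (k := 1) (by norm_num) h₁
  have f₀ := pow_mul_unitPart p (quartic a b c) s 0
  have f₁ := pow_mul_unitPart p (quartic a b c) s 1
  have hσ₁ := not_dvd_unitPart h.prime h₁
  set w := devVal p (quartic a b c) s 1 with hw
  -- the leading part
  obtain ⟨M, hM, hdM⟩ : ∃ M : ℤ, ¬ (p : ℤ) ∣ M ∧ (p : ℤ) ^ (3 * w + 1) ∣
      27 * s * devCoeff (quartic a b c) s 0 ^ 2 + devCoeff (quartic a b c) s 1 ^ 3 -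
        (p : ℤ) ^ (3 * w) * M := by
    rcases hle.lt_or_eq with hlt | heq
    · refine ⟨unitPart p (quartic a b c) s 1 ^ 3, fun hd ↦ hσ₁ (hP.dvd_of_dvd_pow hd), ?_⟩
      have d₀ : (p : ℤ) ^ (3 * w + 1) ∣ devCoeff (quartic a b c) s 0 ^ 2 := by
        have hdv := pow_dvd_pow_of_dvd ((h.pow_dvd h.devCoeff_zero_ne).2 le_rfl) 2
        rw [← pow_mul] at hdv
        exact (pow_dvd_pow _ (by omega)).trans hdv
      obtain ⟨r, hr⟩ := d₀
      refine ⟨27 * s * r, ?_⟩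
      rw [hr, ← f₁]
      ring
    · refine ⟨unitPart p (quartic a b c) s 1 ^ 3 + 27 * s * unitPart p (quartic a b c) s 0 ^ 2,
        fun hd ↦ ?_, 0, ?_⟩
      · exact (h.not_isRegular_iff hA).2 ⟨h₁, heq.symm, hd⟩ hreg
      · have hpow : ((p : ℤ) ^ devVal p (quartic a b c) s 0) ^ 2 = (p : ℤ) ^ (3 * w) := by
          rw [← pow_mul, heq, mul_comm]
        rw [← f₁, ← f₀]
        linear_combination (27 * s * unitPart p (quartic a b c) s 0 ^ 2) * hpow
  -- From 3w₁ ≤ 2w₀ and `TwoAbove` one gets w₁ < 2w₂, so terms containing A₂ have value above 3w₁.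
  -- If A₂ = 0 any large x serves, and w is enough.
  obtain ⟨x, hx, d₂⟩ : ∃ x, w < 2 * x ∧ (p : ℤ) ^ x ∣ devCoeff (quartic a b c) s 2 := by
    by_cases h₂ : devCoeff (quartic a b c) s 2 = 0
    · exact ⟨w, by omega, by rw [h₂]; exact _root_.dvd_zero _⟩
    · exact ⟨_, by have := hA h₂; omega, (h.pow_dvd h₂).2 le_rfl⟩
  have d₀ : (p : ℤ) ^ devVal p (quartic a b c) s 0 ∣ devCoeff (quartic a b c) s 0 :=
    (h.pow_dvd h.devCoeff_zero_ne).2 le_rfl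
  have d₁ : (p : ℤ) ^ w ∣ devCoeff (quartic a b c) s 1 := (h.pow_dvd h₁).2 le_rfl
  have t := fun i j k ↦ pow_dvd_mul_pow (n := 3 * w + 1) d₀ d₁ d₂ i j k
  have tail := pow_dvd_discr_tail (n := 3 * w + 1) (devCoeff (quartic a b c) s 3) d₀ d₁ d₂
    (by omega) (by omega) (by omega) (by omega) (by omega) (by omega) (by omega) (by omega)
    (by omega)
  refine padicValInt_eq_of_dvd_sub h.prime (M := -4 * (4 * s) ^ 3 * M) ?_ ?_
  · intro hd
    rcases hP.dvd_or_dvd hd with hd | hd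
    · rcases hP.dvd_or_dvd hd with hd | hd
      · exact h.not_dvd_four ((dvd_neg).1 hd)
      · exact h.not_dvd_four_mul (hP.dvd_of_dvd_pow hd)
    · exact hM hd
  rw [discr_quartic_eq_devCoeff a b c s rfl rfl rfl devCoeff_three]
  rw [devCoeff_three] at tail
  generalize devCoeff (quartic a b c) s 0 = A₀ at *
  generalize devCoeff (quartic a b c) s 1 = A₁ at *
  generalize devCoeff (quartic a b c) s 2 = A₂ at *
  have head : (p : ℤ) ^ (3 * w + 1) ∣ (4 * s) ^ 2 * (A₂ ^ 2 * A₁ ^ 2 * A₀ ^ 0)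
      + (-4 * (4 * s) ^ 2) * (A₂ ^ 3 * A₁ ^ 0 * A₀ ^ 1)
      + (18 * (4 * s) ^ 3) * (A₂ ^ 1 * A₁ ^ 1 * A₀ ^ 1) := by
    refine dvd_add (dvd_add ?_ ?_) ?_ <;>
    · refine Dvd.dvd.mul_left (t _ _ _ ?_) _
      omega
  convert! dvd_add (dvd_add head tail) (hdM.mul_left (-4 * (4 * s) ^ 3)) using 1
  ring

theorem devVal_real (h : IsTripleRoot p a b c s) :
    (devVal p (quartic a b c) s 3 : ℝ) = 0 ∧ (devVal p (quartic a b c) s 4 : ℝ) = 0 := by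
  rw [h.devVal_three, devVal_four]
  simp

/-- The polygon is the segment from (0, w₀) to (3, 0). -/
theorem exists_line_of_lt (h : IsTripleRoot p a b c s) (hA : TwoAbove p a b c s)
    (hlt : devCoeff (quartic a b c) s 1 ≠ 0 →
      2 * devVal p (quartic a b c) s 0 < 3 * devVal p (quartic a b c) s 1) :
    ∃ α β : ℝ, (∀ k, devCoeff (quartic a b c) s k ≠ 0 →
        α + β * k ≤ devVal p (quartic a b c) s k) ∧
      newtonPolygon p (quartic a b c) s 1 = α + β * 1 ∧
      newtonPolygon p (quartic a b c) s 2 = α + β * 2 ∧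
      α + β = 2 * devVal p (quartic a b c) s 0 / 3 ∧
      α + β * 2 = devVal p (quartic a b c) s 0 / 3 := by
  obtain ⟨hw3, hw4⟩ := h.devVal_real
  have hw0 : (0 : ℝ) ≤ devVal p (quartic a b c) s 0 := by positivity
  have hline : ∀ k, devCoeff (quartic a b c) s k ≠ 0 →
      (devVal p (quartic a b c) s 0 : ℝ) + (-(devVal p (quartic a b c) s 0 : ℝ) / 3) * k
        ≤ devVal p (quartic a b c) s k := by
    intro k hk
    have hk4 := le_four hk
    interval_cases k
    · simp
    · have : 2 * (devVal p (quartic a b c) s 0 : ℝ) < 3 * devVal p (quartic a b c) s 1 := by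
        exact_mod_cast hlt hk
      push_cast; linarith
    · have : devVal p (quartic a b c) s 0 < 3 * devVal p (quartic a b c) s 2 := by
        rcases hA hk with h' | ⟨h', h''⟩
        · exact h'
        · have := hlt h'
          omega
      have : (devVal p (quartic a b c) s 0 : ℝ) < 3 * devVal p (quartic a b c) s 2 := by
        exact_mod_cast this
      push_cast; linarith
    all_goals push_cast; linarith
  refine ⟨_, _, hline, newtonPolygon_eq hline h.devCoeff_zero_ne h.devCoeff_three_ne
    (by push_cast; ring) (by push_cast; linarith) (by norm_num) (by norm_num),
    newtonPolygon_eq hline h.devCoeff_zero_ne h.devCoeff_three_ne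
    (by push_cast; ring) (by push_cast; linarith) (by norm_num) (by norm_num), by ring, by ring⟩

/-- On [1, 3] the polygon is the segment from (1, w₁) to (3, 0). Its ordinate w₁ at 1 equals (Δ -
w₁)/2 because Δ = 3w₁. -/
theorem exists_line_of_le (h : IsTripleRoot p a b c s) (hA : TwoAbove p a b c s)
    (hreg : IsRegular p (quartic a b c) s) (h₁ : devCoeff (quartic a b c) s 1 ≠ 0)
    (hle : 3 * devVal p (quartic a b c) s 1 ≤ 2 * devVal p (quartic a b c) s 0) :
    ∃ α β : ℝ, (∀ k, devCoeff (quartic a b c) s k ≠ 0 →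
        α + β * k ≤ devVal p (quartic a b c) s k) ∧
      newtonPolygon p (quartic a b c) s 1 = α + β * 1 ∧
      newtonPolygon p (quartic a b c) s 2 = α + β * 2 ∧
      2 * (α + β) = padicValInt p (quartic a b c).discr - devVal p (quartic a b c) s 1 ∧
      α + β * 2 = devVal p (quartic a b c) s 1 / 2 := by
  obtain ⟨hw3, hw4⟩ := h.devVal_real
  have hw1 : (0 : ℝ) ≤ devVal p (quartic a b c) s 1 := by positivity
  have hline : ∀ k, devCoeff (quartic a b c) s k ≠ 0 →
      3 * (devVal p (quartic a b c) s 1 : ℝ) / 2 + (-(devVal p (quartic a b c) s 1 : ℝ) / 2) * k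
        ≤ devVal p (quartic a b c) s k := by
    intro k hk
    have hk4 := le_four hk
    interval_cases k
    · have : 3 * (devVal p (quartic a b c) s 1 : ℝ) ≤ 2 * devVal p (quartic a b c) s 0 := by
        exact_mod_cast hle
      push_cast; linarith
    · push_cast; linarith
    · have : devVal p (quartic a b c) s 1 ≤ 2 * devVal p (quartic a b c) s 2 := by
        have := hA hk
        omega
      have : (devVal p (quartic a b c) s 1 : ℝ) ≤ 2 * devVal p (quartic a b c) s 2 := by
        exact_mod_cast this
      push_cast; linarith
    all_goals push_cast; linarith
  refine ⟨_, _, hline, newtonPolygon_eq hline h₁ h.devCoeff_three_ne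
    (by push_cast; ring) (by push_cast; linarith) (by norm_num) (by norm_num),
    newtonPolygon_eq hline h₁ h.devCoeff_three_ne
    (by push_cast; ring) (by push_cast; linarith) (by norm_num) (by norm_num), ?_, by ring⟩
  rw [h.discr_eq hA hreg h₁ hle]
  push_cast
  ring

end IsTripleRoot

namespace IsIterate

variable {δ : ℕ}

theorem exists_iterStep (h : IsIterate p a b c s δ)
    (hreg : ¬ IsRegular p (quartic a b c) s) : ∃ t, IterStep p (quartic a b c) s t := by
  unfold IsRegular at hreg
  push Not at hreg
  obtain ⟨i, j, hs, hns⟩ := hreg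
  obtain ⟨rfl, rfl, ε, -, h₀, h₁, h₁', hd⟩ := h.eq_of_not_separable hs hns
  obtain ⟨y, hy⟩ := h.exists_sq_dvd hs h₀ h₁ h₁' hd
  have hw2 := h.val_two
  exact ⟨_, 0, 2, ε, y, hs, hns, by omega, hy, rfl⟩

theorem of_reflTransGen (h : IsIterate p a b c s δ) {t : ℤ}
    (ht : Relation.ReflTransGen (IterStep p (quartic a b c)) s t) : IsIterate p a b c t δ := by
  induction ht with
  | refl => exact h
  | tail _ hst ih => exact (ih.of_iterStep hst).1

/-- The iteration stops, since the discriminant is nonzero. -/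
theorem not_forall_iterStep (h : IsIterate p a b c s δ) (t : ℕ → ℤ) (h0 : t 0 = s)
    (hstep : ∀ n, IterStep p (quartic a b c) (t n) (t (n + 1))) : False := by
  have key : ∀ n, IsIterate p a b c (t n) δ ∧ n ≤ devVal p (quartic a b c) (t n) 0 := by
    intro n
    induction n with
    | zero => exact ⟨by rwa [h0], Nat.zero_le _⟩
    | succ n ih =>
      obtain ⟨hn, ε, h₀, h₁, hlt⟩ := ih.1.of_iterStep (hstep n)
      exact ⟨hn, by omega⟩
  -- At an irregular iterate w₀ + δ = 2w₁, so m = w₀ + δ is admissible and w₀ < Δ; the index Δ + 1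
  -- is already too large.
  obtain ⟨hn, hle⟩ := key (padicValInt p (quartic a b c).discr + 1)
  obtain ⟨-, ε, h₀, h₁, -⟩ := hn.of_iterStep (hstep _)
  have hv := hn.val_zero
  have := hn.le_discr (m := devVal p (quartic a b c) _ 0 + δ) (by omega) le_rfl
    (fun _ ↦ by omega)
  omega

end IsIterate

namespace IsTripleRoot

/-- The integers produced by the iteration: the initial one and those having the shape described
by `IsIterate`. -/
theorem eq_or_isIterate (h : IsTripleRoot p a b c s) (hA : TwoAbove p a b c s) {t : ℤ}
    (ht : Relation.ReflTransGen (IterStep p (quartic a b c)) s t) :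
    t = s ∨ ∃ δ, devVal p (quartic a b c) s 0 = 3 * δ ∧ devCoeff (quartic a b c) s 1 ≠ 0 ∧
      devVal p (quartic a b c) s 1 = 2 * δ ∧ IsIterate p a b c t δ := by
  rcases ht.cases_head with rfl | ⟨r, hsr, hrt⟩
  · exact Or.inl rfl
  · obtain ⟨δ, h₀, h₁, h₁', hr⟩ := h.isIterate_of_iterStep hA hsr
    exact Or.inr ⟨δ, h₀, h₁, h₁', hr.of_reflTransGen hrt⟩

end IsTripleRoot

end OreQuartic

/-! ### Ultrametric estimates at a place above p -/

namespace OreQuartic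

section place

variable {K : Type*} [Field K] {v : AbsoluteValue K ℝ} {p : ℕ}

theorem map_sum_lt (hna : IsNonarchimedean v) {ι : Type*} {S : Finset ι} {g : ι → K} {B : ℝ}
    (hB : 0 < B) (h : ∀ k ∈ S, v (g k) < B) : v (∑ k ∈ S, g k) < B := by
  classical
  induction S using Finset.induction_on with
  | empty => simpa using hB
  | insert k S hk ih =>
    rw [Finset.sum_insert hk]
    refine (hna _ _).trans_lt (max_lt (h k (Finset.mem_insert_self _ _)) (ih fun l hl ↦ ?_))
    exact h l (Finset.mem_insert_of_mem hl)

theorem map_sum_le (hna : IsNonarchimedean v) {ι : Type*} {S : Finset ι} {g : ι → K} {B : ℝ}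
    (hB : 0 ≤ B) (h : ∀ k ∈ S, v (g k) ≤ B) : v (∑ k ∈ S, g k) ≤ B := by
  classical
  induction S using Finset.induction_on with
  | empty => simpa using hB
  | insert k S hk ih =>
    rw [Finset.sum_insert hk]
    refine (hna _ _).trans (max_le (h k (Finset.mem_insert_self _ _)) (ih fun l hl ↦ ?_))
    exact h l (Finset.mem_insert_of_mem hl)

theorem map_add_eq_of_lt (hna : IsNonarchimedean v) {x y : K} (h : v x < v y) :
    v (x + y) = v y := by
  refine le_antisymm ((hna _ _).trans (max_le h.le le_rfl)) ?_
  by_contra! hlt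
  have : v y ≤ max (v (x + y)) (v (-x)) := by
    convert! hna (x + y) (-x) using 2
    ring
  rw [v.map_neg] at this
  exact absurd this (not_le.2 (max_lt hlt h))

theorem map_intCast_eq_one (hna : IsNonarchimedean v) (hp : p.Prime) (hv : v p < 1) {n : ℤ}
    (hn : ¬ (p : ℤ) ∣ n) : v n = 1 := by
  refine le_antisymm hna.apply_intCast_le_one ?_
  by_contra! hlt
  obtain ⟨x, y, hxy⟩ : IsCoprime (p : ℤ) n :=
    ((Nat.prime_iff_prime_int.1 hp).coprime_iff_not_dvd).2 hn
  have h1 : v ((x : K) * p + y * n) = 1 := by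
    have : (x : K) * p + y * n = 1 := by exact_mod_cast congrArg (Int.cast (R := K)) hxy
    rw [this, map_one]
  have h2 : v ((x : K) * p + y * n) < 1 := by
    refine (hna _ _).trans_lt (max_lt ?_ ?_)
    · rw [map_mul]
      exact (mul_le_of_le_one_left (v.nonneg _) hna.apply_intCast_le_one).trans_lt hv
    · rw [map_mul]
      exact (mul_le_of_le_one_left (v.nonneg _) hna.apply_intCast_le_one).trans_lt hlt
  linarith

theorem map_devCoeff (hna : IsNonarchimedean v) (hp : p.Prime) (hv : v p < 1) {F : ℤ[X]} {s : ℤ}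
    {k : ℕ} (hk : devCoeff F s k ≠ 0) :
    v (devCoeff F s k : K) = v p ^ (devVal p F s k : ℝ) := by
  have h := congrArg (Int.cast (R := K)) (pow_mul_unitPart p F s k)
  push_cast at h
  rw [← h, map_mul, map_pow, map_intCast_eq_one hna hp hv (not_dvd_unitPart hp hk), mul_one,
    Real.rpow_natCast]

theorem map_aeval_le_one (hna : IsNonarchimedean v) {ξ : K} (hξ : v ξ ≤ 1) (P : ℤ[X]) :
    v (aeval ξ P) ≤ 1 := by
  rw [aeval_eq_sum_range]
  refine map_sum_le hna zero_le_one fun k _ ↦ ?_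
  rw [zsmul_eq_mul, map_mul, map_pow]
  exact mul_le_one₀ hna.apply_intCast_le_one (by positivity) (pow_le_one₀ (v.nonneg _) hξ)

theorem map_aeval_lt_one (hna : IsNonarchimedean v) (hv : v p < 1) {ξ : K} (hξ : v ξ ≤ 1)
    {P : ℤ[X]} (hP : P.map (Int.castRingHom (ZMod p)) = 0) : v (aeval ξ P) < 1 := by
  have : C (p : ℤ) ∣ P := by
    rw [C_dvd_iff_dvd_coeff]
    intro k
    have := congrArg (fun Q ↦ coeff Q k) hP
    simp only [coeff_map, eq_intCast, coeff_zero] at this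
    exact (ZMod.intCast_zmod_eq_zero_iff_dvd _ _).1 this
  obtain ⟨Q, rfl⟩ := this
  rw [map_mul, map_mul, aeval_C]
  refine (mul_le_of_le_one_right (v.nonneg _) (map_aeval_le_one hna hξ Q)).trans_lt ?_
  simpa using hv

/-- If the reduction of `R` is separable, then a root of `R` modulo a place is a simple root. -/
theorem map_aeval_derivative_eq_one (hna : IsNonarchimedean v) (hv : v p < 1) {ξ : K}
    (hξ : v ξ ≤ 1) {R : ℤ[X]} (hR : (R.map (Int.castRingHom (ZMod p))).Separable)
    (hroot : v (aeval ξ R) < 1) : v (aeval ξ (derivative R)) = 1 := by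
  obtain ⟨A, B, hAB⟩ := hR
  -- The Bézout identity over the residue field lifts to ℤ[X] up to an error divisible by p.
  have hsurj := map_surjective (Int.castRingHom (ZMod p)) (ZMod.ringHom_surjective _)
  obtain ⟨A, rfl⟩ := hsurj A
  obtain ⟨B, rfl⟩ := hsurj B
  have h0 : (1 - (A * R + B * derivative R)).map (Int.castRingHom (ZMod p)) = 0 := by
    rw [Polynomial.map_sub, Polynomial.map_add, Polynomial.map_mul, Polynomial.map_mul,
      ← derivative_map, hAB, Polynomial.map_one, sub_self]
  have h1 := map_aeval_lt_one hna hv hξ h0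
  have hB := map_aeval_le_one hna hξ B
  have hA := map_aeval_le_one hna hξ A
  refine le_antisymm (map_aeval_le_one hna hξ _) ?_
  by_contra! hlt
  have h2 : v (1 : K) < 1 := by
    have e : (1 : K) = aeval ξ (1 - (A * R + B * derivative R)) +
        (aeval ξ A * aeval ξ R + aeval ξ B * aeval ξ (derivative R)) := by
      simp
    rw [e]
    refine (hna _ _).trans_lt (max_lt h1 ((hna _ _).trans_lt (max_lt ?_ ?_)))
    · rw [map_mul]
      exact (mul_le_of_le_one_left (v.nonneg _) hA).trans_lt hroot
    · rw [map_mul]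
      exact (mul_le_of_le_one_left (v.nonneg _) hB).trans_lt hlt
  simp at h2

end place

end OreQuartic

/-! ### The value of the derivative under regularity -/

namespace OreQuartic

section place

variable {K : Type*} [Field K] {v : AbsoluteValue K ℝ} {p : ℕ} {F : ℤ[X]} {s : ℤ}

open Classical in
/-- An integral lift of the residual coefficient, along a side. -/
noncomputable def residualLift (p : ℕ) (F : ℤ[X]) (s : ℤ) (i j k : ℕ) : ℤ :=
  if devCoeff F s k ≠ 0 ∧
      ((devVal p F s j : ℤ) - devVal p F s i) * ((k : ℤ) - i)
        = ((devVal p F s k : ℤ) - devVal p F s i) * ((j : ℤ) - i)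
    then unitPart p F s k else 0

/-- An integral lift of the residual polynomial of a side. -/
noncomputable def residualPolyLift (p : ℕ) (F : ℤ[X]) (s : ℤ) (i j : ℕ) : ℤ[X] :=
  ∑ k ∈ Finset.range (sideDegree p F s i j + 1),
    C (residualLift p F s i j (i + k * ((j - i) / sideDegree p F s i j))) * X ^ k

theorem map_residualPolyLift {i j : ℕ} (h : IsSide p F s i j) :
    (residualPolyLift p F s i j).map (Int.castRingHom (ZMod p)) = residualPoly p F s i j := by
  classical
  rw [residualPolyLift, residualPoly, Polynomial.map_sum]
  refine Finset.sum_congr rfl fun k hk ↦ ?_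
  have hd : sideDegree p F s i j ∣ j - i := Nat.gcd_dvd_left _ _
  have hkd : k ≤ sideDegree p F s i j := Nat.lt_succ_iff.1 (Finset.mem_range.1 hk)
  have hle : k * ((j - i) / sideDegree p F s i j) ≤ j - i := by
    calc k * ((j - i) / sideDegree p F s i j)
        ≤ sideDegree p F s i j * ((j - i) / sideDegree p F s i j) := Nat.mul_le_mul_right _ hkd
      _ = j - i := Nat.mul_div_cancel' hd
  have hij := h.1
  rw [Polynomial.map_mul, Polynomial.map_pow, map_X, map_C, h.residualCoeff_eq (by omega)
    (by omega), residualLift]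
  congr 2
  split_ifs <;> simp [unitPart]

/-- Evaluation of the monomials on a side in terms of the lifted residual polynomial. -/
theorem sum_side_eq {i j d e h' : ℕ} {z : K} (hp0 : (p : K) ≠ 0) (hs : IsSide p F s i j)
    (hd : d = sideDegree p F s i j) (he : j - i = d * e)
    (hh : devVal p F s i = devVal p F s j + d * h') {T : Finset ℕ}
    (hT : ∀ k, k ∈ T ↔ i ≤ k ∧ k ≤ j ∧ devCoeff F s k ≠ 0 ∧
      ((devVal p F s j : ℤ) - devVal p F s i) * ((k : ℤ) - i)
        = ((devVal p F s k : ℤ) - devVal p F s i) * ((j : ℤ) - i)) (φ : ℕ → K) :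
    ∑ k ∈ T, φ k * ((devCoeff F s k : K) * z ^ k) = (p : K) ^ devVal p F s i * z ^ i *
      ∑ m ∈ Finset.range (d + 1), φ (i + m * e) *
        ((residualLift p F s i j (i + m * e) : K) * (z ^ e / (p : K) ^ h') ^ m) := by
  classical
  have hij := hs.1
  have hd0 : 0 < d := Nat.pos_of_ne_zero fun h0 ↦ by rw [h0, zero_mul] at he; omega
  have he0 : 0 < e := Nat.pos_of_ne_zero fun h0 ↦ by rw [h0, mul_zero] at he; omega
  have hji : (j : ℤ) - i = d * e := by
    have := congrArg (Nat.cast (R := ℤ)) he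
    rw [Nat.cast_sub hij.le] at this
    exact_mod_cast this
  have hwij : (devVal p F s j : ℤ) - devVal p F s i = - (d * h') := by
    rw [hh]; push_cast; ring
  have hcop : Nat.Coprime e h' := by
    have : Nat.gcd (d * e) (d * h') = d := by
      conv_rhs => rw [hd, sideDegree, he, hh, Nat.add_sub_cancel_left]
    rw [Nat.gcd_mul_left] at this
    exact Nat.eq_of_mul_eq_mul_left hd0 (by rw [this, mul_one])
  -- points on the side
  have hon : ∀ m : ℕ, (((devVal p F s j : ℤ) - devVal p F s i) * (((i + m * e : ℕ) : ℤ) - i)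
        = ((devVal p F s (i + m * e) : ℤ) - devVal p F s i) * ((j : ℤ) - i)) ↔
      devVal p F s (i + m * e) + m * h' = devVal p F s i := by
    intro m
    rw [hwij, hji, ← @Nat.cast_inj ℤ]
    push_cast
    have hde : (d : ℤ) * e ≠ 0 := by positivity
    constructor
    · intro h0
      refine mul_left_cancel₀ hde ?_
      linear_combination -h0
    · intro h0
      linear_combination (-(d : ℤ) * e) * h0
  have hinj : Set.InjOn (fun m ↦ i + m * e) (Finset.range (d + 1) : Set ℕ) := by
    intro m _ m' _ hmm
    exact Nat.eq_of_mul_eq_mul_right he0 (Nat.add_left_cancel hmm)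
  -- Since e and h' are coprime, points with integral ordinates on the side occur only at steps of
  -- e.
  have hsub : T ⊆ (Finset.range (d + 1)).image fun m ↦ i + m * e := by
    intro k hk
    obtain ⟨hik, hkj, -, hline⟩ := (hT k).1 hk
    obtain ⟨n, rfl⟩ := Nat.exists_eq_add_of_le hik
    rw [hwij, hji] at hline
    push_cast at hline
    have hlin : (n : ℤ) * h' = e * ((devVal p F s i : ℤ) - devVal p F s (i + n)) := by
      have hd' : (d : ℤ) ≠ 0 := by positivity
      refine mul_left_cancel₀ hd' ?_
      linear_combination -hline
    have hdvd : (e : ℤ) ∣ n * h' := ⟨_, hlin⟩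
    have hen : e ∣ n := by
      have : e ∣ n * h' := by exact_mod_cast hdvd
      exact hcop.dvd_of_dvd_mul_right this
    obtain ⟨m, rfl⟩ := hen
    refine Finset.mem_image.2 ⟨m, Finset.mem_range.2 (Nat.lt_succ_of_le ?_), by ring⟩
    refine (Nat.mul_le_mul_left_iff he0).1 ?_
    calc e * m ≤ j - i := by omega
      _ = e * d := by rw [he, mul_comm]
  have h1 : ∑ k ∈ T, φ k * ((devCoeff F s k : K) * z ^ k) =
      ∑ k ∈ (Finset.range (d + 1)).image fun m ↦ i + m * e,
        if k ∈ T then φ k * ((devCoeff F s k : K) * z ^ k) else 0 := by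
    rw [← Finset.sum_filter, Finset.filter_mem_eq_inter, Finset.inter_eq_right.2 hsub]
  rw [h1, Finset.sum_image hinj, Finset.mul_sum]
  refine Finset.sum_congr rfl fun m hm ↦ ?_
  have hmd : m ≤ d := Nat.lt_succ_iff.1 (Finset.mem_range.1 hm)
  have hle : m * e ≤ j - i := he ▸ Nat.mul_le_mul_right e hmd
  by_cases hc : devCoeff F s (i + m * e) ≠ 0 ∧
      devVal p F s (i + m * e) + m * h' = devVal p F s i
  · rw [if_pos ((hT _).2 ⟨by omega, by omega, hc.1, (hon m).2 hc.2⟩), residualLift,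
      if_pos ⟨hc.1, (hon m).2 hc.2⟩]
    have f := congrArg (Int.cast (R := K)) (pow_mul_unitPart p F s (i + m * e))
    push_cast at f
    rw [← f, ← hc.2, div_pow, ← pow_mul, ← pow_mul, mul_comm e m, mul_comm h' m, pow_add, pow_add]
    field_simp
  · rw [if_neg fun hk ↦ hc ⟨((hT _).1 hk).2.2.1, (hon m).1 ((hT _).1 hk).2.2.2⟩, residualLift,
      if_neg fun hk ↦ hc ⟨hk.1, (hon m).1 hk.2⟩]
    simp

/-- The value at a place of the derivative at a root of a regular polynomial. -/
theorem exists_map_sum_natCast_mul_eq (hna : IsNonarchimedean v) (hp : p.Prime) (hv0 : 0 < v p)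
    (hv : v p < 1) {N : ℕ} (hN : ∀ k, N ≤ k → devCoeff F s k = 0) (hNp : N ≤ p)
    (hne : ∃ k, devCoeff F s k ≠ 0) (hreg : IsRegular p F s) {z : K} {l : ℝ} (hl : 0 < l)
    (hz : v z = v p ^ l) (hsum : ∑ k ∈ Finset.range N, (devCoeff F s k : K) * z ^ k = 0) :
    ∃ c : ℝ, (∀ k, devCoeff F s k ≠ 0 → c ≤ devVal p F s k + l * k) ∧
      v (∑ k ∈ Finset.range N, (k : K) * ((devCoeff F s k : K) * z ^ k)) = v p ^ c := by
  classical
  have hp0 : (p : K) ≠ 0 := fun h0 ↦ by simp [h0] at hv0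
  set wt : ℕ → ℝ := fun k ↦ devVal p F s k + l * k with hwt
  have hlt : ∀ k, devCoeff F s k ≠ 0 → k < N := fun k hk ↦ by
    by_contra hge
    exact hk (hN k (not_lt.1 hge))
  obtain ⟨k₀, hk₀⟩ := hne
  obtain ⟨k₁, hk₁, hmin⟩ := ((Finset.range N).filter fun k ↦ devCoeff F s k ≠ 0).exists_min_image
    wt ⟨k₀, Finset.mem_filter.2 ⟨Finset.mem_range.2 (hlt _ hk₀), hk₀⟩⟩
  set c := wt k₁ with hc
  have hcle : ∀ k, devCoeff F s k ≠ 0 → c ≤ wt k := fun k hk ↦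
    hmin k (Finset.mem_filter.2 ⟨Finset.mem_range.2 (hlt _ hk), hk⟩)
  refine ⟨c, hcle, ?_⟩
  set T := (Finset.range N).filter fun k ↦ devCoeff F s k ≠ 0 ∧ wt k = c with hTdef
  have hmemT : ∀ k, k ∈ T ↔ devCoeff F s k ≠ 0 ∧ wt k = c := fun k ↦ by
    rw [hTdef, Finset.mem_filter, Finset.mem_range]
    exact ⟨fun h ↦ h.2, fun h ↦ ⟨hlt _ h.1, h⟩⟩
  have hk₁T : k₁ ∈ T := (hmemT _).2 ⟨(Finset.mem_filter.1 hk₁).2, rfl⟩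
  have hterm : ∀ k, devCoeff F s k ≠ 0 → v ((devCoeff F s k : K) * z ^ k) = v p ^ wt k := by
    intro k hk
    rw [map_mul, map_pow, map_devCoeff hna hp hv hk, hz, ← Real.rpow_mul_natCast hv0.le,
      ← Real.rpow_add hv0]
  have hρc : 0 < v p ^ c := Real.rpow_pos_of_pos hv0 _
  have hoff : ∀ φ : ℕ → K, (∀ k, v (φ k) ≤ 1) →
      v (∑ k ∈ (Finset.range N).filter fun k ↦ ¬ (devCoeff F s k ≠ 0 ∧ wt k = c),
        φ k * ((devCoeff F s k : K) * z ^ k)) < v p ^ c := by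
    intro φ hφ
    refine map_sum_lt hna hρc fun k hk ↦ ?_
    by_cases hk0 : devCoeff F s k = 0
    · rw [hk0]; simpa using hρc
    · have hne : wt k ≠ c := fun h ↦ (Finset.mem_filter.1 hk).2 ⟨hk0, h⟩
      rw [map_mul, hterm k hk0]
      refine (mul_le_of_le_one_left (by positivity) (hφ k)).trans_lt ?_
      exact Real.rpow_lt_rpow_of_exponent_gt hv0 hv (lt_of_le_of_ne (hcle k hk0) hne.symm)
  have hsplit : ∀ φ : ℕ → K, ∑ k ∈ Finset.range N, φ k * ((devCoeff F s k : K) * z ^ k) =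
      (∑ k ∈ (Finset.range N).filter fun k ↦ ¬ (devCoeff F s k ≠ 0 ∧ wt k = c),
        φ k * ((devCoeff F s k : K) * z ^ k)) + ∑ k ∈ T, φ k * ((devCoeff F s k : K) * z ^ k) :=
    fun φ ↦ by rw [add_comm, hTdef, Finset.sum_filter_add_sum_filter_not]
  -- the terms of minimal value cancel
  have hT1 : v (∑ k ∈ T, (1 : K) * ((devCoeff F s k : K) * z ^ k)) < v p ^ c := by
    have h1 := hsplit fun _ ↦ 1
    simp only [one_mul] at h1
    rw [hsum] at h1
    have h2 := hoff (fun _ ↦ 1) (fun _ ↦ by simp)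
    simp only [one_mul] at h2 ⊢
    rw [← neg_eq_iff_add_eq_zero.2 h1.symm, v.map_neg] at *
    exact h2
  set i := T.min' ⟨k₁, hk₁T⟩ with hi
  set j := T.max' ⟨k₁, hk₁T⟩ with hj
  have hiT : i ∈ T := Finset.min'_mem _ _
  have hjT : j ∈ T := Finset.max'_mem _ _
  have hle : ∀ k ∈ T, i ≤ k ∧ k ≤ j := fun k hk ↦ ⟨Finset.min'_le _ _ hk, Finset.le_max' _ _ hk⟩
  obtain ⟨hi0, hic⟩ := (hmemT i).1 hiT
  obtain ⟨hj0, hjc⟩ := (hmemT j).1 hjT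
  -- A single term of minimal value could not be cancelled by the others.
  have hij : i < j := by
    by_contra hge
    have hT : T = {i} := Finset.eq_singleton_iff_unique_mem.2 ⟨hiT, fun k hk ↦ by
      have := hle k hk
      omega⟩
    rw [hT, Finset.sum_singleton, one_mul, hterm i hi0, hic] at hT1
    exact lt_irrefl _ hT1
  have hij' : (0 : ℝ) < (j : ℝ) - i := by rw [sub_pos]; exact_mod_cast hij
  have hwij : (devVal p F s j : ℝ) - devVal p F s i = - l * ((j : ℝ) - i) := by
    simp only [hwt] at hic hjc
    linarith
  have hside : IsPrincipalSide p F s i j := by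
    refine ⟨⟨hij, hi0, hj0, fun k hk ↦ ⟨?_, fun hout ↦ ?_⟩⟩, ?_⟩
    · have h1 : c ≤ wt k := hcle k hk
      rw [← hic] at h1
      have h2 : - l * ((k : ℝ) - i) ≤ (devVal p F s k : ℝ) - devVal p F s i := by
        simp only [hwt] at h1
        linarith
      have h3 : ((devVal p F s j : ℝ) - devVal p F s i) * ((k : ℝ) - i)
          ≤ ((devVal p F s k : ℝ) - devVal p F s i) * ((j : ℝ) - i) := by
        rw [hwij]
        linarith [mul_le_mul_of_nonneg_right h2 hij'.le]
      exact_mod_cast h3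
    · have hkT : k ∉ T := fun hkT ↦ by
        have := hle k hkT
        omega
      have h1 : c < wt k := lt_of_le_of_ne (hcle k hk) fun h ↦ hkT ((hmemT k).2 ⟨hk, h.symm⟩)
      rw [← hic] at h1
      have h2 : - l * ((k : ℝ) - i) < (devVal p F s k : ℝ) - devVal p F s i := by
        simp only [hwt] at h1
        linarith
      have h3 : ((devVal p F s j : ℝ) - devVal p F s i) * ((k : ℝ) - i)
          < ((devVal p F s k : ℝ) - devVal p F s i) * ((j : ℝ) - i) := by
        rw [hwij]
        linarith [mul_lt_mul_of_pos_right h2 hij']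
      exact_mod_cast h3
    · have : (devVal p F s j : ℝ) < devVal p F s i := by
        have := mul_pos hl hij'
        linarith
      exact_mod_cast this
  obtain ⟨d, hd⟩ : ∃ d, d = sideDegree p F s i j := ⟨_, rfl⟩
  obtain ⟨e, he⟩ : d ∣ j - i := hd ▸ Nat.gcd_dvd_left _ _
  obtain ⟨h', hh⟩ : d ∣ devVal p F s i - devVal p F s j := hd ▸ Nat.gcd_dvd_right _ _
  have hlt' := hside.2
  have hh' : devVal p F s i = devVal p F s j + d * h' := by omega
  have hd0 : 0 < d := Nat.pos_of_ne_zero fun h0 ↦ by rw [h0, zero_mul] at he; omega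
  have he0 : 0 < e := Nat.pos_of_ne_zero fun h0 ↦ by rw [h0, mul_zero] at he; omega
  have hTiff : ∀ k, k ∈ T ↔ i ≤ k ∧ k ≤ j ∧ devCoeff F s k ≠ 0 ∧
      ((devVal p F s j : ℤ) - devVal p F s i) * ((k : ℤ) - i)
        = ((devVal p F s k : ℤ) - devVal p F s i) * ((j : ℤ) - i) := by
    intro k
    have hcast : ((devVal p F s j : ℤ) - devVal p F s i) * ((k : ℤ) - i)
        = ((devVal p F s k : ℤ) - devVal p F s i) * ((j : ℤ) - i) ↔
        ((devVal p F s j : ℝ) - devVal p F s i) * ((k : ℝ) - i)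
        = ((devVal p F s k : ℝ) - devVal p F s i) * ((j : ℝ) - i) := by
      constructor <;> intro h <;> exact_mod_cast h
    rw [hcast, hwij]
    constructor
    · intro hk
      obtain ⟨hk0, hkc⟩ := (hmemT k).1 hk
      refine ⟨(hle k hk).1, (hle k hk).2, hk0, ?_⟩
      rw [← hic] at hkc
      simp only [hwt] at hkc
      have : (devVal p F s k : ℝ) - devVal p F s i = - l * ((k : ℝ) - i) := by linarith
      rw [this]
      ring
    · rintro ⟨-, -, hk0, hk⟩
      refine (hmemT k).2 ⟨hk0, ?_⟩
      have : - l * ((k : ℝ) - i) = (devVal p F s k : ℝ) - devVal p F s i := by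
        refine mul_right_cancel₀ hij'.ne' ?_
        linarith
      rw [← hic]
      simp only [hwt]
      linarith
  have hkey := sum_side_eq (z := z) hp0 hside.1 hd he hh' hTiff
  -- ξ is a unit at the place, and reduces to a root of the residual polynomial.
  set ξ := z ^ e / (p : K) ^ h' with hξdef
  have hξ : v ξ = 1 := by
    have hle' : l * e = h' := by
      have h1 : (j : ℝ) - i = d * e := by
        have := congrArg (Nat.cast (R := ℝ)) he
        rw [Nat.cast_sub hij.le] at this
        exact_mod_cast this
      have h2 : (devVal p F s i : ℝ) = devVal p F s j + d * h' := by exact_mod_cast hh'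
      have h3 : (d : ℝ) ≠ 0 := by positivity
      refine mul_left_cancel₀ h3 ?_
      rw [h1] at hwij
      linarith
    rw [hξdef, map_div₀, map_pow, map_pow, hz, ← Real.rpow_mul_natCast hv0.le, hle',
      Real.rpow_natCast, div_self (by positivity)]
  have hlead : v ((p : K) ^ devVal p F s i * z ^ i) = v p ^ c := by
    rw [← hic, map_mul, map_pow, map_pow, hz, ← Real.rpow_mul_natCast hv0.le,
      ← Real.rpow_natCast, ← Real.rpow_add hv0]
  have hji : (j - i) / d = e := by rw [he, Nat.mul_div_cancel_left _ hd0]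
  have hR : aeval ξ (residualPolyLift p F s i j) = ∑ m ∈ Finset.range (d + 1),
      ((residualLift p F s i j (i + m * e) : K) * ξ ^ m) := by
    rw [residualPolyLift, map_sum, ← hd, hji]
    simp
  have hR' : ξ * aeval ξ (derivative (residualPolyLift p F s i j)) =
      ∑ m ∈ Finset.range (d + 1), (m : K) *
        ((residualLift p F s i j (i + m * e) : K) * ξ ^ m) := by
    rw [residualPolyLift, derivative_sum, map_sum, ← hd, hji, Finset.mul_sum]
    refine Finset.sum_congr rfl fun m _ ↦ ?_
    rcases m with _ | m
    · simp
    · simp [derivative_mul]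
      ring
  have hroot : v (aeval ξ (residualPolyLift p F s i j)) < 1 := by
    have h1 := hkey fun _ ↦ 1
    simp only [one_mul] at h1 hT1
    rw [← hR] at h1
    rw [h1, map_mul, hlead] at hT1
    by_contra hge
    exact absurd hT1 (not_lt.2 (le_mul_of_one_le_right hρc.le (not_lt.1 hge)))
  have hsimple : v (aeval ξ (derivative (residualPolyLift p F s i j))) = 1 :=
    map_aeval_derivative_eq_one hna hv hξ.le
      (by rw [map_residualPolyLift hside.1]; exact hreg i j hside) hroot
  have hmain : v (∑ k ∈ T, (k : K) * ((devCoeff F s k : K) * z ^ k)) = v p ^ c := by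
    -- The weight k = i + me splits the sum into iR(ξ), which is small, and eξR'(ξ), which is a
    -- unit.
    have h1 : ∑ m ∈ Finset.range (d + 1), ((i + m * e : ℕ) : K) *
        ((residualLift p F s i j (i + m * e) : K) * ξ ^ m) =
        i * aeval ξ (residualPolyLift p F s i j) +
        e * (ξ * aeval ξ (derivative (residualPolyLift p F s i j))) := by
      rw [hR, hR', Finset.mul_sum, Finset.mul_sum, ← Finset.sum_add_distrib]
      refine Finset.sum_congr rfl fun m _ ↦ ?_
      push_cast
      ring
    rw [hkey fun k ↦ (k : K), h1, map_mul, hlead]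
    -- Tameness: e ≤ j < N ≤ p.
    have hpe : ¬ (p : ℤ) ∣ (e : ℤ) := by
      intro hdv
      have h2 := Nat.le_of_dvd he0 (Int.natCast_dvd_natCast.1 hdv)
      have h3 := hlt j hj0
      have h4 : e ≤ j - i := he ▸ Nat.le_mul_of_pos_left e hd0
      omega
    have h2 : v (e * (ξ * aeval ξ (derivative (residualPolyLift p F s i j)))) = 1 := by
      have := map_intCast_eq_one hna hp hv hpe
      rw [Int.cast_natCast] at this
      rw [map_mul, map_mul, this, hξ, hsimple]
      norm_num
    rw [map_add_eq_of_lt hna, h2, mul_one]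
    rw [h2, map_mul]
    exact (mul_le_of_le_one_left (v.nonneg _) hna.apply_natCast_le_one).trans_lt hroot
  rw [hsplit fun k ↦ (k : K), map_add_eq_of_lt hna, hmain]
  rw [hmain]
  exact hoff _ fun _ ↦ hna.apply_natCast_le_one

end place

end OreQuartic

/-! ### The quartic at places above p -/

namespace OreQuartic

namespace IsTripleRoot

variable {K : Type*} [Field K] {v : AbsoluteValue K ℝ} {p : ℕ} {a b c s : ℤ}

theorem map_devCoeff_le (h : IsTripleRoot p a b c s) (hna : IsNonarchimedean v) (hv0 : 0 < v p)
    (hv : v p < 1) {z : K} {l x : ℝ} (hz : v z = v p ^ l) {k : ℕ} {i : ℕ}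
    (hx : devCoeff (quartic a b c) s k ≠ 0 → x + l * i ≤ devVal p (quartic a b c) s k + l * k) :
    v ((devCoeff (quartic a b c) s k : K) * z ^ k) ≤ v p ^ (x + l * i) := by
  by_cases hk : devCoeff (quartic a b c) s k = 0
  · rw [hk]
    simpa using Real.rpow_nonneg hv0.le _
  · rw [map_mul, map_pow, map_devCoeff hna h.prime hv hk, hz, ← Real.rpow_mul_natCast hv0.le,
      ← Real.rpow_add hv0]
    exact Real.rpow_le_rpow_of_exponent_ge hv0 hv.le (hx hk)

theorem map_devCoeff_lt_one (h : IsTripleRoot p a b c s) (hna : IsNonarchimedean v)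
    (hv : v p < 1) {k : ℕ} (hk : k < 3) : v (devCoeff (quartic a b c) s k : K) < 1 := by
  have hd : (p : ℤ) ∣ devCoeff (quartic a b c) s k := by
    interval_cases k
    exacts [h.dvd_zero, h.dvd_one, h.dvd_two]
  obtain ⟨q, hq⟩ := hd
  rw [hq, Int.cast_mul, map_mul, Int.cast_natCast]
  exact (mul_le_of_le_one_right (v.nonneg _) hna.apply_intCast_le_one).trans_lt hv

/-- The value of the derivative at a root, at a place above `p`. -/
theorem exists_map_derivative_eq (h : IsTripleRoot p a b c s)
    (hreg : IsRegular p (quartic a b c) s) (hna : IsNonarchimedean v) (hv0 : 0 < v p)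
    (hv : v p < 1) {z : K} (hz0 : z ≠ 0) (hz1 : v z ≤ 1)
    (hsum : ∑ k ∈ Finset.range 5, (devCoeff (quartic a b c) s k : K) * z ^ k = 0) :
    ∃ l : ℝ, 0 ≤ l ∧ v z = v p ^ l ∧ ∃ c' : ℝ, (∀ k, devCoeff (quartic a b c) s k ≠ 0 →
      c' ≤ devVal p (quartic a b c) s k + l * k) ∧
      v (∑ k ∈ Finset.range 5, (k : K) * ((devCoeff (quartic a b c) s k : K) * z ^ k))
        = v p ^ c' := by
  have hvz : 0 < v z := v.pos hz0
  rcases hz1.lt_or_eq with hlt | heq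
  · have hl : v z = v p ^ (Real.logb (v p) (v z)) := (Real.rpow_logb hv0 hv.ne hvz).symm
    have hl0 : 0 < Real.logb (v p) (v z) := Real.logb_pos_of_base_lt_one hv0 hv hvz hlt
    refine ⟨_, hl0.le, hl, exists_map_sum_natCast_mul_eq hna h.prime hv0 hv (fun k hk ↦ ?_) ?_
      ⟨3, h.devCoeff_three_ne⟩ hreg hl0 hl hsum⟩
    · by_contra hne
      exact absurd (le_four hne) (by omega)
    · rcases lt_or_eq_of_le (Nat.succ_le_of_lt h.three_lt) with h5 | h4
      · omega
      · have hp := h.prime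
        rw [← h4] at hp
        exact absurd hp (by norm_num)
  · refine ⟨0, le_rfl, by rw [heq, Real.rpow_zero], 0, fun k _ ↦ by simp, ?_⟩
    rw [Real.rpow_zero]
    -- The unit root, outside the principal polygon: subtracting 4f(z) = 0 removes z⁴ and leaves
    -- -4sz³ as the only unit term.
    have e : ∑ k ∈ Finset.range 5, (k : K) * ((devCoeff (quartic a b c) s k : K) * z ^ k) =
        (-4 * (devCoeff (quartic a b c) s 0 : K) - 3 * (devCoeff (quartic a b c) s 1 : K) * z
          - 2 * (devCoeff (quartic a b c) s 2 : K) * z ^ 2) + (-((4 * s : ℤ) : K)) * z ^ 3 := by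
      simp only [Finset.sum_range_succ, Finset.sum_range_zero, devCoeff_three, devCoeff_four]
        at hsum ⊢
      push_cast at hsum ⊢
      linear_combination 4 * hsum
    have h3 : v ((-((4 * s : ℤ) : K)) * z ^ 3) = 1 := by
      rw [map_mul, v.map_neg, map_intCast_eq_one hna h.prime hv h.not_dvd_four_mul, map_pow, heq]
      norm_num
    have hsmall : ∀ n : ℤ, ∀ k < 3,
        v ((n : K) * (devCoeff (quartic a b c) s k : K) * z ^ k) < 1 := by
      intro n k hk
      rw [map_mul, map_mul, map_pow, heq, one_pow, mul_one]
      exact (mul_le_of_le_one_left (v.nonneg _) hna.apply_intCast_le_one).trans_lt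
        (h.map_devCoeff_lt_one hna hv hk)
    rw [e, map_add_eq_of_lt hna, h3]
    rw [h3]
    have e' : (-4 * (devCoeff (quartic a b c) s 0 : K) - 3 * (devCoeff (quartic a b c) s 1 : K) * z
          - 2 * (devCoeff (quartic a b c) s 2 : K) * z ^ 2) =
        (((-4 : ℤ) : K) * (devCoeff (quartic a b c) s 0 : K) * z ^ 0 +
          ((-3 : ℤ) : K) * (devCoeff (quartic a b c) s 1 : K) * z ^ 1) +
          ((-2 : ℤ) : K) * (devCoeff (quartic a b c) s 2 : K) * z ^ 2 := by
      push_cast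
      ring
    rw [e']
    exact (hna _ _).trans_lt (max_lt ((hna _ _).trans_lt (max_lt (hsmall _ 0 (by norm_num))
      (hsmall _ 1 (by norm_num)))) (hsmall _ 2 (by norm_num)))

/-- The partial sums of the development, divided by the power of `z`, are bounded by the Newton
polygon. -/
theorem map_quotient_le (h : IsTripleRoot p a b c s) (hna : IsNonarchimedean v) (hv0 : 0 < v p)
    (hv : v p < 1) {z g : K} {l : ℝ} (hl : v z = v p ^ l) {α β : ℝ}
    (hline : ∀ k, devCoeff (quartic a b c) s k ≠ 0 → α + β * k ≤ devVal p (quartic a b c) s k)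
    {i : ℕ} (hg : z ^ i * g =
      ∑ k ∈ (Finset.range 5).filter (i ≤ ·), (devCoeff (quartic a b c) s k : K) * z ^ k)
    (hg' : z ^ i * g =
      -∑ k ∈ (Finset.range 5).filter (· < i), (devCoeff (quartic a b c) s k : K) * z ^ k) :
    v g ≤ v p ^ (α + β * i) := by
  have hzi : v (z ^ i) = v p ^ (l * i) := by
    rw [map_pow, hl, ← Real.rpow_mul_natCast hv0.le]
  have key : v (z ^ i * g) ≤ v p ^ ((α + β * i) + l * i) := by
    -- Along the line the values α + βk + lk are monotone in k. If they increase, the part k ≥ i is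
    -- bounded by its first term; if they decrease, the complementary part k < i is used.
    rcases le_total 0 (β + l) with hs | hs
    · rw [hg]
      refine map_sum_le hna (Real.rpow_nonneg hv0.le _) fun k hk ↦
        h.map_devCoeff_le hna hv0 hv hl fun hk0 ↦ ?_
      have hik : (i : ℝ) ≤ k := by exact_mod_cast (Finset.mem_filter.1 hk).2
      nlinarith [hline k hk0, mul_nonneg hs (sub_nonneg.2 hik)]
    · rw [hg', v.map_neg]
      refine map_sum_le hna (Real.rpow_nonneg hv0.le _) fun k hk ↦
        h.map_devCoeff_le hna hv0 hv hl fun hk0 ↦ ?_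
      have hik : (k : ℝ) ≤ i := by exact_mod_cast (Finset.mem_filter.1 hk).2.le
      nlinarith [hline k hk0, mul_nonneg (neg_nonneg.2 hs) (sub_nonneg.2 hik)]
  rw [map_mul, hzi, Real.rpow_add hv0, mul_comm] at key
  exact le_of_mul_le_mul_right key (Real.rpow_pos_of_pos hv0 _)

end IsTripleRoot

end OreQuartic

/-! ### Integrality and traces through places -/

namespace OreQuartic

section global

open NumberField IsDedekindDomain IsDedekindDomain.HeightOneSpectrum

variable {K : Type*} [Field K] [NumberField K]

theorem isIntegral_of_adicAbv_le_one {x : K}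
    (h : ∀ P : HeightOneSpectrum (𝓞 K), NumberField.HeightOneSpectrum.adicAbv K P x ≤ 1) :
    IsIntegral ℤ x := by
  have h1 : ∀ P : HeightOneSpectrum (𝓞 K), P.valuation K x ≤ 1 := by
    intro P
    have := h P
    rw [NumberField.HeightOneSpectrum.adicAbv_def] at this
    have h2 : WithZeroMulInt.toNNReal (NumberField.HeightOneSpectrum.absNorm_ne_zero P)
      (P.valuation K x) ≤ 1 := by exact_mod_cast this
    exact (WithZeroMulInt.toNNReal_le_one_iff
      (NumberField.HeightOneSpectrum.one_lt_absNorm_nnreal P)).1 h2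
  obtain ⟨y, rfl⟩ := mem_integers_of_valuation_le_one K x h1
  exact y.isIntegral_coe

theorem adicAbv_le_one_of_isIntegral (P : HeightOneSpectrum (𝓞 K)) {x : K} (h : IsIntegral ℤ x) :
    NumberField.HeightOneSpectrum.adicAbv K P x ≤ 1 :=
  P.adicAbv_coe_le_one (K := K) (NumberField.HeightOneSpectrum.one_lt_absNorm_nnreal P) ⟨x, h⟩

/-- The trace of an element of a free algebra which is nilpotent modulo a prime is divisible by
this prime. -/
theorem dvd_trace_of_pow_eq {p : ℕ} (hp : p.Prime) {x y : 𝓞 K} {n : ℕ} (h : x ^ n = p * y) :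
    (p : ℤ) ∣ Algebra.trace ℤ (𝓞 K) x := by
  classical
  have := Fact.mk hp
  let b := RingOfIntegers.basis K
  rw [Algebra.trace_eq_matrix_trace b]
  set M := Algebra.leftMulMatrix b x with hM
  have h1 : M ^ n = (p : ℤ) • Algebra.leftMulMatrix b y := by
    rw [hM, ← map_pow, h, ← map_smul]
    congr 1
    simp
  have h2 : IsNilpotent (M.map (Int.castRingHom (ZMod p))) := by
    refine ⟨n, ?_⟩
    rw [← RingHom.mapMatrix_apply, ← map_pow, h1]
    ext i j
    rw [RingHom.mapMatrix_apply, Matrix.map_apply, Matrix.smul_apply, smul_eq_mul, map_mul]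
    simp
  have h3 := (Matrix.isNilpotent_trace_of_isNilpotent h2).eq_zero
  rw [← ZMod.intCast_zmod_eq_zero_iff_dvd, ← h3]
  simp [Matrix.trace]

/-- After multiplication by a suitable m, pmz is an algebraic integer lying in every prime above p.
It is thus nilpotent modulo p, as are its integral multiples, so their traces are divisible by p,
and p cancels. -/
theorem exists_dvd_trace {p : ℕ} (hp : p.Prime) {z : K}
    (hz : ∀ P : HeightOneSpectrum (𝓞 K), NumberField.HeightOneSpectrum.adicAbv K P (p : K) < 1 →
      NumberField.HeightOneSpectrum.adicAbv K P ((p : K) * z) < 1) :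
    ∃ m : ℤ, ¬ (p : ℤ) ∣ m ∧ ∀ x : K, IsIntegral ℤ x →
      ∃ n : ℤ, (m : ℚ) * Algebra.trace ℚ K (x * z) = n := by
  have hp0 : (p : K) ≠ 0 := by exact_mod_cast hp.ne_zero
  obtain ⟨N, hN0, hN⟩ := ((IsFractionRing.isAlgebraic_iff ℤ ℚ K).2
    (Algebra.IsAlgebraic.isAlgebraic (R := ℚ) z)).exists_integral_multiple
  have hNm := pow_mul_div_pow p N
  have hm := not_dvd_div_pow hp hN0
  -- The part of a denominator of z prime to p: it restores integrality at the places not above p.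
  set m := N / (p : ℤ) ^ padicValInt p N with hmdef
  refine ⟨m, hm, ?_⟩
  have hint : IsIntegral ℤ ((p : K) * (m * z)) := by
    refine isIntegral_of_adicAbv_le_one fun P ↦ ?_
    rcases (NumberField.HeightOneSpectrum.adicAbv_natCast_le_one K P p).lt_or_eq with hlt | heq
    · rw [mul_left_comm, map_mul]
      exact mul_le_one₀ (NumberField.HeightOneSpectrum.adicAbv_intCast_le_one K P m)
        (by positivity) (hz P hlt).le
    · have h1 := adicAbv_le_one_of_isIntegral P hN
      rw [zsmul_eq_mul, ← hNm] at h1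
      push_cast at h1
      rw [mul_assoc, map_mul, map_pow, heq, one_pow, one_mul] at h1
      rwa [map_mul, heq, one_mul]
  obtain ⟨y, hy⟩ : ∃ y : 𝓞 K, (y : K) = p * (m * z) := ⟨⟨_, hint⟩, rfl⟩
  have hrad : y ∈ (Ideal.span {(p : 𝓞 K)}).radical := by
    rw [Ideal.radical_eq_sInf, Ideal.mem_sInf]
    rintro J ⟨hJ, hJp⟩
    have hpJ : (p : 𝓞 K) ∈ J := hJ (Ideal.mem_span_singleton_self _)
    have hpne : (p : 𝓞 K) ≠ 0 := by exact_mod_cast hp.ne_zero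
    let P : HeightOneSpectrum (𝓞 K) := ⟨J, hJp, fun h ↦ hpne (by rw [h] at hpJ; exact hpJ)⟩
    have h1 : NumberField.HeightOneSpectrum.adicAbv K P (p : K) < 1 := by
      have := (P.adicAbv_coe_lt_one_iff (K := K)
        (NumberField.HeightOneSpectrum.one_lt_absNorm_nnreal P) (p : 𝓞 K)).2 hpJ
      rwa [map_natCast] at this
    have h2 : NumberField.HeightOneSpectrum.adicAbv K P (algebraMap (𝓞 K) K y) < 1 := by
      change NumberField.HeightOneSpectrum.adicAbv K P (y : K) < 1
      rw [hy, mul_left_comm, map_mul]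
      exact (mul_le_of_le_one_left (by positivity)
        (NumberField.HeightOneSpectrum.adicAbv_intCast_le_one K P m)).trans_lt (hz P h1)
    exact (P.adicAbv_coe_lt_one_iff (K := K)
      (NumberField.HeightOneSpectrum.one_lt_absNorm_nnreal P) y).1 h2
  obtain ⟨n, hn⟩ := hrad
  obtain ⟨w, hw⟩ := Ideal.mem_span_singleton'.1 hn
  intro x hx
  obtain ⟨x, rfl⟩ : ∃ x' : 𝓞 K, (x' : K) = x := ⟨⟨x, hx⟩, rfl⟩
  obtain ⟨q, hq⟩ := dvd_trace_of_pow_eq hp (x := x * y) (y := x ^ n * w) (n := n)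
    (by rw [mul_pow, ← hw]; ring)
  refine ⟨q, ?_⟩
  have h1 : ((Algebra.trace ℤ (𝓞 K) (x * y) : ℤ) : ℚ) = Algebra.trace ℚ K ((x * y : 𝓞 K) : K) :=
    Algebra.coe_trace_int _
  have h2 : ((x * y : 𝓞 K) : K) = ((p * m : ℚ)) • ((x : K) * z) := by
    have h3 : ((x * y : 𝓞 K) : K) = (x : K) * (y : K) := map_mul (algebraMap (𝓞 K) K) x y
    rw [Algebra.smul_def, h3, hy, map_mul, map_natCast, map_intCast]
    ring
  rw [h2, map_smul, hq, smul_eq_mul] at h1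
  push_cast at h1
  have hpQ : (p : ℚ) ≠ 0 := by exact_mod_cast hp.ne_zero
  refine mul_left_cancel₀ hpQ ?_
  linarith

end global

end OreQuartic

/-! ### Euler's dual basis -/

namespace OreQuartic

section dual

variable {K : Type*} [Field K] [NumberField K] {a b c s : ℤ} {θ : K}

theorem minpoly_eq_quartic (hirr : Irreducible (quartic a b c))
    (hroot : aeval θ (quartic a b c) = 0) :
    minpoly ℚ θ = (quartic a b c).map (algebraMap ℤ ℚ) := by
  have hm := quartic_monic a b c
  refine (minpoly.eq_of_irreducible_of_monic
    ((hm.irreducible_iff_irreducible_map_fraction_map).1 hirr) ?_ (hm.map _)).symm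
  rw [aeval_map_algebraMap, hroot]

theorem minpoly_sub_eq (hirr : Irreducible (quartic a b c))
    (hroot : aeval θ (quartic a b c) = 0) (s : ℤ) :
    minpoly ℚ (θ - s) = (taylor s (quartic a b c)).map (algebraMap ℤ ℚ) := by
  have h := minpoly.sub_algebraMap (A := ℚ) θ (s : ℚ)
  rw [map_intCast] at h
  rw [h, minpoly_eq_quartic hirr hroot, taylor_apply, map_comp]
  simp

theorem adjoin_sub_eq_top (hgen : IntermediateField.adjoin ℚ {θ} = ⊤) (s : ℤ) :
    Algebra.adjoin ℚ {θ - s} = ⊤ := by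
  have hθ : IsIntegral ℚ θ := Algebra.IsIntegral.isIntegral θ
  have h1 : Algebra.adjoin ℚ {θ} = ⊤ := by
    rw [← IntermediateField.adjoin_simple_toSubalgebra_of_isAlgebraic hθ.isAlgebraic, hgen,
      IntermediateField.top_toSubalgebra]
  rw [eq_top_iff, ← h1, Algebra.adjoin_le_iff, Set.singleton_subset_iff]
  have h2 := Algebra.self_mem_adjoin_singleton ℚ (θ - s)
  have h3 := add_mem h2 (intCast_mem (Algebra.adjoin ℚ {θ - (s : K)}) s)
  rwa [sub_add_cancel] at h3

theorem aeval_derivative_ne_zero (hirr : Irreducible (quartic a b c))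
    (hroot : aeval θ (quartic a b c) = 0) (s : ℤ) :
    aeval (θ - s) (derivative (taylor s (quartic a b c))) ≠ 0 := by
  have h := (Algebra.IsSeparable.isSeparable ℚ (θ - s)).aeval_derivative_ne_zero
    (minpoly.aeval ℚ (θ - s))
  rwa [minpoly_sub_eq hirr hroot, derivative_map, aeval_map_algebraMap] at h

/-- The expansion of an element in the coefficients of `f / (X - θ)`, by Euler's formula for the
dual basis. -/
theorem eq_sum_trace (hirr : Irreducible (quartic a b c))
    (hroot : aeval θ (quartic a b c) = 0) (hgen : IntermediateField.adjoin ℚ {θ} = ⊤) {z D : K}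
    (hz : z = θ - s) (hD : D = aeval z (derivative (taylor s (quartic a b c)))) (x : K) :
    x = Algebra.trace ℚ K (x * (1 / D)) • (devCoeff (quartic a b c) s 1
        + devCoeff (quartic a b c) s 2 * z + devCoeff (quartic a b c) s 3 * z ^ 2 + z ^ 3)
      + Algebra.trace ℚ K (x * (z / D)) • (devCoeff (quartic a b c) s 2
        + devCoeff (quartic a b c) s 3 * z + z ^ 2)
      + Algebra.trace ℚ K (x * (z ^ 2 / D)) • (devCoeff (quartic a b c) s 3 + z)
      + Algebra.trace ℚ K (x * (z ^ 3 / D)) • (1 : K) := by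
  have hD0 : D ≠ 0 := by rw [hD, hz]; exact aeval_derivative_ne_zero hirr hroot s
  have hmin := minpoly_sub_eq hirr hroot s
  rw [← hz] at hmin
  have hint : IsIntegral ℚ z := Algebra.IsIntegral.isIntegral z
  let pb := PowerBasis.ofAdjoinEqTop hint (by rw [hz]; exact adjoin_sub_eq_top hgen s)
  have hgenz : pb.gen = z := PowerBasis.ofAdjoinEqTop_gen _ _
  have hnat : (minpoly ℚ z).natDegree = 4 := by
    rw [hmin, natDegree_map_eq_of_injective (algebraMap ℤ ℚ).injective_int, natDegree_taylor,
      quartic_natDegree]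
  have hdim : pb.dim = 4 := by
    rw [← hnat]; exact PowerBasis.ofAdjoinEqTop_dim _ _
  have hsum := pb.basis.traceDual.sum_repr (x / D)
  have hcoeff : ∀ i, (minpoly ℚ z).coeff i = (devCoeff (quartic a b c) s i : ℚ) := fun i ↦ by
    rw [hmin, coeff_map]; rfl
  have q4 : (minpolyDiv ℚ z).coeff 4 = 0 := coeff_eq_zero_of_natDegree_lt (by
    rw [natDegree_minpolyDiv, hnat]; norm_num)
  have q3 : (minpolyDiv ℚ z).coeff 3 = 1 := by
    rw [coeff_minpolyDiv, q4, hcoeff, IsTripleRoot.devCoeff_four]; simp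
  have q2 : (minpolyDiv ℚ z).coeff 2 = devCoeff (quartic a b c) s 3 + z := by
    rw [coeff_minpolyDiv, q3, hcoeff]; simp
  have q1 : (minpolyDiv ℚ z).coeff 1 = devCoeff (quartic a b c) s 2
      + devCoeff (quartic a b c) s 3 * z + z ^ 2 := by
    rw [coeff_minpolyDiv, q2, hcoeff]; simp; ring
  have q0 : (minpolyDiv ℚ z).coeff 0 = devCoeff (quartic a b c) s 1
      + devCoeff (quartic a b c) s 2 * z + devCoeff (quartic a b c) s 3 * z ^ 2 + z ^ 3 := by
    rw [coeff_minpolyDiv, q1, hcoeff]; simp; ring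
  have hterm : ∀ i : Fin pb.dim, pb.basis.traceDual.repr (x / D) i • pb.basis.traceDual i =
      Algebra.trace ℚ K (x * (z ^ (i : ℕ) / D)) • ((minpolyDiv ℚ z).coeff i / D) := by
    intro i
    rw [Module.Basis.traceDual_repr_apply, Module.Basis.traceDual_powerBasis_eq, hgenz,
      Algebra.traceForm_apply, PowerBasis.basis_eq_pow, hgenz, hmin, derivative_map,
      aeval_map_algebraMap, ← hD]
    congr 2
    ring
  rw [Finset.sum_congr rfl fun i _ ↦ hterm i, Fin.sum_univ_eq_sum_range (fun i ↦
    Algebra.trace ℚ K (x * (z ^ i / D)) • ((minpolyDiv ℚ z).coeff i / D)), hdim] at hsum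
  simp only [Finset.sum_range_succ, Finset.sum_range_zero, zero_add, q0, q1, q2, q3, pow_zero,
    pow_one] at hsum
  have hx : x = D * (x / D) := by field_simp
  conv_lhs => rw [hx, ← hsum]
  simp only [mul_add, mul_smul_comm]
  field_simp

end dual

end OreQuartic

/-! ### Independence and local integrality criterion -/

namespace OreQuartic

section basis

open NumberField IsDedekindDomain

variable {p : ℕ} {a b c s : ℤ} {K : Type*} [Field K] [NumberField K] {θ : K}

/-- A relation is a rational polynomial of degree at most 3 vanishing at θ, hence zero; the family
is triangular in the powers of θ. -/
theorem linearIndependent_tripleBasis (hp : p.Prime) (hirr : Irreducible (quartic a b c))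
    (hroot : aeval θ (quartic a b c) = 0) (ν₁ ν₂ : ℤ) :
    LinearIndependent ℤ (tripleBasis p θ a b s ν₁ ν₂) := by
  rw [Fintype.linearIndependent_iff]
  intro n hn
  have hp0 : (p : ℚ) ≠ 0 := by exact_mod_cast hp.ne_zero
  obtain ⟨P₁, hP₁⟩ : ∃ P₁ : ℚ, P₁ = (p : ℚ) ^ ν₁ := ⟨_, rfl⟩
  obtain ⟨P₂, hP₂⟩ : ∃ P₂ : ℚ, P₂ = (p : ℚ) ^ ν₂ := ⟨_, rfl⟩
  have hP₁0 : P₁ ≠ 0 := by rw [hP₁]; exact zpow_ne_zero _ hp0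
  have hP₂0 : P₂ ≠ 0 := by rw [hP₂]; exact zpow_ne_zero _ hp0
  have e₁ : (p : K) ^ ν₁ = algebraMap ℚ K P₁ := by rw [hP₁]; simp
  have e₂ : (p : K) ^ ν₂ = algebraMap ℚ K P₂ := by rw [hP₂]; simp
  rw [Fin.sum_univ_four] at hn
  simp only [tripleBasis, Matrix.cons_val_zero, Matrix.cons_val_one, Matrix.cons_val, e₁, e₂,
    zsmul_eq_mul] at hn
  set r₃ : ℚ := n 3 / P₁ with hr₃
  set r₂ : ℚ := n 2 / P₂ + r₃ * s with hr₂
  set r₁ : ℚ := n 1 + n 2 / P₂ * (2 * s) + r₃ * (s ^ 2 + a) with hr₁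
  set r₀ : ℚ := n 0 + n 2 / P₂ * (3 * s ^ 2 + a) + r₃ * (s ^ 3 + a * s + b) with hr₀
  set Q : ℚ[X] := C r₀ + C r₁ * X + C r₂ * X ^ 2 + C r₃ * X ^ 3 with hQ
  have hQθ : aeval θ Q = 0 := by
    rw [← hn]
    simp only [hQ, hr₀, hr₁, hr₂, hr₃, map_add, map_mul, map_pow, map_div₀, aeval_C, aeval_X,
      map_intCast, map_ofNat]
    ring
  have hdeg : Q.natDegree < (minpoly ℚ θ).natDegree := by
    rw [minpoly_eq_quartic hirr hroot, natDegree_map_eq_of_injective (algebraMap ℤ ℚ).injective_int,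
      quartic_natDegree]
    refine Nat.lt_succ_of_le ?_
    rw [hQ]
    compute_degree
  have hQ0 : Q = 0 := by
    by_contra hne
    exact absurd hdeg (not_lt.2 (natDegree_le_natDegree (minpoly.degree_le_of_ne_zero ℚ θ hne hQθ)))
  have hco : ∀ i, Q.coeff i = 0 := fun i ↦ by rw [hQ0, coeff_zero]
  have c₀ := hco 0
  have c₁ := hco 1
  have c₂ := hco 2
  have c₃ := hco 3
  simp only [hQ, coeff_add, coeff_C_mul, coeff_X_pow, coeff_X, coeff_C] at c₀ c₁ c₂ c₃
  norm_num at c₀ c₁ c₂ c₃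
  have n₃ : (n 3 : ℚ) = 0 := by
    rw [hr₃] at c₃
    exact (div_eq_zero_iff.1 c₃).resolve_right hP₁0
  have n₂ : (n 2 : ℚ) = 0 := by
    rw [hr₂, c₃, zero_mul, add_zero] at c₂
    exact (div_eq_zero_iff.1 c₂).resolve_right hP₂0
  have n₁ : (n 1 : ℚ) = 0 := by
    rw [hr₁, c₃, n₂] at c₁
    simpa using c₁
  have n₀ : (n 0 : ℚ) = 0 := by
    rw [hr₀, c₃, n₂] at c₀
    simpa using c₀
  intro i
  fin_cases i
  exacts [Int.cast_eq_zero.1 n₀, Int.cast_eq_zero.1 n₁, Int.cast_eq_zero.1 n₂,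
    Int.cast_eq_zero.1 n₃]

theorem adicAbv_pos (P : HeightOneSpectrum (𝓞 K)) (hp : p.Prime) :
    0 < NumberField.HeightOneSpectrum.adicAbv K P (p : K) :=
  (NumberField.HeightOneSpectrum.adicAbv K P).pos (by exact_mod_cast hp.ne_zero)

/-- Integrality outside `p` and a bound at the places above `p`. -/
theorem isIntegral_div_zpow (hp : p.Prime) {g : K} (hg : IsIntegral ℤ g) {x : ℝ} {ν : ℤ}
    (hν : ν ≤ x) (h : ∀ P : HeightOneSpectrum (𝓞 K),
      NumberField.HeightOneSpectrum.adicAbv K P (p : K) < 1 →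
      NumberField.HeightOneSpectrum.adicAbv K P g ≤
        NumberField.HeightOneSpectrum.adicAbv K P (p : K) ^ x) :
    IsIntegral ℤ (g / (p : K) ^ ν) := by
  refine isIntegral_of_adicAbv_le_one fun P ↦ ?_
  have hv0 := adicAbv_pos (K := K) P hp
  rw [map_div₀, map_zpow₀]
  rcases (NumberField.HeightOneSpectrum.adicAbv_natCast_le_one K P p).lt_or_eq with hlt | heq
  · rw [div_le_one (zpow_pos hv0 _), ← Real.rpow_intCast]
    exact (h P hlt).trans (Real.rpow_le_rpow_of_exponent_ge hv0 hlt.le hν)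
  · rw [heq, one_zpow, div_one]
    exact adicAbv_le_one_of_isIntegral P hg

end basis

end OreQuartic

/-! ### The p-integral basis attached to a regular integer -/

namespace OreQuartic

section basis

open NumberField IsDedekindDomain

variable {p : ℕ} {a b c s : ℤ} {K : Type*} [Field K] {θ : K}

theorem taylor_quartic_eq_devCoeff (a b c s : ℤ) : taylor s (quartic a b c) =
    X ^ 4 + C (devCoeff (quartic a b c) s 3) * X ^ 3 + C (devCoeff (quartic a b c) s 2) * X ^ 2 +
      C (devCoeff (quartic a b c) s 1) * X + C (devCoeff (quartic a b c) s 0) := by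
  obtain ⟨e₀, e₁, e₂, e₃, -, -⟩ := devCoeff_quartic a b c s
  rw [taylor_quartic, e₀, e₁, e₂, e₃]

theorem sum_devCoeff_eq_zero (hroot : aeval θ (quartic a b c) = 0) (s : ℤ) :
    ∑ k ∈ Finset.range 5, (devCoeff (quartic a b c) s k : K) * (θ - s) ^ k = 0 := by
  have h : aeval (θ - s) (taylor s (quartic a b c)) = 0 := by
    rw [taylor_apply, aeval_comp]
    simpa using hroot
  rw [taylor_quartic_eq_devCoeff] at h
  rw [← h]
  simp only [Finset.sum_range_succ, Finset.sum_range_zero, IsTripleRoot.devCoeff_four, map_add,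
    map_mul, map_pow, aeval_C, aeval_X]
  simp only [algebraMap_int_eq, eq_intCast, Int.cast_one]
  ring

theorem mul_aeval_derivative (z : K) : z * aeval z (derivative (taylor s (quartic a b c))) =
    ∑ k ∈ Finset.range 5, (k : K) * ((devCoeff (quartic a b c) s k : K) * z ^ k) := by
  rw [taylor_quartic_eq_devCoeff]
  simp only [Finset.sum_range_succ, Finset.sum_range_zero, IsTripleRoot.devCoeff_four,
    derivative_C, derivative_C_mul, derivative_X, derivative_X_pow, map_add,
    map_mul, map_pow, aeval_C, aeval_X, map_one, map_zero, map_natCast]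
  simp only [algebraMap_int_eq, eq_intCast, Int.cast_one]
  push_cast
  ring

variable [NumberField K]

/-- Ensures that the infimum defining the polygon is over a nonempty set, so that lower bounds pass
to it. -/
theorem exists_mem_convexHull (h : IsTripleRoot p a b c s) {x : ℝ} (hx0 : 0 ≤ x) (hx4 : x ≤ 4) :
    ∃ y, (x, y) ∈ convexHull ℝ (newtonPoints p (quartic a b c) s) := by
  refine ⟨_, mem_convexHull_of_le_of_le (α := devVal p (quartic a b c) s 0)
    (β := ((devVal p (quartic a b c) s 4 : ℝ) - devVal p (quartic a b c) s 0) / 4) (i := 0) (j := 4)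
    h.devCoeff_zero_ne ?_ (by simp) (by push_cast; ring) (by exact_mod_cast hx0)
    (by exact_mod_cast hx4)⟩
  rw [IsTripleRoot.devCoeff_four]
  exact one_ne_zero

/-- The elements of the dual family lie in the codifferent at `p`. -/
theorem exists_dvd_trace_dual (h : IsTripleRoot p a b c s)
    (hreg : IsRegular p (quartic a b c) s) (hroot : aeval θ (quartic a b c) = 0) {i : ℕ} {ν : ℤ}
    {x : ℝ} (hx : ∀ c' l : ℝ, (∀ k, devCoeff (quartic a b c) s k ≠ 0 →
      c' ≤ devVal p (quartic a b c) s k + l * k) → c' ≤ x + l * (i + 1 : ℕ)) (hν : x < ν + 1) :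
    ∃ m : ℤ, ¬ (p : ℤ) ∣ m ∧ ∀ y : K, IsIntegral ℤ y →
      ∃ n : ℤ, (m : ℚ) * ((p : ℚ) ^ ν * Algebra.trace ℚ K (y * ((θ - s) ^ i /
        aeval (θ - s) (derivative (taylor s (quartic a b c)))))) = n := by
  have hD0 := aeval_derivative_ne_zero h.irr hroot s
  have hzD := mul_aeval_derivative (a := a) (b := b) (c := c) (s := s) (θ - s)
  have hsum := sum_devCoeff_eq_zero hroot s
  have hzint : IsIntegral ℤ (θ - s) :=
    IsIntegral.sub ⟨_, quartic_monic a b c, hroot⟩ (isIntegral_algebraMap (x := s))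
  have hz0 : θ - (s : K) ≠ 0 := by
    intro h0
    rw [h0] at hsum
    simp [Finset.sum_range_succ] at hsum
    exact h.devCoeff_zero_ne hsum
  set z := θ - (s : K) with hz
  set D := aeval z (derivative (taylor s (quartic a b c))) with hD
  obtain ⟨m, hm, htr⟩ := exists_dvd_trace h.prime (z := (p : K) ^ ν * (z ^ i / D)) (by
    intro P hv
    have hv0 := adicAbv_pos (K := K) P h.prime
    have hna := NumberField.HeightOneSpectrum.isNonarchimedean_adicAbv K P
    obtain ⟨l, hl0, hl, c', hc', hval⟩ := h.exists_map_derivative_eq hreg hna hv0 hv hz0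
      (adicAbv_le_one_of_isIntegral P hzint) hsum
    have hb := hx c' l hc'
    set v := NumberField.HeightOneSpectrum.adicAbv K P with hvdef
    -- The known value is that of zD, so one extra power of z is needed: this is why zⁱ/D is
    -- governed by the abscissa i + 1.
    have e : (p : K) * ((p : K) ^ ν * (z ^ i / D)) =
        ((p : K) * (p : K) ^ ν * z ^ (i + 1)) / (z * D) := by
      field_simp
      ring
    rw [e, hzD, map_div₀, hval, div_lt_one (Real.rpow_pos_of_pos hv0 _), map_mul, map_mul,
      map_zpow₀, map_pow, hl, ← Real.rpow_mul_natCast hv0.le, ← Real.rpow_intCast]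
    nth_rw 1 [← Real.rpow_one (v p)]
    rw [← Real.rpow_add hv0, ← Real.rpow_add hv0]
    exact Real.rpow_lt_rpow_of_exponent_gt hv0 hv (by linarith))
  refine ⟨m, hm, fun y hy ↦ ?_⟩
  obtain ⟨n, hn⟩ := htr y hy
  refine ⟨n, ?_⟩
  rw [← hn]
  congr 1
  have e : y * ((p : K) ^ ν * (z ^ i / D)) = ((p : ℚ) ^ ν) • (y * (z ^ i / D)) := by
    rw [Algebra.smul_def]
    simp
    ring
  rw [e, map_smul, smul_eq_mul]

/-- **Ore's theorem** for the triple root: a regular integer yields a `p`-integral basis. -/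
theorem isPIntegralBasis_tripleBasis (h : IsTripleRoot p a b c s)
    (hreg : IsRegular p (quartic a b c) s) (hroot : aeval θ (quartic a b c) = 0)
    (hgen : IntermediateField.adjoin ℚ {θ} = ⊤) {α β : ℝ}
    (hline : ∀ k, devCoeff (quartic a b c) s k ≠ 0 → α + β * k ≤ devVal p (quartic a b c) s k)
    (h₁ : newtonPolygon p (quartic a b c) s 1 = α + β * 1)
    (h₂ : newtonPolygon p (quartic a b c) s 2 = α + β * 2) :
    IsPIntegralBasis p (tripleBasis p θ a b s ⌊newtonPolygon p (quartic a b c) s 1⌋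
      ⌊newtonPolygon p (quartic a b c) s 2⌋) := by
  obtain ⟨ν₁, hν₁⟩ : ∃ ν₁, ν₁ = ⌊newtonPolygon p (quartic a b c) s 1⌋ := ⟨_, rfl⟩
  obtain ⟨ν₂, hν₂⟩ : ∃ ν₂, ν₂ = ⌊newtonPolygon p (quartic a b c) s 2⌋ := ⟨_, rfl⟩
  rw [← hν₁, ← hν₂]
  have hθ : IsIntegral ℤ θ := ⟨_, quartic_monic a b c, hroot⟩
  have hsint : ∀ n : ℤ, IsIntegral ℤ (n : K) := fun n ↦ isIntegral_algebraMap (x := n)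
  have hsum := sum_devCoeff_eq_zero hroot s
  have hz0 : θ - (s : K) ≠ 0 := by
    intro h0
    rw [h0] at hsum
    simp [Finset.sum_range_succ] at hsum
    exact h.devCoeff_zero_ne hsum
  obtain ⟨d₀, d₁, d₂, d₃, d₄, -⟩ := devCoeff_quartic a b c s
  obtain ⟨z, hz⟩ : ∃ z : K, z = θ - s := ⟨_, rfl⟩
  rw [← hz] at hsum hz0
  have hzint : IsIntegral ℤ z := hz ▸ hθ.sub (hsint s)
  set g₁ : K := devCoeff (quartic a b c) s 2 + devCoeff (quartic a b c) s 3 * z + z ^ 2 with hg₁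
  set g₀ : K := devCoeff (quartic a b c) s 1 + devCoeff (quartic a b c) s 2 * z
    + devCoeff (quartic a b c) s 3 * z ^ 2 + z ^ 3 with hg₀
  have hg₁int : IsIntegral ℤ g₁ := ((hsint _).add ((hsint _).mul hzint)).add (hzint.pow 2)
  have hg₀int : IsIntegral ℤ g₀ :=
    (((hsint _).add ((hsint _).mul hzint)).add ((hsint _).mul (hzint.pow 2))).add (hzint.pow 3)
  have hfam : tripleBasis p θ a b s ν₁ ν₂ = ![1, θ, g₁ / (p : K) ^ ν₂, g₀ / (p : K) ^ ν₁] := by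
    have e₁ : θ ^ 2 + 2 * (s : K) * θ + 3 * (s : K) ^ 2 + (a : K) = g₁ := by
      rw [hg₁, d₂, d₃, hz]
      push_cast
      ring
    have e₀ : θ ^ 3 + (s : K) * θ ^ 2 + ((s : K) ^ 2 + (a : K)) * θ
        + (s : K) ^ 3 + (a : K) * (s : K) + (b : K) = g₀ := by
      rw [hg₀, d₁, d₂, d₃, hz]
      push_cast
      ring
    rw [tripleBasis, e₁, e₀]
  have hzsum := hsum
  simp only [Finset.sum_range_succ, Finset.sum_range_zero, d₄] at hzsum
  have hfilter : ∀ i ≤ 5, (Finset.range 5).filter (i ≤ ·) = Finset.Ico i 5 := by decide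
  have hfilter' : ∀ i ≤ 5, (Finset.range 5).filter (· < i) = Finset.range i := by decide
  have int₁ : IsIntegral ℤ (g₁ / (p : K) ^ ν₂) := by
    refine isIntegral_div_zpow h.prime hg₁int (x := α + β * (2 : ℕ)) ?_ fun P hv ↦ ?_
    · push_cast
      rw [← h₂, hν₂]
      exact Int.floor_le _
    · have hv0 := adicAbv_pos (K := K) P h.prime
      have hna := NumberField.HeightOneSpectrum.isNonarchimedean_adicAbv K P
      obtain ⟨l, -, hl, -⟩ := h.exists_map_derivative_eq hreg hna hv0 hv hz0
        (adicAbv_le_one_of_isIntegral P hzint) hsum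
      refine h.map_quotient_le hna hv0 hv hl hline ?_ ?_
      · rw [hfilter 2 (by norm_num), hg₁]
        simp [Finset.sum_Ico_succ_top, d₄]
        ring
      · rw [hfilter' 2 (by norm_num), hg₁]
        simp [Finset.sum_range_succ]
        simp at hzsum
        linear_combination hzsum
  have int₀ : IsIntegral ℤ (g₀ / (p : K) ^ ν₁) := by
    refine isIntegral_div_zpow h.prime hg₀int (x := α + β * (1 : ℕ)) ?_ fun P hv ↦ ?_
    · rw [Nat.cast_one, ← h₁, hν₁]
      exact Int.floor_le _
    · have hv0 := adicAbv_pos (K := K) P h.prime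
      have hna := NumberField.HeightOneSpectrum.isNonarchimedean_adicAbv K P
      obtain ⟨l, -, hl, -⟩ := h.exists_map_derivative_eq hreg hna hv0 hv hz0
        (adicAbv_le_one_of_isIntegral P hzint) hsum
      refine h.map_quotient_le hna hv0 hv hl hline ?_ ?_
      · rw [hfilter 1 (by norm_num), hg₀]
        simp [Finset.sum_Ico_succ_top, d₄]
        ring
      · rw [hfilter' 1 (by norm_num), hg₀]
        simp
        simp at hzsum
        linear_combination hzsum
  refine ⟨?_, linearIndependent_tripleBasis h.prime h.irr hroot ν₁ ν₂, fun x hx ↦ ?_⟩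
  · rw [hfam]
    intro i
    fin_cases i
    exacts [isIntegral_one, hθ, int₁, int₀]
  -- the bounds for the dual family
  have hN : ∀ n : ℕ, n ≤ 4 → ∀ c' l : ℝ, (∀ k, devCoeff (quartic a b c) s k ≠ 0 →
      c' ≤ devVal p (quartic a b c) s k + l * k) →
      c' ≤ newtonPolygon p (quartic a b c) s n + l * n := by
    intro n hn c' l hc'
    obtain ⟨y, hy⟩ := exists_mem_convexHull h (x := n) (by positivity) (by exact_mod_cast hn)
    have := le_newtonPolygon (α := c') (β := -l) hy fun k hk ↦ by
      have := hc' k hk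
      linarith
    linarith
  obtain ⟨m₀, hm₀, t₀⟩ := exists_dvd_trace_dual h hreg hroot (i := 0) (ν := ν₁)
    (x := newtonPolygon p (quartic a b c) s 1)
    (fun c' l hc' ↦ by simpa using hN 1 (by norm_num) c' l hc')
    (by rw [hν₁]; exact Int.lt_floor_add_one _)
  obtain ⟨m₁, hm₁, t₁⟩ := exists_dvd_trace_dual h hreg hroot (i := 1) (ν := ν₂)
    (x := newtonPolygon p (quartic a b c) s 2)
    (fun c' l hc' ↦ by simpa using hN 2 (by norm_num) c' l hc')
    (by rw [hν₂]; exact Int.lt_floor_add_one _)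
  obtain ⟨hw3, hw4⟩ := h.devVal_real
  -- The points of abscissas 3 and 4 have ordinate 0, so these two coordinates need no denominator.
  obtain ⟨m₂, hm₂, t₂⟩ := exists_dvd_trace_dual h hreg hroot (i := 2) (ν := 0) (x := 0)
    (fun c' l hc' ↦ by simpa [hw3] using hc' 3 h.devCoeff_three_ne) (by norm_num)
  obtain ⟨m₃, hm₃, t₃⟩ := exists_dvd_trace_dual h hreg hroot (i := 3) (ν := 0) (x := 0)
    (fun c' l hc' ↦ by simpa [hw4] using hc' 4 (by rw [d₄]; exact one_ne_zero)) (by norm_num)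
  obtain ⟨n₀, hn₀⟩ := t₀ x hx
  obtain ⟨n₁, hn₁⟩ := t₁ x hx
  obtain ⟨n₂, hn₂⟩ := t₂ x hx
  obtain ⟨n₃, hn₃⟩ := t₃ x hx
  have hexp := eq_sum_trace (s := s) h.irr hroot hgen hz rfl x
  rw [← hz] at hn₀ hn₁ hn₂ hn₃
  rw [← hg₀, ← hg₁] at hexp
  rw [pow_zero] at hn₀
  rw [pow_one] at hn₁
  rw [zpow_zero, one_mul] at hn₂ hn₃
  set T₀ := Algebra.trace ℚ K (x * (1 / aeval z (derivative (taylor s (quartic a b c)))))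
  set T₁ := Algebra.trace ℚ K (x * (z / aeval z (derivative (taylor s (quartic a b c)))))
  set T₂ := Algebra.trace ℚ K (x * (z ^ 2 / aeval z (derivative (taylor s (quartic a b c)))))
  set T₃ := Algebra.trace ℚ K (x * (z ^ 3 / aeval z (derivative (taylor s (quartic a b c)))))
  have hP := h.isPrime
  refine ⟨m₀ * m₁ * m₂ * m₃, fun hd ↦ ?_, ?_⟩
  · rcases hP.dvd_or_dvd hd with hd | hd
    · rcases hP.dvd_or_dvd hd with hd | hd
      · exact (hP.dvd_or_dvd hd).elim hm₀ hm₁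
      · exact hm₂ hd
    · exact hm₃ hd
  · have hpK : (p : K) ≠ 0 := by exact_mod_cast h.prime.ne_zero
    have k₀ := congrArg (algebraMap ℚ K) hn₀
    have k₁ := congrArg (algebraMap ℚ K) hn₁
    have k₂ := congrArg (algebraMap ℚ K) hn₂
    have k₃ := congrArg (algebraMap ℚ K) hn₃
    simp only [map_mul, map_intCast, map_zpow₀, map_natCast] at k₀ k₁ k₂ k₃
    have hmem : ∀ i, tripleBasis p θ a b s ν₁ ν₂ i ∈
        Submodule.span ℤ (Set.range (tripleBasis p θ a b s ν₁ ν₂)) :=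
      fun i ↦ Submodule.subset_span ⟨i, rfl⟩
    rw [hfam] at hmem ⊢
    -- The quotient 4s + z is θ + 3s, which explains the contribution 3s to the coefficient of 1.
    have e : (m₀ * m₁ * m₂ * m₃) • x =
        (m₀ * m₁ * m₂ * n₃ + m₀ * m₁ * m₃ * n₂ * (3 * s)) • (1 : K)
        + (m₀ * m₁ * m₃ * n₂) • θ + (m₀ * m₂ * m₃ * n₁) • (g₁ / (p : K) ^ ν₂)
        + (m₁ * m₂ * m₃ * n₀) • (g₀ / (p : K) ^ ν₁) := by
      simp only [Algebra.smul_def (R := ℚ), d₃] at hexp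
      simp only [zsmul_eq_mul]
      conv_lhs => rw [hexp]
      push_cast
      rw [← k₀, ← k₁, ← k₂, ← k₃, hz]
      field_simp
      ring
    rw [e]
    exact add_mem (add_mem (add_mem (Submodule.smul_mem _ _ (hmem 0))
      (Submodule.smul_mem _ _ (hmem 1))) (Submodule.smul_mem _ _ (hmem 2)))
      (Submodule.smul_mem _ _ (hmem 3))

end basis

end OreQuartic

/-! ### Assembling the statement -/

namespace OreQuartic

theorem emultiplicity_eq_padicValInt {p : ℕ} (hp : p.Prime) {A : ℤ} (hA : A ≠ 0) :
    emultiplicity (p : ℤ) A = padicValInt p A := by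
  rw [emultiplicity_eq_coe, pow_dvd_iff_le_padicValInt hp hA, pow_dvd_iff_le_padicValInt hp hA]
  omega

theorem isTripleRoot_of_modEq {p : ℕ} (hp : p.Prime) (hp3 : 3 < p) {a b c s : ℤ}
    (hirr : Irreducible (quartic a b c)) (hs : ¬ (p : ℤ) ∣ s) (ha : a ≡ -6 * s ^ 2 [ZMOD p])
    (hb : b ≡ 8 * s ^ 3 [ZMOD p]) (hc : c ≡ -3 * s ^ 4 [ZMOD p]) : IsTripleRoot p a b c s := by
  obtain ⟨x, hx⟩ := ha.symm.dvd
  obtain ⟨y, hy⟩ := hb.symm.dvd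
  obtain ⟨z, hz⟩ := hc.symm.dvd
  obtain ⟨e₀, e₁, e₂, -⟩ := devCoeff_quartic a b c s
  refine ⟨hp, hp3, hirr, hs, ?_, ?_, ?_⟩
  · rw [e₀]
    exact ⟨x * s ^ 2 + y * s + z, by linear_combination s ^ 2 * hx + s * hy + hz⟩
  · rw [e₁]
    exact ⟨2 * x * s + y, by linear_combination 2 * s * hx + hy⟩
  · rw [e₂]
    exact ⟨x, by linear_combination hx⟩

theorem floor_eq_floor_of_eq {x : ℝ} {q : ℚ} (h : x = q) : ⌊q⌋ = ⌊x⌋ := by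
  rw [h, Rat.floor_cast]

/-- The iteration method stops at a triple root satisfying `TwoAbove`. -/
theorem IsTripleRoot.not_exists_iterStep_seq {p : ℕ} {a b c s : ℤ} (h : IsTripleRoot p a b c s)
    (hA : TwoAbove p a b c s) :
    ¬ ∃ t : ℕ → ℤ, t 0 = s ∧ ∀ n, IterStep p (quartic a b c) (t n) (t (n + 1)) := by
  rintro ⟨t, rfl, ht⟩
  obtain ⟨δ, -, -, -, hδ⟩ := h.isIterate_of_iterStep hA (ht 0)
  exact hδ.not_forall_iterStep (fun n ↦ t (n + 1)) rfl fun n ↦ ht (n + 1)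

end OreQuartic

open OreQuartic in
theorem lemma4p2 (p : ℕ) (hp : p.Prime) (hp3 : 3 < p)
    (a b c : ℤ) (hirr : Irreducible (quartic a b c))
    {K : Type*} [Field K] [NumberField K] (θ : K)
    (hroot : aeval θ (quartic a b c) = 0)
    (hgen : IntermediateField.adjoin ℚ {θ} = ⊤)
    (Δ : ℕ) (hΔ : Δ = padicValInt p (quartic a b c).discr)
    (s₀ : ℤ) (hs₀ : ¬ (p : ℤ) ∣ s₀)
    (ha : a ≡ -6 * s₀ ^ 2 [ZMOD p]) (hb : b ≡ 8 * s₀ ^ 3 [ZMOD p])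
    (hc : c ≡ -3 * s₀ ^ 4 [ZMOD p])
    (hu₂ : (Δ : ℕ∞) < 6 * emultiplicity (p : ℤ) (a + 6 * s₀ ^ 2))
    -- `u₀` and `Δ` are finite since `f` is irreducible; `u₁` may be infinite
    (u₀ : ℕ) (hu₀ : u₀ = padicValInt p ((quartic a b c).eval s₀))
    (u₁ : ℕ∞) (hu₁ : u₁ = emultiplicity (p : ℤ) ((derivative (quartic a b c)).eval s₀))
    (σ₀ : ℤ) (hσ₀ : σ₀ = (quartic a b c).eval s₀ / (p : ℤ) ^ u₀)
    (σ₁ : ℤ) (hσ₁ : σ₁ = (derivative (quartic a b c)).eval s₀ / (p : ℤ) ^ u₁.toNat)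
    (ν₁ ν₂ : ℤ)
    (hν_lt : 2 * (u₀ : ℕ∞) < 3 * u₁ →
      ν₁ = ⌊(2 * (u₀ : ℚ)) / 3⌋ ∧ ν₂ = ⌊(u₀ : ℚ) / 3⌋)
    (hν_ge : 3 * u₁ ≤ 2 * (u₀ : ℕ∞) →
      ν₁ = ⌊((Δ : ℚ) - (u₁.toNat : ℚ)) / 2⌋ ∧ ν₂ = ⌊(u₁.toNat : ℚ) / 2⌋) :
    -- the irregularity criterion
    (¬ IsRegular p (quartic a b c) s₀ ↔
      2 * (u₀ : ℕ∞) = 3 * u₁ ∧ (p : ℤ) ∣ σ₁ ^ 3 + 27 * s₀ * σ₀ ^ 2) ∧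
    -- the iteration method starting at `s₀` can be continued as long as the iterate is irregular
    (∀ t : ℤ, Relation.ReflTransGen (IterStep p (quartic a b c)) s₀ t →
      ¬ IsRegular p (quartic a b c) t → ∃ t' : ℤ, IterStep p (quartic a b c) t t') ∧
    -- and it stops after finitely many steps, whatever choices are made
    (¬ ∃ t : ℕ → ℤ, t 0 = s₀ ∧ ∀ n, IterStep p (quartic a b c) (t n) (t (n + 1))) ∧
    -- any regular `s` it produces (`s = s₀` if `s₀` is regular) yields the `p`-integral basis
    (∀ s : ℤ, Relation.ReflTransGen (IterStep p (quartic a b c)) s₀ s →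
      IsRegular p (quartic a b c) s →
        ν₁ = ⌊newtonPolygon p (quartic a b c) s 1⌋ ∧
        ν₂ = ⌊newtonPolygon p (quartic a b c) s 2⌋ ∧
        IsPIntegralBasis p (tripleBasis p θ a b s ν₁ ν₂)) := by
  have h := isTripleRoot_of_modEq hp hp3 hirr hs₀ ha hb hc
  obtain ⟨e₀, e₁, e₂, -⟩ := devCoeff_quartic a b c s₀
  have hA : TwoAbove p a b c s₀ := by
    refine h.twoAbove_of_discr_lt fun hne ↦ ?_
    rw [add_comm, ← e₂, emultiplicity_eq_padicValInt hp hne, hΔ] at hu₂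
    exact_mod_cast hu₂
  rw [quartic_eval, ← e₀] at hu₀ hσ₀
  rw [quartic_derivative_eval, ← e₁] at hu₁ hσ₁
  -- If f'(s₀) = 0 then u₁ = ∞ and the inequality holds, whereas `devVal` is 0 there; hence the
  -- guard on the right.
  have hlt : 2 * (u₀ : ℕ∞) < 3 * u₁ ↔ (devCoeff (quartic a b c) s₀ 1 ≠ 0 →
      2 * devVal p (quartic a b c) s₀ 0 < 3 * devVal p (quartic a b c) s₀ 1) := by
    by_cases hne : devCoeff (quartic a b c) s₀ 1 = 0
    · rw [hu₁, hne, emultiplicity_zero, ENat.mul_top (by norm_num)]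
      simpa using ENat.natCast_lt_top (2 * u₀)
    · rw [hu₁, emultiplicity_eq_padicValInt hp hne, hu₀]
      simp only [ne_eq, hne, not_false_eq_true, forall_const, devVal]
      exact_mod_cast Iff.rfl
  have htoNat (hne : devCoeff (quartic a b c) s₀ 1 ≠ 0) :
      u₁.toNat = devVal p (quartic a b c) s₀ 1 := by
    rw [hu₁, emultiplicity_eq_padicValInt hp hne, ENat.toNat_natCast, devVal]
  refine ⟨?_, ?_, h.not_exists_iterStep_seq hA, ?_⟩
  · rw [h.not_isRegular_iff hA]
    by_cases hne : devCoeff (quartic a b c) s₀ 1 = 0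
    · have htop : 2 * (u₀ : ℕ∞) < 3 * u₁ := hlt.2 (absurd hne)
      simp [hne, htop.ne]
    · rw [hσ₀, hσ₁, htoNat hne, hu₁, emultiplicity_eq_padicValInt hp hne, hu₀]
      simp only [ne_eq, hne, not_false_eq_true, true_and, unitPart, devVal]
      norm_cast
  · intro t ht htreg
    rcases h.eq_or_isIterate hA ht with rfl | ⟨δ, -, -, -, hδ⟩
    · exact h.exists_iterStep hA htreg
    · exact hδ.exists_iterStep htreg
  · intro s hs hreg
    have key : IsTripleRoot p a b c s ∧ ∃ α β : ℝ, (∀ k, devCoeff (quartic a b c) s k ≠ 0 →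
        α + β * k ≤ devVal p (quartic a b c) s k) ∧
        newtonPolygon p (quartic a b c) s 1 = α + β * 1 ∧
        newtonPolygon p (quartic a b c) s 2 = α + β * 2 ∧
        ν₁ = ⌊α + β * 1⌋ ∧ ν₂ = ⌊α + β * 2⌋ := by
      rcases h.eq_or_isIterate hA hs with rfl | ⟨δ, h₀, hne, h₁, hδ⟩
      · by_cases hcase : 2 * (u₀ : ℕ∞) < 3 * u₁
        · obtain ⟨α, β, hline, hN₁, hN₂, hα, hβ⟩ := h.exists_line_of_lt hA (hlt.1 hcase)
          obtain ⟨hν₁, hν₂⟩ := hν_lt hcase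
          refine ⟨h, α, β, hline, hN₁, hN₂, ?_, ?_⟩
          · rw [hν₁, hu₀, mul_one, hα]
            exact floor_eq_floor_of_eq (by push_cast [devVal]; rfl)
          · rw [hν₂, hu₀, hβ]
            exact floor_eq_floor_of_eq (by push_cast [devVal]; rfl)
        · obtain ⟨hν₁, hν₂⟩ := hν_ge (not_lt.1 hcase)
          rw [hlt] at hcase
          push Not at hcase
          obtain ⟨α, β, hline, hN₁, hN₂, hα, hβ⟩ := h.exists_line_of_le hA hreg hcase.1 hcase.2
          refine ⟨h, α, β, hline, hN₁, hN₂, ?_, ?_⟩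
          · rw [hν₁, htoNat hcase.1, hΔ]
            exact floor_eq_floor_of_eq (by push_cast; linarith)
          · rw [hν₂, htoNat hcase.1, hβ]
            exact floor_eq_floor_of_eq (by push_cast; rfl)
      · obtain ⟨α, β, hline, hN₁, hN₂, hα, hβ⟩ := hδ.exists_line_of_isRegular hreg
        -- Having made a step forces u₀ = 3δ and u₁ = 2δ, so the second formula applies.
        obtain ⟨hν₁, hν₂⟩ := hν_ge <| by
          rw [← not_lt, hlt]
          intro hlt'
          have := hlt' hne
          omega
        refine ⟨hδ.tripleRoot, α, β, hline, hN₁, hN₂, ?_, ?_⟩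
        · rw [hν₁, htoNat hne, hΔ, h₁]
          exact floor_eq_floor_of_eq (by push_cast; linarith)
        · rw [hν₂, htoNat hne, h₁]
          exact floor_eq_floor_of_eq (by push_cast; linarith)
    obtain ⟨ht, α, β, hline, hN₁, hN₂, hν₁, hν₂⟩ := key
    rw [← hN₁] at hν₁
    rw [← hN₂] at hν₂
    refine ⟨hν₁, hν₂, ?_⟩
    rw [hν₁, hν₂]
    exact isPIntegralBasis_tripleBasis ht hreg hroot hgen hline hN₁ hN₂
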